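/- **Setting.** Let $N\ge 1$, let $d,L>0$, $\gamma\in\{1,2,\dots\}$, and let $G:\mathbb R^N\times(0,\infty)\to\mathbb R$ satisfy * $G\in C^\gamma(\mathbb R^N\times(0,\infty))$; * $G(x,t)=t^{-N/d}\,G(t^{-1/d}x,1)$ for $x\in\mathbb R^N$, $t>0$, and $\sup_{x}(1+|x|)^{N+L+j}|\nabla_x^jG(x,1)|<\infty$ for $j=0,\dots,\gamma$; * $G(x,t)=\int_{\mathbb R^N}G(x-y,t-s)G(y,s)\,dy$ for $x\in\mathbb R^N$, $t>s>0$. Write $[e^{t\mathcal L}\varphi](x)=\int_{\mathbb R^N} G(x-y,t)\varphi(y)\,dy$, $|||f|||_k=\int_{\mathbb R^N}|f(x)|(1+|x|^k)\,dx$, and let $L^1_k$ be the space of measurable $f$ with $|||f|||_k<\infty$; $\|\cdot\|_q$ is the norm of $L^q(\mathbb R^N)$, and $1/q=0$ for $q=\infty$. For multi-indices $\alpha$ put $$g_\alpha(x,t)=\frac{(-1)^{|\alpha|}}{\alpha!}\,\partial_x^\alpha G(x,t+1),$$ $$M_\alpha(f,t)=\int_{\mathbb R^N}x^\alpha f(x)\,dx-\sum_{\beta\le\alpha,\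 \beta\ne\alpha}M_\beta(f,t)\int_{\mathbb R^N}x^\alpha g_\beta(x,t)\,dx$$ (recursively in $\alpha$, so $M_0(f,t)=\int f\,dx$), and $[P_k(t)f](x)=f(x)-\sum_{|\alpha|\le k}M_\alpha(f,t)g_\alpha(x,t)$. Let $0\le K<L$ with $\lfloor K\rfloor+1\le\gamma$, and let $\varphi\in L^\infty(\mathbb R^N)\cap L^1_K$. Let $F:\mathbb R^N\times(0,\infty)\times\mathbb R\to\mathbb R$ be such that $F(\cdot,\cdot,v)$ is measurable for each $v\in\mathbb R$, $F(x,t,0)=0$, and $$|F(x,t,u_1)-F(x,t,u_2)|\le C_*(1+t)^A\max\{|u_1|^{p-1},|u_2|^{p-1}\}\,|u_1-u_2|$$ for all $x\in\mathbb R^N$, $t>0$, $u_1,u_2\in\mathbb R$, where $C_*>0$, $A\in\mathbb R$, $p\ge 1$ (with $0^0=1$), and assume $$A_p:=-A+\frac{N(p-1)}d-1>0 .$$ Let $u$ be a measurable function on $\mathbb R^N\times(0,\infty)$ such that $$u(x,t)=\int_{\mathbb R^N}G(x-y,t)\varphi(y)\,dy+\int_0^t\int_{\mathbb R^N}G(x-y,t-s)F(y,s,u(y,s))\,dy\,ds$$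 for all $x\in\mathbb R^N$, $t>0$, and, for every $q\in[1,\infty]$ and $\ell\in[0,K]$, $$\sup_{t>0}(1+t)^{\frac Nd(1-\frac1q)}\|u(t)\|_q+\sup_{t>0}(1+t)^{-\frac\ell d}|||u(t)|||_\ell<\infty .$$ Put $F(s)=F(\cdot,s,u(\cdot,s))$ and, for $|\alpha|\le K$, $$c_\alpha(t)=M_\alpha(\varphi,0)+\int_0^tM_\alpha(F(s),s)\,ds,$$ and define $U_n$ for $n=0,1,2,\dots$ inductively by $$U_0(x,t)=\sum_{|\alpha|\le K}c_\alpha(t)g_\alpha(x,t),\qquad U_{n+1}(x,t)=U_0(x,t)+\int_0^t\big[e^{(t-s)\mathcal L}P_K(s)F_n(s)\big](x)\,ds,$$ where $F_n(s)=F(\cdot,s,U_n(\cdot,s))$. **Theorem 5.1.** (i) Let $|\alpha|\le K$. Then $s\mapsto M_\alpha(F(s),s)$ is integrable on $(0,t)$ for every $t>0$. If $A_p>|\alpha|/d$, there is a constant $c_\alpha$ with $$|c_\alpha(t)-c_\alpha|=O(t^{-A_p+|\alpha|/d})\qquad(t\to\infty).$$ If $A_p<|\alpha|/d$, then $c_\alpha(t)=O(t^{-A_p+|\alpha|/d})$,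 and if $A_p=|\alpha|/d$, then $c_\alpha(t)=O(\log t)$, as $t\to\infty$. (ii) Let $n\in\{0,1,2,\dots\}$. For every $t>0$, $U_n(\cdot,t)$ is measurable. For every $x\in\mathbb R^N$ and $t>0$, the functions $(y,s)\mapsto G(x-y,t-s)[P_K(s)F_n(s)](y)$ and $(y,s)\mapsto G(x-y,t-s)F_n(s)(y)$ are integrable on $\mathbb R^N\times(0,t)$, the functions $s\mapsto M_\alpha(F(s)-F_n(s),s)$, $|\alpha|\le K$, are integrable on $(0,t)$, and $$U_{n+1}(x,t)=\sum_{|\alpha|\le K}\Big[M_\alpha(\varphi,0)+\int_0^tM_\alpha(F(s)-F_n(s),s)\,ds\Big]g_\alpha(x,t)+\int_0^t\big[e^{(t-s)\mathcal L}F_n(s)\big](x)\,ds .$$ Moreover, for every $q\in[1,\infty]$ and $\ell\in[0,K]$, $$\sup_{t>0}t^{\frac Nd(1-\frac1q)}\|U_n(t)\|_q+\sup_{t>0}(1+t)^{-\frac\ell d}|||U_n(t)|||_\ell<\infty$$ and, as $t\to\infty$, $$t^{\frac Nd(1-\frac1q)}\|u(t)-U_n(t)\|_q+t^{-\frac\ell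 d}|||u(t)-U_n(t)|||_\ell=\begin{cases}o(t^{-K/d})+O(t^{-(n+1)A_p})&\text{if }(n+1)A_p\ne K/d,\\[2pt] O(t^{-K/d}\log t)&\text{if }(n+1)A_p=K/d.\end{cases}$$ -/

import Mathlib

open MeasureTheory Filter Asymptotics
open scoped ENNReal

noncomputable section

namespace GenHeat

/-- The Euclidean space `ℝ^N`. -/
abbrev E (N : ℕ) : Type := EuclideanSpace ℝ (Fin N)

/-! ### Multi-indices -/

/-- The length `|α| = α₁ + ⋯ + α_N`. -/
def len {N : ℕ} (α : Fin N → ℕ) : ℕ := ∑ i, α i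

/-- `α! = α₁! ⋯ α_N!`. -/
def multiFact {N : ℕ} (α : Fin N → ℕ) : ℕ := ∏ i, (α i).factorial

/-- The monomial `x^α`. -/
def monom {N : ℕ} (α : Fin N → ℕ) (x : E N) : ℝ := ∏ i, x i ^ α i

/-- The finite set of multi-indices `α` with `|α| ≤ k` (for real `k ≥ 0`). -/
def multiIdx (N : ℕ) (k : ℝ) : Finset (Fin N → ℕ) :=
  (Fintype.piFinset fun _ : Fin N => Finset.range (⌊k⌋₊ + 1)).filter fun α => len α ≤ ⌊k⌋₊

theorem mem_multiIdx {N : ℕ} {k : ℝ} (hk : 0 ≤ k) (α : Fin N → ℕ) :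
    α ∈ multiIdx N k ↔ (len α : ℝ) ≤ k := by
  unfold multiIdx
  rw [Finset.mem_filter, Fintype.mem_piFinset, Nat.le_floor_iff hk]
  constructor
  · exact fun h => h.2
  · refine fun h => ⟨fun i => ?_, h⟩
    rw [Finset.mem_range, Nat.lt_succ_iff]
    exact le_trans (Finset.single_le_sum (f := α) (fun _ _ => Nat.zero_le _) (Finset.mem_univ i))
      ((Nat.le_floor_iff hk).2 h)

/-- The first-order partial derivative `∂f/∂x_i`. -/
def pderiv {N : ℕ} (i : Fin N) (f : E N → ℝ) : E N → ℝ :=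
  fun x => lineDeriv ℝ f x (EuclideanSpace.single i 1)

/-- `∂_x^α f = ∂₁^{α₁} (∂₂^{α₂} (⋯ ∂_N^{α_N} f))`. -/
def multiDeriv {N : ℕ} (α : Fin N → ℕ) (f : E N → ℝ) : E N → ℝ :=
  (List.finRange N).foldr (fun i h => (pderiv i)^[α i] h) f

/-! ### The kernel -/

/-- The standing condition on the integral kernel `G = G(x,t)`, for `x ∈ ℝ^N` and `t > 0`.
The values `G x t` for `t ≤ 0` are irrelevant. -/
structure KernelCondition {N : ℕ} (G : E N → ℝ → ℝ) (γ : ℕ) (d L : ℝ) : Prop where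
  /-- `G ∈ C^γ(ℝ^N × (0,∞))`. -/
  contDiffOn : ContDiffOn ℝ (γ : ℕ∞) (fun z : E N × ℝ => G z.1 z.2) (Set.univ ×ˢ Set.Ioi (0 : ℝ))
  /-- `G(x,t) = t^{-N/d} G(x / t^{1/d}, 1)`. -/
  selfSimilar : ∀ (x : E N) (t : ℝ), 0 < t →
    G x t = t ^ (-((N : ℝ) / d)) * G ((t ^ (1 / d))⁻¹ • x) 1
  /-- `sup_x (1 + |x|)^{N+L+j} |∇_x^j G(x,1)| < ∞` for `j = 0, …, γ`. -/
  decay : ∀ j : ℕ, j ≤ γ → ∃ C : ℝ, ∀ x : E N,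
    (1 + ‖x‖) ^ ((N : ℝ) + L + j) * ‖iteratedFDeriv ℝ j (fun y : E N => G y 1) x‖ ≤ C
  /-- `G(x,t) = ∫ G(x-y,t-s) G(y,s) dy` for `t > s > 0`. -/
  semigroup : ∀ (x : E N) (s t : ℝ), 0 < s → s < t →
    G x t = ∫ y : E N, G (x - y) (t - s) * G y s

/-- `[e^{tℒ} φ](x) = ∫ G(x-y,t) φ(y) dy`. -/
def evol {N : ℕ} (G : E N → ℝ → ℝ) (t : ℝ) (φ : E N → ℝ) (x : E N) : ℝ :=
  ∫ y : E N, G (x - y) t * φ y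

/-- `g_α(x,t) = ((-1)^{|α|} / α!) ∂_x^α g(x,t)`, where `g(x,t) = G(x,t+1)`. -/
def gker {N : ℕ} (G : E N → ℝ → ℝ) (α : Fin N → ℕ) (x : E N) (t : ℝ) : ℝ :=
  (-1) ^ len α / (multiFact α : ℝ) * multiDeriv α (fun z : E N => G z (t + 1)) x

/-- The moments `M_α(f,t)`, defined recursively by
`M_α(f,t) = ∫ x^α f(x) dx - ∑_{β ≤ α, β ≠ α} M_β(f,t) ∫ x^α g_β(x,t) dx`.
The index set `Finset.Iio α` is `{β : β ≤ α, β ≠ α}` for the componentwise order; it is empty for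
`α = 0`, so that `M_0(f,t) = ∫ f(x) dx`. -/
def moment {N : ℕ} (G : E N → ℝ → ℝ) (f : E N → ℝ) (t : ℝ) (α : Fin N → ℕ) : ℝ :=
  (∫ x : E N, monom α x * f x) -
    ∑ β : Finset.Iio α, moment G f t β.1 * ∫ x : E N, monom α x * gker G β.1 x t
termination_by len α
decreasing_by
  obtain ⟨h, i, hi⟩ := Pi.lt_def.1 (Finset.mem_Iio.1 β.2)
  exact Finset.sum_lt_sum (fun j _ => h j) ⟨i, Finset.mem_univ i, hi⟩

theorem moment_eq {N : ℕ} (G : E N → ℝ → ℝ) (f : E N → ℝ) (t : ℝ) (α : Fin N → ℕ) :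
    moment G f t α = (∫ x : E N, monom α x * f x) -
      ∑ β ∈ Finset.Iio α, moment G f t β * ∫ x : E N, monom α x * gker G β x t := by
  rw [moment]
  congr 1
  exact Finset.sum_coe_sort (Finset.Iio α)
    (fun β => moment G f t β * ∫ x : E N, monom α x * gker G β x t)

/-- `[P_k(t) f](x) = f(x) - ∑_{|α| ≤ k} M_α(f,t) g_α(x,t)`. -/
def proj {N : ℕ} (G : E N → ℝ → ℝ) (k t : ℝ) (f : E N → ℝ) (x : E N) : ℝ :=
  f x - ∑ α ∈ multiIdx N k, moment G f t α * gker G α x t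

/-! ### Norms -/

/-- `|||f|||_k = ∫ |f(x)| (1 + |x|^k) dx`, with values in `[0,∞]`. -/
def wnorm {N : ℕ} (k : ℝ) (f : E N → ℝ) : ℝ≥0∞ :=
  ∫⁻ x : E N, ‖f x‖ₑ * ENNReal.ofReal (1 + ‖x‖ ^ k)

/-- Membership in `L^1_k = L^1(ℝ^N, (1 + |x|^k) dx)`. -/
def MemL1k {N : ℕ} (k : ℝ) (f : E N → ℝ) : Prop :=
  AEStronglyMeasurable f volume ∧ wnorm k f < ∞

/-- The exponent `(N/d)(1 - 1/q)` for `q ∈ [1,∞]` (with `1/∞ = 0`). -/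
def qExp (N : ℕ) (d : ℝ) (q : ℝ≥0∞) : ℝ := (N : ℝ) / d * (1 - (q⁻¹).toReal)

/-- Lebesgue measure on `ℝ^N × (0,T]`. -/
def slab (N : ℕ) (T : ℝ) : Measure (E N × ℝ) :=
  (volume : Measure (E N)).prod (volume.restrict (Set.Ioc 0 T))

/-- Lebesgue measure on `ℝ^N × (0,∞)`. -/
def halfSpace (N : ℕ) : Measure (E N × ℝ) :=
  (volume : Measure (E N)).prod (volume.restrict (Set.Ioi 0))

/-! ### The integral equation and the approximations -/

/-- `u` satisfies, at every `x ∈ ℝ^N` and `t > 0`,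
`u(x,t) = ∫ G(x-y,t) φ(y) dy + ∫_0^t ∫ G(x-y,t-s) F(y,s,u(y,s)) dy ds`. -/
def IsSolution {N : ℕ} (G : E N → ℝ → ℝ) (F : E N → ℝ → ℝ → ℝ) (φ : E N → ℝ)
    (u : E N → ℝ → ℝ) : Prop :=
  ∀ (x : E N) (t : ℝ), 0 < t →
    u x t = (∫ y : E N, G (x - y) t * φ y) +
      ∫ s in (0 : ℝ)..t, ∫ y : E N, G (x - y) (t - s) * F y s (u y s)

/-- The function `y ↦ F(y,s,w(y,s))`. -/
def nonlin {N : ℕ} (F : E N → ℝ → ℝ → ℝ) (w : E N → ℝ → ℝ) (s : ℝ) (y : E N) : ℝ :=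
  F y s (w y s)

/-- `c_α(t) = M_α(φ,0) + ∫_0^t M_α(F(·,s,u(·,s)),s) ds`. -/
def coeff {N : ℕ} (G : E N → ℝ → ℝ) (F : E N → ℝ → ℝ → ℝ) (φ : E N → ℝ) (u : E N → ℝ → ℝ)
    (α : Fin N → ℕ) (t : ℝ) : ℝ :=
  moment G φ 0 α + ∫ s in (0 : ℝ)..t, moment G (nonlin F u s) s α

/-- The approximations: `U_0(x,t) = ∑_{|α| ≤ K} c_α(t) g_α(x,t)` and
`U_{n+1}(x,t) = U_0(x,t) + ∫_0^t [e^{(t-s)ℒ} P_K(s) F_n(s)](x) ds`,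
where `F_n(s) = F(·,s,U_n(·,s))`. -/
def approx {N : ℕ} (G : E N → ℝ → ℝ) (F : E N → ℝ → ℝ → ℝ) (φ : E N → ℝ) (u : E N → ℝ → ℝ)
    (K : ℝ) : ℕ → E N → ℝ → ℝ
  | 0 => fun x t => ∑ α ∈ multiIdx N K, coeff G F φ u α t * gker G α x t
  | n + 1 => fun x t =>
      (∑ α ∈ multiIdx N K, coeff G F φ u α t * gker G α x t) +
        ∫ s in (0 : ℝ)..t, evol G (t - s) (proj G K s (nonlin F (approx G F φ u K n) s)) x

/-- `t^{(N/d)(1-1/q)} ‖u(t) - U(t)‖_q + t^{-ℓ/d} |||u(t) - U(t)|||_ℓ`, with values in `[0,∞]`. -/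
def errNorm {N : ℕ} (d : ℝ) (q : ℝ≥0∞) (ℓ : ℝ) (u U : E N → ℝ → ℝ) (t : ℝ) : ℝ≥0∞ :=
  ENNReal.ofReal (t ^ qExp N d q) * eLpNorm (fun x => u x t - U x t) q volume +
    ENNReal.ofReal (t ^ (-(ℓ / d))) * wnorm ℓ (fun x => u x t - U x t)

end GenHeat

end

/-! Put a = (1+t)^{-1/d}. A single norm adapted to time t, a^{-N}‖f‖_∞ + ∫|f|(1+(a|x|)^K) dx
(`essNorm`), controls every L^q norm and every weighted norm in the theorem with the correct power
of t. So everything reduces to estimating u(t) - U_n(t) in this norm.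

The linear mechanism is cancellation of moments. Self-similarity and the semigroup identity force
∫G(·,1) = 1 unless G vanishes for all positive times (`KernelCondition.mass_eq_one_or`). Integration
by parts then shows that the matrix ∫x^α g_β is triangular with unit diagonal, so the recursion
defining M_α makes all moments of P_K(s)f of order at most K vanish
(`KernelCondition.integral_monom_proj`). Against such a function the kernel may be replaced by its
Taylor remainder, which is bounded by `rho` K (a|y|), the minimum of (a|y|)^K and (a|y|)^{⌊K⌋+1}.
Hence e^{(t-s)ℒ}P_K(s) gains the factor ((1+s)/(1+t))^{K/d}
(`KernelCondition.exists_supNorm_evol_proj_le`). Moreover a^{-K} rho(ar) is dominated by r^K and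
tends to 0 with a, so dominated convergence turns O(t^{-K/d}) into o(t^{-K/d}) whenever
∫∫|P_K(s)h(s)||y|^K is finite.

Differentiating the semigroup identity gives e^{(t-s)ℒ}g_α(s) = g_α(t)
(`KernelCondition.evol_gker`). Splitting off the projections in the integral equation therefore
leaves exactly the coefficients c_α(t), and u - U_0 = e^{tℒ}P_K(0)φ + ∫_0^t e^{(t-s)ℒ}P_K(s)F(s) ds;
for U_{n+1} the source F is replaced by F - F_n.

The growth condition on F makes the scaled norm of F(s) of order (1+s)^{-1-A_p}, and that of F - F_n
of order (1+s)^{-1-A_p} times the norm of u - U_n. A source of order (1+s)^{-1-b} contributes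
(1+t)^{-K/d}∫_0^t(1+s)^{K/d-b-1} ds, which is of order (1+t)^{-b} for b < K/d, carries a logarithm
for b = K/d, and is o(t^{-K/d}) after the refinement for b > K/d. Each iteration raises b by A_p
until K/d is passed (`Remainder.exists_rateBound`, `Setting.exists_remainder`).

The coefficients in (i) follow by integrating |M_α(F(s),s)| ≤ C(1+s)^{|α|/d-A_p-1}. -/

noncomputable section
namespace GenHeat
variable {N : ℕ}

/-! ### Iterated partial derivatives -/

/-- The partial derivatives along a list of coordinates. -/
def listDeriv (l : List (Fin N)) (f : E N → ℝ) : E N → ℝ := l.foldr pderiv f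

/-- The list of coordinates in which `i` occurs `α i` times. -/
def idxList (α : Fin N → ℕ) : List (Fin N) :=
  (List.finRange N).flatMap fun i => List.replicate (α i) i

theorem listDeriv_append (l l' : List (Fin N)) (f : E N → ℝ) :
    listDeriv (l ++ l') f = listDeriv l (listDeriv l' f) := by
  simp [listDeriv, List.foldr_append]

theorem listDeriv_replicate (i : Fin N) (n : ℕ) (f : E N → ℝ) :
    listDeriv (List.replicate n i) f = (pderiv i)^[n] f := by
  induction n with
  | zero => rfl
  | succ n ih =>
    rw [Function.iterate_succ_apply', ← ih, List.replicate_succ]; rfl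

/-- Flattening the nested iterates into one list of coordinates lets all later arguments proceed by
induction on a single derivative at a time. -/
theorem multiDeriv_eq_listDeriv (α : Fin N → ℕ) (f : E N → ℝ) :
    multiDeriv α f = listDeriv (idxList α) f := by
  unfold multiDeriv idxList
  induction List.finRange N with
  | nil => rfl
  | cons i l ih =>
    rw [List.foldr_cons, ih, List.flatMap_cons, listDeriv_append, listDeriv_replicate]

theorem count_idxList (α : Fin N → ℕ) (i : Fin N) : (idxList α).count i = α i := by
  unfold idxList
  rw [List.count_flatMap]
  have : (List.count i ∘ fun j => List.replicate (α j) j) = fun j => if j = i then α i else 0 := by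
    funext j
    by_cases h : j = i
    · subst h; simp
    · simp [List.count_replicate, h]
  rw [this, ← List.ofFn_id, List.map_ofFn, List.sum_ofFn]
  simp

theorem length_idxList (α : Fin N → ℕ) : (idxList α).length = len α := by
  unfold idxList len
  rw [List.length_flatMap, ← List.ofFn_id, List.map_ofFn, List.sum_ofFn]
  simp

/-- `f` is of class `C^m` and its derivatives up to order `m` are `O((1 + |x|)^{-r})`. -/
structure DecayC (r : ℝ) (m : ℕ) (f : E N → ℝ) : Prop where
  contDiff : ContDiff ℝ m f
  bound : ∀ j ≤ m, ∃ C : ℝ, ∀ x, ‖iteratedFDeriv ℝ j f x‖ ≤ C * (1 + ‖x‖) ^ (-r)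

theorem DecayC.mono {r : ℝ} {m n : ℕ} {f : E N → ℝ} (h : DecayC r m f) (hn : n ≤ m) :
    DecayC r n f :=
  ⟨h.contDiff.of_le (by exact_mod_cast hn), fun j hj => h.bound j (hj.trans hn)⟩

theorem DecayC.continuous {r : ℝ} {m : ℕ} {f : E N → ℝ} (h : DecayC r m f) : Continuous f :=
  h.contDiff.continuous

theorem DecayC.differentiable {r : ℝ} {m : ℕ} {f : E N → ℝ} (h : DecayC r (m + 1) f) :
    Differentiable ℝ f :=
  h.contDiff.differentiable (by simp)

theorem DecayC.exists_bound {r : ℝ} {m : ℕ} {f : E N → ℝ} (h : DecayC r m f) :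
    ∃ C : ℝ, 0 ≤ C ∧ ∀ x, |f x| ≤ C * (1 + ‖x‖) ^ (-r) := by
  obtain ⟨C, hC⟩ := h.bound 0 (Nat.zero_le _)
  refine ⟨|C|, abs_nonneg _, fun x => ?_⟩
  have := hC x
  rw [norm_iteratedFDeriv_zero, Real.norm_eq_abs] at this
  exact this.trans (mul_le_mul_of_nonneg_right (le_abs_self C) (by positivity))

theorem pderiv_eq_fderiv {f : E N → ℝ} (hf : Differentiable ℝ f) (i : Fin N) :
    pderiv i f = fun x => fderiv ℝ f x (EuclideanSpace.single i 1) := by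
  funext x
  exact (hf x).lineDeriv_eq_fderiv

/-- Evaluation at a unit vector is a continuous linear map of norm at most one, so the bound on the
derivative of order j + 1 passes to the partial derivative with the same constant. -/
theorem DecayC.pderiv {r : ℝ} {m : ℕ} {f : E N → ℝ} (h : DecayC r (m + 1) f) (i : Fin N) :
    DecayC r m (pderiv i f) := by
  rw [pderiv_eq_fderiv h.differentiable]
  have hc : ContDiff ℝ m (fderiv ℝ f) :=
    h.contDiff.fderiv_right (m := m) (by push_cast; exact le_rfl)
  refine ⟨hc.clm_apply contDiff_const, fun j hj => ?_⟩
  obtain ⟨C, hC⟩ := h.bound (j + 1) (by omega)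
  refine ⟨C, fun x => ?_⟩
  have := (ContinuousLinearMap.apply ℝ ℝ
    (EuclideanSpace.single i (1 : ℝ) : E N)).norm_iteratedFDeriv_comp_left
      (f := fderiv ℝ f) (x := x) hc.contDiffAt (by exact_mod_cast hj)
  have h1 : ‖ContinuousLinearMap.apply ℝ ℝ (EuclideanSpace.single i (1 : ℝ) : E N)‖ ≤ 1 := by
    refine ContinuousLinearMap.opNorm_le_bound _ zero_le_one fun T => ?_
    have := T.le_opNorm (EuclideanSpace.single i (1 : ℝ) : E N)
    simpa using this
  rw [norm_iteratedFDeriv_fderiv] at this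
  refine (this.trans (mul_le_of_le_one_left (norm_nonneg _) h1)).trans (hC x)

theorem DecayC.listDeriv {r : ℝ} {m : ℕ} {f : E N → ℝ} :
    ∀ (l : List (Fin N)), DecayC r (m + l.length) f → DecayC r m (listDeriv l f)
  | [], h => h
  | i :: l, h => (DecayC.listDeriv (m := m + 1) l
      (by rw [List.length_cons] at h; rwa [show m + 1 + l.length = m + (l.length + 1) by ring])).pderiv i

theorem DecayC.multiDeriv {r : ℝ} {m n : ℕ} {f : E N → ℝ} (h : DecayC r n f) (α : Fin N → ℕ)
    (hn : m + len α ≤ n) : DecayC r m (multiDeriv α f) := by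
  rw [multiDeriv_eq_listDeriv]
  exact DecayC.listDeriv _ (h.mono (by rwa [length_idxList]))

/-! ### Derivatives of dilations and convolutions -/

theorem pderiv_smul_comp (i : Fin N) (c a : ℝ) (f : E N → ℝ) :
    pderiv i (fun z => c * f (a • z)) = fun x => (c * a) * pderiv i f (a • x) := by
  funext x
  unfold pderiv lineDeriv
  rw [deriv_const_mul_field]
  have := deriv_comp_mul_left a (fun t : ℝ => f (a • x + t • EuclideanSpace.single i (1 : ℝ))) 0
  simp only [smul_add, smul_smul, mul_zero, smul_eq_mul] at this ⊢
  rw [this, mul_assoc]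

theorem listDeriv_smul_comp (l : List (Fin N)) (c a : ℝ) (f : E N → ℝ) :
    listDeriv l (fun z => c * f (a • z)) =
      fun x => (c * a ^ l.length) * listDeriv l f (a • x) := by
  induction l with
  | nil => funext x; simp [listDeriv]
  | cons i l ih =>
    change pderiv i (listDeriv l _) = _
    rw [ih, pderiv_smul_comp]
    funext x
    rw [List.length_cons, pow_succ, ← mul_assoc]; rfl

theorem multiDeriv_smul_comp (α : Fin N → ℕ) (c a : ℝ) (f : E N → ℝ) :
    multiDeriv α (fun z => c * f (a • z)) =
      fun x => (c * a ^ len α) * multiDeriv α f (a • x) := by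
  rw [multiDeriv_eq_listDeriv, multiDeriv_eq_listDeriv, listDeriv_smul_comp, length_idxList]

theorem DecayC.bounded {r : ℝ} {m : ℕ} {f : E N → ℝ} (h : DecayC r m f) (hr : 0 ≤ r) :
    ∃ C : ℝ, 0 ≤ C ∧ ∀ x, |f x| ≤ C := by
  obtain ⟨C, hC0, hC⟩ := h.exists_bound
  refine ⟨C, hC0, fun x => (hC x).trans (mul_le_of_le_one_right hC0 ?_)⟩
  exact Real.rpow_le_one_of_one_le_of_nonpos (by linarith [norm_nonneg x]) (by linarith)

/-- Differentiation under the integral sign, dominated by |k| times the supremum of the partial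
derivative. Boundedness of f and its derivative is enough, hence only r ≥ 0. -/
theorem pderiv_conv {r : ℝ} (hr : 0 ≤ r) {f k : E N → ℝ} (hf : DecayC r 1 f) (hk : Integrable k)
    (i : Fin N) :
    pderiv i (fun x => ∫ y, k y * f (x - y)) = fun x => ∫ y, k y * pderiv i f (x - y) := by
  funext x
  obtain ⟨C, hC0, hC⟩ := hf.bounded hr
  obtain ⟨D, hD0, hD⟩ := (DecayC.pderiv (m := 0) hf i).bounded hr
  have hfc := hf.continuous
  have hpc := (DecayC.pderiv (m := 0) hf i).continuous
  have hmeas : ∀ (g : E N → ℝ) (_ : Continuous g) (z : E N),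
      AEStronglyMeasurable (fun y => k y * g (z - y)) volume := fun g hg z =>
    hk.aestronglyMeasurable.mul (by fun_prop)
  have key := hasDerivAt_integral_of_dominated_loc_of_deriv_le (μ := (volume : Measure (E N)))
    (F := fun (t : ℝ) y => k y * f (x + t • EuclideanSpace.single i (1 : ℝ) - y))
    (F' := fun (t : ℝ) y => k y * pderiv i f (x + t • EuclideanSpace.single i (1 : ℝ) - y))
    (x₀ := 0) (s := Set.univ) (bound := fun y => |k y| * D) Filter.univ_mem
    (Eventually.of_forall fun t => hmeas f hfc _)
    ?_ (hmeas _ hpc _) ?_ ?_ ?_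
  · have := key.2.deriv
    unfold pderiv lineDeriv at *
    rw [this]
    simp
  · refine (hk.abs.mul_const C).mono' (hmeas f hfc _) (Eventually.of_forall fun y => ?_)
    rw [Real.norm_eq_abs, abs_mul]
    exact mul_le_mul_of_nonneg_left (hC _) (abs_nonneg _)
  · refine Eventually.of_forall fun y t _ => ?_
    rw [Real.norm_eq_abs, abs_mul]
    exact mul_le_mul_of_nonneg_left (hD _) (abs_nonneg _)
  · exact hk.abs.mul_const D
  · refine Eventually.of_forall fun y t _ => HasDerivAt.const_mul _ ?_
    rw [pderiv_eq_fderiv (DecayC.differentiable (m := 0) hf)]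
    have h1 : HasDerivAt (fun t : ℝ => x + t • EuclideanSpace.single i (1 : ℝ) - y)
        (EuclideanSpace.single i (1 : ℝ) : E N) t := by
      simpa using (((hasDerivAt_id t).smul_const
        (EuclideanSpace.single i (1 : ℝ) : E N)).const_add x).sub_const y
    exact ((DecayC.differentiable (m := 0) hf _).hasFDerivAt).comp_hasDerivAt t h1

theorem listDeriv_conv {r : ℝ} (hr : 0 ≤ r) {f k : E N → ℝ} (hk : Integrable k) :
    ∀ l : List (Fin N), DecayC r l.length f →
      listDeriv l (fun x => ∫ y, k y * f (x - y)) = fun x => ∫ y, k y * listDeriv l f (x - y)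
  | [], _ => rfl
  | i :: l, h => by
    change pderiv i (listDeriv l _) = _
    rw [listDeriv_conv hr hk l (h.mono (by simp)), pderiv_conv hr _ hk]
    · rfl
    · exact DecayC.listDeriv l (by rw [add_comm]; simpa using h)

theorem multiDeriv_conv {r : ℝ} (hr : 0 ≤ r) {f k : E N → ℝ} (hk : Integrable k)
    (α : Fin N → ℕ) (h : DecayC r (len α) f) :
    multiDeriv α (fun x => ∫ y, k y * f (x - y)) = fun x => ∫ y, k y * multiDeriv α f (x - y) := by
  simp only [multiDeriv_eq_listDeriv]
  exact listDeriv_conv hr hk _ (by rwa [length_idxList])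

/-! ### Monomials and integration by parts -/

theorem continuous_monom (α : Fin N → ℕ) : Continuous (monom α) := by
  unfold monom; fun_prop

theorem abs_monom_le (α : Fin N → ℕ) (x : E N) : |monom α x| ≤ ‖x‖ ^ len α := by
  unfold monom len
  rw [Finset.abs_prod, ← Finset.prod_pow_eq_pow_sum]
  refine Finset.prod_le_prod (fun _ _ => abs_nonneg _) fun i _ => ?_
  rw [abs_pow]
  exact pow_le_pow_left₀ (abs_nonneg _) (by simpa using PiLp.norm_apply_le x i) _

theorem monom_smul (α : Fin N → ℕ) (a : ℝ) (x : E N) : monom α (a • x) = a ^ len α * monom α x := by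
  unfold monom len
  rw [← Finset.prod_pow_eq_pow_sum, ← Finset.prod_mul_distrib]
  exact Finset.prod_congr rfl fun i _ => by simp [mul_pow]

/-- Only the i-th factor varies along the i-th axis. When α i = 0 the coefficient vanishes, so the
truncated subtraction in the exponent is harmless. -/
theorem hasLineDerivAt_monom (α : Fin N → ℕ) (i : Fin N) (x : E N) :
    HasLineDerivAt ℝ (monom α) (α i * monom (α - Pi.single i 1) x) x
      (EuclideanSpace.single i 1) := by
  unfold HasLineDerivAt
  have h1 : (fun t : ℝ => monom α (x + t • EuclideanSpace.single i (1 : ℝ))) =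
      fun t => (x i + t) ^ α i * ∏ j ∈ Finset.univ.erase i, x j ^ α j := by
    funext t
    unfold monom
    rw [← Finset.mul_prod_erase _ _ (Finset.mem_univ i)]
    congr 1
    · simp
    · refine Finset.prod_congr rfl fun j hj => ?_
      simp [Finset.ne_of_mem_erase hj]
  have h2 : monom (α - Pi.single i 1) x =
      x i ^ (α i - 1) * ∏ j ∈ Finset.univ.erase i, x j ^ α j := by
    unfold monom
    rw [← Finset.mul_prod_erase _ _ (Finset.mem_univ i)]
    congr 1
    · simp
    · refine Finset.prod_congr rfl fun j hj => ?_
      simp [Finset.ne_of_mem_erase hj]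
  rw [h1, h2]
  have := (((hasDerivAt_id (0 : ℝ)).const_add (x i)).pow (α i)).mul_const
    (∏ j ∈ Finset.univ.erase i, x j ^ α j)
  simpa [mul_assoc] using this

theorem integrable_one_add_norm_neg {r : ℝ} (hr : (N : ℝ) < r) :
    Integrable (fun x : E N => (1 + ‖x‖) ^ (-r)) :=
  integrable_one_add_norm (by simpa using hr)

theorem integrable_monom_mul {r : ℝ} {m : ℕ} {f : E N → ℝ} (hf : DecayC r m f) (α : Fin N → ℕ)
    (hα : N + len α < r) : Integrable (fun x => monom α x * f x) := by
  obtain ⟨C, hC0, hC⟩ := hf.exists_bound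
  refine ((integrable_one_add_norm_neg (N := N) (r := r - len α) (by linarith)).const_mul C).mono'
    ((continuous_monom α).mul hf.continuous).aestronglyMeasurable (Eventually.of_forall fun x => ?_)
  have h1 : (0 : ℝ) < 1 + ‖x‖ := by positivity
  rw [Real.norm_eq_abs, abs_mul, show -(r - len α) = (len α : ℝ) + -r by ring, Real.rpow_add h1,
    Real.rpow_natCast, mul_left_comm]
  refine mul_le_mul ((abs_monom_le α x).trans ?_) (hC x) (abs_nonneg _) (by positivity)
  exact pow_le_pow_left₀ (norm_nonneg _) (by linarith) _

theorem len_sub_single_le (α : Fin N → ℕ) (i : Fin N) : len (α - Pi.single i 1) ≤ len α :=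
  Finset.sum_le_sum fun _ _ => Nat.sub_le _ _

/-- Integration by parts without boundary terms: N + |α| < r makes all the products involved
integrable. -/
theorem integral_monom_mul_pderiv {r : ℝ} {f : E N → ℝ} (hf : DecayC r 1 f) (α : Fin N → ℕ)
    (hα : N + len α < r) (i : Fin N) :
    ∫ x, monom α x * pderiv i f x = -(α i * ∫ x, monom (α - Pi.single i 1) x * f x) := by
  have hle : (len (α - Pi.single i 1) : ℝ) ≤ len α := by exact_mod_cast len_sub_single_le α i
  have key := integral_bilinear_hasLineDerivAt_right_eq_neg_left_of_integrable
    (μ := (volume : Measure (E N))) (B := ContinuousLinearMap.mul ℝ ℝ)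
    (f := monom α) (f' := fun x => α i * monom (α - Pi.single i 1) x) (g := f) (g' := pderiv i f)
    (v := EuclideanSpace.single i 1) ?_ ?_ ?_ (fun x _ => hasLineDerivAt_monom α i x)
    (fun x _ => (DecayC.differentiable (m := 0) hf x).lineDifferentiableAt.hasLineDerivAt)
  · simp only [ContinuousLinearMap.mul_apply', mul_assoc] at key
    rw [key, integral_const_mul]
  · simp only [ContinuousLinearMap.mul_apply', mul_assoc]
    exact (integrable_monom_mul hf _ (by linarith)).const_mul _
  · exact integrable_monom_mul (DecayC.pderiv (m := 0) hf i) α hα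
  · exact integrable_monom_mul hf α hα

/-- Each integration by parts lowers one exponent and brings down its current value, so the
exponents accumulate falling factorials. These vanish once an exponent is exhausted, which is the
source of the triangular structure of the moments of the g_β. -/
theorem integral_monom_mul_listDeriv {r : ℝ} {f : E N → ℝ} (l : List (Fin N)) :
    ∀ (α : Fin N → ℕ), N + len α < r → DecayC r l.length f →
      ∫ x, monom α x * listDeriv l f x = (-1) ^ l.length *
        (∏ i, (α i).descFactorial (l.count i) : ℕ) *
        ∫ x, monom (fun i => α i - l.count i) x * f x := by
  induction l with
  | nil => intro α _ _; simp [listDeriv]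
  | cons j l ih =>
    intro α hα hf
    have hle : (len (α - Pi.single j 1) : ℝ) ≤ len α := by exact_mod_cast len_sub_single_le α j
    change ∫ x, monom α x * pderiv j (listDeriv l f) x = _
    rw [integral_monom_mul_pderiv (DecayC.listDeriv l (by rw [add_comm]; simpa using hf)) α hα,
      ih _ (by linarith) (hf.mono (by simp))]
    have h1 : (fun i => (α - Pi.single j 1 : Fin N → ℕ) i - l.count i) = fun i => α i - (j :: l).count i := by
      funext i
      by_cases h : i = j
      · subst h; simp; omega
      · simp [h, Ne.symm h]
    have h2 : ∏ i, (α i).descFactorial ((j :: l).count i) =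
        α j * ∏ i, ((α - Pi.single j 1 : Fin N → ℕ) i).descFactorial (l.count i) := by
      rw [← Finset.mul_prod_erase _ _ (Finset.mem_univ j)]
      refine Eq.trans ?_ (congrArg (α j * ·) (Finset.mul_prod_erase Finset.univ
        (fun i => ((α - Pi.single j 1 : Fin N → ℕ) i).descFactorial (l.count i))
        (Finset.mem_univ j)))
      rw [← mul_assoc]
      congr 1
      · simp only [List.count_cons_self, Pi.sub_apply, Pi.single_eq_same]
        cases α j with
        | zero => simp
        | succ n => rw [Nat.succ_descFactorial_succ, Nat.add_sub_cancel]
      · refine Finset.prod_congr rfl fun i hi => ?_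
        have hi := Finset.ne_of_mem_erase hi
        simp [hi, Ne.symm hi]
    rw [h1, h2, List.length_cons, pow_succ]
    push_cast
    ring

theorem integral_monom_mul_multiDeriv_self {r : ℝ} {f : E N → ℝ} (α : Fin N → ℕ)
    (hα : N + len α < r) (hf : DecayC r (len α) f) :
    ∫ x, monom α x * multiDeriv α f x = (-1) ^ len α * multiFact α * ∫ x, f x := by
  rw [multiDeriv_eq_listDeriv, integral_monom_mul_listDeriv _ α hα (by rwa [length_idxList])]
  simp [count_idxList, length_idxList, Nat.descFactorial_self, multiFact, monom]

/-- Some coordinate is differentiated more often than its exponent allows, and its falling factorial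
is zero. -/
theorem integral_monom_mul_multiDeriv_of_not_le {r : ℝ} {f : E N → ℝ} (α β : Fin N → ℕ)
    (hα : N + len α < r) (hf : DecayC r (len β) f) (h : ¬ β ≤ α) :
    ∫ x, monom α x * multiDeriv β f x = 0 := by
  rw [multiDeriv_eq_listDeriv, integral_monom_mul_listDeriv _ α hα (by rwa [length_idxList])]
  obtain ⟨i, hi⟩ : ∃ i, α i < β i := by simpa [Pi.le_def] using h
  rw [Finset.prod_eq_zero (Finset.mem_univ i)]
  · simp
  · rw [count_idxList, Nat.descFactorial_eq_zero_iff_lt]; exact hi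

end GenHeat
end
noncomputable section
namespace GenHeat
variable {N : ℕ}

/-! ### Taylor expansion of the profile -/

/-- The Taylor polynomial of degree `k` of `y ↦ f (x - y)` at `y = 0`. -/
def taylorPoly (f : E N → ℝ) (k : ℕ) (x y : E N) : ℝ :=
  ∑ j ∈ Finset.range (k + 1), ((j.factorial : ℝ))⁻¹ * iteratedFDeriv ℝ j f x (fun _ => -y)

/-- The remainder of the Taylor polynomial. -/
def taylorRem (f : E N → ℝ) (k : ℕ) (x y : E N) : ℝ := f (x - y) - taylorPoly f k x y

theorem iteratedDeriv_comp_line {m : ℕ} {f : E N → ℝ} (hf : ContDiff ℝ m f) (x v : E N) :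
    ∀ j ≤ m, iteratedDeriv j (fun θ : ℝ => f (x + θ • v)) =
      fun θ => iteratedFDeriv ℝ j f (x + θ • v) (fun _ => v)
  | 0, _ => by funext θ; simp
  | j + 1, hj => by
    rw [iteratedDeriv_succ, iteratedDeriv_comp_line hf x v j (by omega)]
    funext θ
    have h1 : HasDerivAt (fun t : ℝ => x + t • v) v θ := by
      simpa using ((hasDerivAt_id θ).smul_const v).const_add x
    have h2 := ((hf.differentiable_iteratedFDeriv (m := j)
      (by exact_mod_cast hj)) (x + θ • v)).hasFDerivAt.comp_hasDerivAt θ h1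
    have h3 := (ContinuousMultilinearMap.apply ℝ (fun _ : Fin j => E N) ℝ
      (fun _ => v)).hasFDerivAt.comp_hasDerivAt θ h2
    rw [iteratedFDeriv_succ_apply_left]
    exact h3.deriv

/-- The one-variable Lagrange remainder, applied to the restriction of f to the segment from x to x
- y. -/
theorem exists_taylorRem_eq {k : ℕ} {f : E N → ℝ} (hf : ContDiff ℝ (k + 1 : ℕ) f) (x y : E N) :
    ∃ θ ∈ Set.Ioo (0 : ℝ) 1, taylorRem f k x y =
      iteratedFDeriv ℝ (k + 1) f (x + θ • (-y)) (fun _ => -y) / (k + 1).factorial := by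
  have hc : ContDiff ℝ (k + 1 : ℕ) (fun θ : ℝ => f (x + θ • (-y))) := by fun_prop
  obtain ⟨θ, hθ, h⟩ := taylor_mean_remainder_lagrange_iteratedDeriv (n := k)
    (f := fun θ : ℝ => f (x + θ • (-y))) (zero_ne_one' ℝ) (by exact_mod_cast hc.contDiffOn)
  refine ⟨θ, by simpa [Set.uIoo_of_lt] using hθ, ?_⟩
  rw [iteratedDeriv_comp_line hf x (-y) (k + 1) le_rfl, taylor_within_apply] at h
  simp only [sub_zero, one_pow, mul_one] at h
  rw [← h, taylorRem, taylorPoly]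
  congr 1
  · rw [one_smul, sub_eq_add_neg]
  · refine Finset.sum_congr rfl fun j hj => ?_
    have hj : j ≤ k + 1 := (Finset.mem_range.1 hj).le
    rw [iteratedDerivWithin_eq_iteratedDeriv (uniqueDiffOn_uIcc (zero_ne_one' ℝ))
      (hc.of_le (by exact_mod_cast hj)).contDiffAt (by simp),
      iteratedDeriv_comp_line hf x (-y) j hj]
    simp

/-- The Lagrange remainder is evaluated at an unknown point within distance one of x; there the
decay weight agrees with that at x up to the factor 2^r. -/
theorem one_add_norm_rpow_neg_le {r : ℝ} (hr : 0 ≤ r) {x z : E N} (h : ‖x‖ ≤ ‖z‖ + 1) :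
    (1 + ‖z‖) ^ (-r) ≤ 2 ^ r * (1 + ‖x‖) ^ (-r) := by
  have hx : 0 < 1 + ‖x‖ := by positivity
  have hz : 0 < 1 + ‖z‖ := by positivity
  have h1 : (1 + ‖x‖) / 2 ≤ 1 + ‖z‖ := by linarith [norm_nonneg z]
  refine (Real.rpow_le_rpow_of_nonpos (by positivity) h1 (by linarith)).trans (le_of_eq ?_)
  rw [Real.div_rpow hx.le zero_le_two, Real.rpow_neg zero_le_two, div_inv_eq_mul, mul_comm]

theorem exists_abs_taylorRem_le_of_norm_le_one {r : ℝ} (hr : 0 ≤ r) {k : ℕ} {f : E N → ℝ}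
    (hf : DecayC r (k + 1) f) : ∃ C : ℝ, 0 ≤ C ∧ ∀ x y : E N, ‖y‖ ≤ 1 →
      |taylorRem f k x y| ≤ C * ‖y‖ ^ (k + 1) * (1 + ‖x‖) ^ (-r) := by
  obtain ⟨C, hC⟩ := hf.bound (k + 1) le_rfl
  refine ⟨|C| * 2 ^ r, by positivity, fun x y hy => ?_⟩
  obtain ⟨θ, hθ, h⟩ := exists_taylorRem_eq hf.contDiff x y
  rw [h, abs_div, Nat.abs_cast]
  refine (div_le_self (abs_nonneg _) (by exact_mod_cast Nat.factorial_pos _)).trans ?_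
  refine ((iteratedFDeriv ℝ (k + 1) f (x + θ • (-y))).le_opNorm _).trans ?_
  rw [Finset.prod_const, Finset.card_univ, Fintype.card_fin, norm_neg]
  have h1 : ‖x‖ ≤ ‖x + θ • (-y)‖ + 1 := by
    have h2 : ‖θ • (-y)‖ ≤ 1 := by
      rw [norm_smul, norm_neg, Real.norm_eq_abs, abs_of_pos hθ.1]
      exact mul_le_one₀ hθ.2.le (norm_nonneg _) hy
    have := norm_sub_le (x + θ • (-y)) (θ • (-y))
    rw [add_sub_cancel_right] at this
    linarith
  have h2 := one_add_norm_rpow_neg_le hr h1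
  calc _ ≤ (|C| * (2 ^ r * (1 + ‖x‖) ^ (-r))) * ‖y‖ ^ (k + 1) := by
        refine mul_le_mul_of_nonneg_right ((hC _).trans ?_) (by positivity)
        exact mul_le_mul (le_abs_self C) h2 (by positivity) (abs_nonneg _)
    _ = _ := by ring

/-- For |y| ≥ 1 the top power |y|^k dominates all the others. -/
theorem exists_abs_taylorPoly_le {r : ℝ} {k : ℕ} {f : E N → ℝ} (hf : DecayC r k f) :
    ∃ C : ℝ, 0 ≤ C ∧ ∀ x y : E N, 1 ≤ ‖y‖ →
      |taylorPoly f k x y| ≤ C * ‖y‖ ^ k * (1 + ‖x‖) ^ (-r) := by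
  have : ∀ j : ℕ, ∃ C : ℝ, j ≤ k → ∀ x, ‖iteratedFDeriv ℝ j f x‖ ≤ C * (1 + ‖x‖) ^ (-r) := by
    intro j
    by_cases hj : j ≤ k
    · obtain ⟨C, hC⟩ := hf.bound j hj
      exact ⟨C, fun _ => hC⟩
    · exact ⟨0, fun h => absurd h hj⟩
  choose C hC using this
  refine ⟨∑ j ∈ Finset.range (k + 1), |C j|, Finset.sum_nonneg fun _ _ => abs_nonneg _,
    fun x y hy => ?_⟩
  rw [taylorPoly, Finset.sum_mul, Finset.sum_mul]
  refine (Finset.abs_sum_le_sum_abs _ _).trans (Finset.sum_le_sum fun j hj => ?_)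
  have hj : j ≤ k := Nat.lt_succ_iff.1 (Finset.mem_range.1 hj)
  rw [abs_mul, abs_inv, Nat.abs_cast]
  refine (mul_le_of_le_one_left (abs_nonneg _)
    (inv_le_one_of_one_le₀ (by exact_mod_cast Nat.factorial_pos _))).trans ?_
  refine ((iteratedFDeriv ℝ j f x).le_opNorm _).trans ?_
  rw [Finset.prod_const, Finset.card_univ, Fintype.card_fin, norm_neg, mul_right_comm]
  refine mul_le_mul ((hC j hj x).trans (mul_le_mul_of_nonneg_right (le_abs_self _)
    (by positivity))) (pow_le_pow_right₀ hy hj) (by positivity) (by positivity)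

/-- The gain function of the Taylor remainder. -/
def rho (K : ℝ) (s : ℝ) : ℝ := min (s ^ K) (s ^ (⌊K⌋₊ + 1))

theorem rho_nonneg (K : ℝ) {s : ℝ} (hs : 0 ≤ s) : 0 ≤ rho K s :=
  le_min (by positivity) (by positivity)

theorem rho_le_rpow (K s : ℝ) : rho K s ≤ s ^ K := min_le_left _ _

theorem rho_le_pow (K s : ℝ) : rho K s ≤ s ^ (⌊K⌋₊ + 1) := min_le_right _ _

theorem rho_mono {K : ℝ} (hK : 0 ≤ K) {s t : ℝ} (hs : 0 ≤ s) (h : s ≤ t) : rho K s ≤ rho K t :=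
  min_le_min (Real.rpow_le_rpow hs h hK) (pow_le_pow_left₀ hs h _)

theorem measurable_rho (K : ℝ) : Measurable (rho K) := by
  unfold rho; fun_prop

/-- Since K < ⌊K⌋ + 1, the integer power is the smaller one on [0,1] and the K-th power is the
smaller one beyond 1. This and the next two bounds identify which branch of the minimum is active.
-/
theorem pow_le_rho {K : ℝ} {s : ℝ} (hs : 0 ≤ s) (h : s ≤ 1) : s ^ (⌊K⌋₊ + 1) ≤ rho K s := by
  refine le_min ?_ le_rfl
  rw [← Real.rpow_natCast]
  rcases hs.eq_or_lt with rfl | hs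
  · rw [Real.zero_rpow (by positivity)]; positivity
  · exact Real.rpow_le_rpow_of_exponent_ge hs h (by push_cast; exact (Nat.lt_floor_add_one K).le)

theorem rpow_le_rho {K : ℝ} {s : ℝ} (h : 1 ≤ s) : s ^ K ≤ rho K s := by
  refine le_min le_rfl ?_
  rw [← Real.rpow_natCast]
  exact Real.rpow_le_rpow_of_exponent_le h (by push_cast; exact (Nat.lt_floor_add_one K).le)

theorem pow_floor_le_rho {K : ℝ} (hK : 0 ≤ K) {s : ℝ} (h : 1 ≤ s) : s ^ ⌊K⌋₊ ≤ rho K s := by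
  refine le_trans ?_ (rpow_le_rho h)
  rw [← Real.rpow_natCast]
  exact Real.rpow_le_rpow_of_exponent_le h (Nat.floor_le hK)

/-- For |y| ≤ 1 the Lagrange form applies. For |y| > 1 the polynomial and f(x - y) are bounded
separately; the second keeps its own term because it decays away from y and not away from the
origin. -/
theorem exists_abs_taylorRem_le {r K : ℝ} (hr : 0 ≤ r) (hK : 0 ≤ K) {f : E N → ℝ}
    (hf : DecayC r (⌊K⌋₊ + 1) f) : ∃ C : ℝ, 0 ≤ C ∧ ∀ x y : E N,
      |taylorRem f ⌊K⌋₊ x y| ≤ C * rho K ‖y‖ * (1 + ‖x‖) ^ (-r) +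
        (if 1 < ‖y‖ then C * (1 + ‖x - y‖) ^ (-r) else 0) := by
  obtain ⟨C₁, h₁, H₁⟩ := exists_abs_taylorRem_le_of_norm_le_one hr hf
  obtain ⟨C₂, h₂, H₂⟩ := exists_abs_taylorPoly_le (hf.mono (Nat.le_succ _))
  obtain ⟨C₃, h₃, H₃⟩ := hf.exists_bound
  refine ⟨C₁ + C₂ + C₃, by positivity, fun x y => ?_⟩
  have hρ := rho_nonneg K (norm_nonneg y)
  split_ifs with hy
  · have h4 := H₂ x y hy.le
    have h5 := H₃ (x - y)
    have h6 : |taylorRem f ⌊K⌋₊ x y| ≤ _ := abs_sub _ _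
    refine h6.trans ?_
    rw [add_comm]
    refine add_le_add (h4.trans ?_) (h5.trans ?_)
    · refine mul_le_mul_of_nonneg_right ?_ (by positivity)
      exact mul_le_mul (by linarith) (pow_floor_le_rho hK hy.le) (by positivity) (by positivity)
    · exact mul_le_mul_of_nonneg_right (by linarith) (by positivity)
  · rw [add_zero]
    push Not at hy
    refine (H₁ x y hy).trans (mul_le_mul_of_nonneg_right ?_ (by positivity))
    exact mul_le_mul (by linarith) (pow_le_rho (norm_nonneg _) hy) (by positivity) (by positivity)

/-- The pointwise bound for the Taylor remainder. -/
theorem exists_abs_taylorRem_le_rho {r K : ℝ} (hr : 0 ≤ r) (hK : 0 ≤ K) {f : E N → ℝ}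
    (hf : DecayC r (⌊K⌋₊ + 1) f) : ∃ C : ℝ, 0 ≤ C ∧ ∀ x y : E N,
      |taylorRem f ⌊K⌋₊ x y| ≤ C * rho K ‖y‖ := by
  obtain ⟨C, hC, H⟩ := exists_abs_taylorRem_le hr hK hf
  refine ⟨2 * C, by positivity, fun x y => (H x y).trans ?_⟩
  have hρ := rho_nonneg K (norm_nonneg y)
  have hle : ∀ z : E N, (1 + ‖z‖) ^ (-r) ≤ 1 := fun z =>
    Real.rpow_le_one_of_one_le_of_nonpos (by linarith [norm_nonneg z]) (by linarith)
  have h1 : C * rho K ‖y‖ * (1 + ‖x‖) ^ (-r) ≤ C * rho K ‖y‖ :=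
    mul_le_of_le_one_right (by positivity) (hle x)
  have h2 : (if 1 < ‖y‖ then C * (1 + ‖x - y‖) ^ (-r) else 0) ≤ C * rho K ‖y‖ := by
    split_ifs with hy
    · refine mul_le_mul_of_nonneg_left ((hle _).trans ?_) hC
      exact (Real.one_le_rpow hy.le hK).trans (rpow_le_rho hy.le)
    · positivity
  linarith

/-- c is at most twice the larger of a and b. This makes the weight 1 + |x|^K submultiplicative up
to 2^K, so that weighted norms of convolutions factor. -/
theorem one_add_norm_add_rpow_le {K : ℝ} (hK : 0 ≤ K) {a b c : ℝ} (ha : 0 ≤ a) (hb : 0 ≤ b)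
    (hc : 0 ≤ c) (h : c ≤ a + b) : 1 + c ^ K ≤ 2 ^ K * ((1 + a ^ K) * (1 + b ^ K)) := by
  have h2 : (1 : ℝ) ≤ 2 ^ K := Real.one_le_rpow one_le_two hK
  have ha' : 0 ≤ a ^ K := by positivity
  have hb' : 0 ≤ b ^ K := by positivity
  have h3 : c ^ K ≤ 2 ^ K * (a ^ K + b ^ K) := by
    rcases le_total a b with hab | hab
    · refine (Real.rpow_le_rpow hc (by linarith : c ≤ 2 * b) hK).trans ?_
      rw [Real.mul_rpow zero_le_two hb]
      exact mul_le_mul_of_nonneg_left (by linarith) (by positivity)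
    · refine (Real.rpow_le_rpow hc (by linarith : c ≤ 2 * a) hK).trans ?_
      rw [Real.mul_rpow zero_le_two ha]
      exact mul_le_mul_of_nonneg_left (by linarith) (by positivity)
  nlinarith [mul_nonneg ha' hb']

/-- The weighted mass `∫ (1 + |x|)^{-r} (1 + |x|^K) dx`. -/
def weightMass (N : ℕ) (r K : ℝ) : ℝ≥0∞ :=
  ∫⁻ x : E N, ENNReal.ofReal ((1 + ‖x‖) ^ (-r) * (1 + ‖x‖ ^ K))

theorem weightMass_lt_top {r K : ℝ} (hK : 0 ≤ K) (h : N + K < r) : weightMass N r K < ∞ := by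
  have h1 := (integrable_one_add_norm_neg (N := N) (r := r - K) (by linarith)).const_mul 2
  refine lt_of_le_of_lt (lintegral_mono fun x => ENNReal.ofReal_le_ofReal ?_)
    h1.lintegral_lt_top
  have h2 : (0 : ℝ) < 1 + ‖x‖ := by positivity
  rw [show -(r - K) = -r + K by ring, Real.rpow_add h2, mul_left_comm]
  refine mul_le_mul_of_nonneg_left ?_ (by positivity)
  have h3 : ‖x‖ ^ K ≤ (1 + ‖x‖) ^ K := Real.rpow_le_rpow (norm_nonneg _) (by linarith) hK
  have h4 : 1 ≤ (1 + ‖x‖) ^ K := Real.one_le_rpow (by linarith [norm_nonneg x]) hK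
  linarith

theorem lintegral_translate_weight_le {r K : ℝ} (hK : 0 ≤ K) (y : E N) :
    ∫⁻ x : E N, ENNReal.ofReal ((1 + ‖x - y‖) ^ (-r) * (1 + ‖x‖ ^ K)) ≤
      ENNReal.ofReal (2 ^ K * (1 + ‖y‖ ^ K)) * weightMass N r K := by
  rw [weightMass, ← lintegral_add_right_eq_self _ y, ← lintegral_const_mul' _ _ ENNReal.ofReal_ne_top]
  refine lintegral_mono fun x => ?_
  rw [← ENNReal.ofReal_mul (by positivity)]
  refine ENNReal.ofReal_le_ofReal ?_
  rw [add_sub_cancel_right]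
  have := one_add_norm_add_rpow_le hK (norm_nonneg x) (norm_nonneg y) (norm_nonneg (x + y))
    (norm_add_le x y)
  calc _ ≤ (1 + ‖x‖) ^ (-r) * (2 ^ K * ((1 + ‖x‖ ^ K) * (1 + ‖y‖ ^ K))) :=
        mul_le_mul_of_nonneg_left this (by positivity)
    _ = _ := by ring

/-- The weighted integral bound for the Taylor remainder. -/
theorem exists_lintegral_taylorRem_le_rho {r K : ℝ} (hK : 0 ≤ K) (hr : N + K < r)
    {f : E N → ℝ} (hf : DecayC r (⌊K⌋₊ + 1) f) : ∃ C : ℝ, 0 ≤ C ∧ ∀ y : E N,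
      ∫⁻ x, ‖taylorRem f ⌊K⌋₊ x y‖ₑ * ENNReal.ofReal (1 + ‖x‖ ^ K) ≤
        ENNReal.ofReal (C * rho K ‖y‖) := by
  have hN : (0 : ℝ) ≤ N := Nat.cast_nonneg N
  obtain ⟨C, hC, H⟩ := exists_abs_taylorRem_le (by linarith) hK hf
  set J := (weightMass N r K).toReal with hJ
  have hJ' : weightMass N r K = ENNReal.ofReal J :=
    (ENNReal.ofReal_toReal (weightMass_lt_top hK hr).ne).symm
  have hJ0 : 0 ≤ J := ENNReal.toReal_nonneg
  have h2K : (0 : ℝ) ≤ 2 ^ K := by positivity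
  refine ⟨C * J + C * (2 ^ K * 2) * J, by positivity, fun y => ?_⟩
  have hρ := rho_nonneg K (norm_nonneg y)
  calc _ ≤ ∫⁻ x : E N, (ENNReal.ofReal (C * rho K ‖y‖) *
          ENNReal.ofReal ((1 + ‖x‖) ^ (-r) * (1 + ‖x‖ ^ K)) +
          ENNReal.ofReal (if 1 < ‖y‖ then C else 0) *
            ENNReal.ofReal ((1 + ‖x - y‖) ^ (-r) * (1 + ‖x‖ ^ K))) := by
        refine lintegral_mono fun x => ?_
        rw [← ENNReal.ofReal_mul (by positivity),
          ← ENNReal.ofReal_mul (by split_ifs <;> positivity),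
          ← ENNReal.ofReal_add (by positivity) (by split_ifs <;> positivity),
          Real.enorm_eq_ofReal_abs, ← ENNReal.ofReal_mul (abs_nonneg _)]
        refine ENNReal.ofReal_le_ofReal ?_
        refine (mul_le_mul_of_nonneg_right (H x y) (by positivity)).trans (le_of_eq ?_)
        split_ifs <;> ring
    _ = ENNReal.ofReal (C * rho K ‖y‖) * weightMass N r K +
          ENNReal.ofReal (if 1 < ‖y‖ then C else 0) *
            ∫⁻ x : E N, ENNReal.ofReal ((1 + ‖x - y‖) ^ (-r) * (1 + ‖x‖ ^ K)) := by
        rw [lintegral_add_left (by fun_prop), lintegral_const_mul' _ _ ENNReal.ofReal_ne_top,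
          lintegral_const_mul' _ _ ENNReal.ofReal_ne_top, weightMass]
    _ ≤ ENNReal.ofReal (C * rho K ‖y‖) * weightMass N r K +
          ENNReal.ofReal (if 1 < ‖y‖ then C else 0) *
            (ENNReal.ofReal (2 ^ K * (1 + ‖y‖ ^ K)) * weightMass N r K) := by
        gcongr
        exact lintegral_translate_weight_le hK y
    _ ≤ _ := by
        rw [hJ', ← ENNReal.ofReal_mul (by positivity), ← ENNReal.ofReal_mul (by positivity),
          ← ENNReal.ofReal_mul (by split_ifs <;> positivity),
          ← ENNReal.ofReal_add (by positivity) (by split_ifs <;> positivity)]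
        refine ENNReal.ofReal_le_ofReal ?_
        -- Translating the mass to y costs 1 + |y|^K, and this happens only for |y| > 1, where the
        -- cost is at most twice `rho`.
        have : (if 1 < ‖y‖ then C else 0) * (2 ^ K * (1 + ‖y‖ ^ K) * J) ≤
            C * (2 ^ K * 2) * J * rho K ‖y‖ := by
          split_ifs with hy
          · have h1 : 1 + ‖y‖ ^ K ≤ 2 * rho K ‖y‖ := by
              have := rpow_le_rho (K := K) hy.le
              have := Real.one_le_rpow hy.le hK
              linarith
            calc C * (2 ^ K * (1 + ‖y‖ ^ K) * J) ≤ C * (2 ^ K * (2 * rho K ‖y‖) * J) := by gcongr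
              _ = _ := by ring
          · rw [zero_mul]; positivity
        calc _ ≤ C * rho K ‖y‖ * J + C * (2 ^ K * 2) * J * rho K ‖y‖ := by linarith
          _ = _ := by ring

/-! ### Vanishing moments annihilate the Taylor polynomial -/

theorem prod_apply_eq_monom {j : ℕ} (e : Fin j → Fin N) (y : E N) :
    ∏ i, y (e i) = monom (fun a => (Finset.univ.filter fun i => e i = a).card) y := by
  unfold monom
  rw [← Finset.prod_fiberwise_of_maps_to (s := Finset.univ) (t := Finset.univ) (g := e)
    (fun _ _ => Finset.mem_univ _)]
  refine Finset.prod_congr rfl fun a _ => ?_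
  rw [Finset.prod_congr rfl (g := fun _ => y a), Finset.prod_const]
  intro i hi
  rw [(Finset.mem_filter.1 hi).2]

theorem len_card_fiber {j : ℕ} (e : Fin j → Fin N) :
    len (fun a => (Finset.univ.filter fun i => e i = a).card) = j := by
  unfold len
  rw [← Finset.card_eq_sum_card_fiberwise (s := Finset.univ) (t := Finset.univ) (f := e)
    (fun _ _ => Finset.mem_univ _)]
  simp

/-- Expanding y in the standard basis turns each term of the Taylor polynomial into a combination of
monomials of degree j in y; the multi-index records how often each basis vector is chosen. Vanishing
moments therefore annihilate the whole polynomial. -/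
theorem multilinear_diag_eq_sum_monom {j : ℕ} (T : ContinuousMultilinearMap ℝ (fun _ : Fin j => E N) ℝ)
    (y : E N) :
    T (fun _ => y) = ∑ e : Fin j → Fin N,
      monom (fun a => (Finset.univ.filter fun i => e i = a).card) y *
        T (fun i => EuclideanSpace.single (e i) 1) := by
  have hy : y = ∑ a, y a • (EuclideanSpace.single a (1 : ℝ) : E N) := by
    ext i
    simp [Pi.single_apply]
  have h1 : (fun _ : Fin j => y) = fun _ => ∑ a, y a • (EuclideanSpace.single a (1 : ℝ) : E N) :=
    funext fun _ => hy
  rw [h1, T.map_sum]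
  refine Finset.sum_congr rfl fun e _ => ?_
  rw [T.map_smul_univ, prod_apply_eq_monom, smul_eq_mul]

theorem integral_taylorPoly_mul_eq_zero (f : E N → ℝ) (k : ℕ) (x : E N) (a : ℝ) {h : E N → ℝ}
    (hint : ∀ α : Fin N → ℕ, len α ≤ k → Integrable (fun y => monom α y * h y))
    (h0 : ∀ α : Fin N → ℕ, len α ≤ k → ∫ y, monom α y * h y = 0) :
    Integrable (fun y => taylorPoly f k x (a • y) * h y) ∧
      ∫ y, taylorPoly f k x (a • y) * h y = 0 := by
  have hexp : (fun y => taylorPoly f k x (a • y) * h y) = fun y =>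
      ∑ j ∈ Finset.range (k + 1), ∑ e : Fin j → Fin N,
        (((j.factorial : ℝ))⁻¹ * (-a) ^ j *
          iteratedFDeriv ℝ j f x (fun i => EuclideanSpace.single (e i) 1)) *
          (monom (fun a => (Finset.univ.filter fun i => e i = a).card) y * h y) := by
    funext y
    rw [taylorPoly, Finset.sum_mul]
    refine Finset.sum_congr rfl fun j _ => ?_
    rw [multilinear_diag_eq_sum_monom, Finset.mul_sum, Finset.sum_mul]
    refine Finset.sum_congr rfl fun e _ => ?_
    rw [← neg_smul, monom_smul, len_card_fiber]
    ring
  have hlen : ∀ j ∈ Finset.range (k + 1), ∀ e : Fin j → Fin N,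
      len (fun a => (Finset.univ.filter fun i => e i = a).card) ≤ k := fun j hj e => by
    rw [len_card_fiber]; exact Nat.lt_succ_iff.1 (Finset.mem_range.1 hj)
  rw [hexp]
  constructor
  · exact integrable_finsetSum _ fun j hj => integrable_finsetSum _ fun e _ =>
      (hint _ (hlen j hj e)).const_mul _
  · rw [integral_finsetSum _ fun j hj => integrable_finsetSum _ fun e _ =>
      (hint _ (hlen j hj e)).const_mul _]
    refine Finset.sum_eq_zero fun j hj => ?_
    rw [integral_finsetSum _ fun e _ => (hint _ (hlen j hj e)).const_mul _]
    refine Finset.sum_eq_zero fun e _ => ?_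
    rw [integral_const_mul, h0 _ (hlen j hj e), mul_zero]

end GenHeat
end
noncomputable section
namespace GenHeat
variable {N : ℕ}

/-! ### Scaling -/

/-- The spatial scaling factor `t^{-1/d}`. -/
def scl (d t : ℝ) : ℝ := t ^ (-(1 / d))

theorem scl_pos {d t : ℝ} (ht : 0 < t) : 0 < scl d t := Real.rpow_pos_of_pos ht _

theorem scl_rpow {d t : ℝ} (ht : 0 < t) (K : ℝ) : scl d t ^ K = t ^ (-(K / d)) := by
  rw [scl, ← Real.rpow_mul ht.le]; congr 1; ring

theorem scl_pow {d t : ℝ} (ht : 0 < t) (n : ℕ) : scl d t ^ n = t ^ (-((n : ℝ) / d)) := by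
  rw [← Real.rpow_natCast, scl_rpow ht]

theorem scl_anti {d s t : ℝ} (hd : 0 < d) (hs : 0 < s) (h : s ≤ t) : scl d t ≤ scl d s :=
  Real.rpow_le_rpow_of_nonpos hs h (by rw [neg_nonpos]; positivity)

theorem lintegral_scale {a : ℝ} (ha : 0 < a) (f : E N → ℝ≥0∞) :
    ∫⁻ x, ENNReal.ofReal (a ^ N) * f (a • x) = ∫⁻ x, f x := by
  have h1 := lintegral_map_equiv (μ := (volume : Measure (E N))) f
    (Homeomorph.smul (isUnit_iff_ne_zero.2 ha.ne').unit).toMeasurableEquiv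
  have h2 : Measure.map (Homeomorph.smul (isUnit_iff_ne_zero.2 ha.ne').unit).toMeasurableEquiv
      (volume : Measure (E N)) = ENNReal.ofReal |(a ^ N)⁻¹| • volume := by
    have := Measure.map_addHaar_smul (volume : Measure (E N)) ha.ne'
    rw [finrank_euclideanSpace_fin] at this
    exact this
  rw [h2, lintegral_smul_measure] at h1
  rw [lintegral_const_mul' _ _ ENNReal.ofReal_ne_top]
  have h3 : ∫⁻ x, f (a • x) = ENNReal.ofReal |(a ^ N)⁻¹| * ∫⁻ x, f x := h1.symm
  rw [h3, ← mul_assoc, ← ENNReal.ofReal_mul (by positivity), abs_of_pos (by positivity),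
    mul_inv_cancel₀ (by positivity), ENNReal.ofReal_one, one_mul]

theorem integral_scale {a : ℝ} (ha : 0 < a) (f : E N → ℝ) :
    ∫ x, a ^ N * f (a • x) = ∫ x, f x := by
  rw [integral_const_mul, Measure.integral_comp_smul, finrank_euclideanSpace_fin, smul_eq_mul,
    ← mul_assoc, abs_of_pos (by positivity), mul_inv_cancel₀ (by positivity), one_mul]

/-- The exponent drops to 0: differentiating a convolution needs only bounded derivatives. -/
theorem DecayC.smul_comp {r : ℝ} {m : ℕ} {f : E N → ℝ} (h : DecayC r m f) (hr : 0 ≤ r)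
    (c a : ℝ) : DecayC 0 m (fun z => c * f (a • z)) := by
  have hc := h.contDiff
  have hc' : ContDiff ℝ m (fun z => f (a • z)) := by fun_prop
  refine ⟨by fun_prop, fun j hj => ?_⟩
  obtain ⟨C, hC⟩ := h.bound j hj
  refine ⟨|c| * (|C| * ∏ _i : Fin j, ‖a • ContinuousLinearMap.id ℝ (E N)‖), fun x => ?_⟩
  have h1 := ContinuousLinearMap.iteratedFDeriv_comp_right (a • ContinuousLinearMap.id ℝ (E N))
    hc x (i := j) (by exact_mod_cast hj)
  have h2 : iteratedFDeriv ℝ j (fun z => c * f (a • z)) x =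
      c • iteratedFDeriv ℝ j (f ∘ (a • ContinuousLinearMap.id ℝ (E N))) x :=
    iteratedFDeriv_const_smul_apply (a := c)
      ((hc'.of_le (by exact_mod_cast hj : (j : WithTop ℕ∞) ≤ m)).contDiffAt)
  rw [neg_zero, Real.rpow_zero, mul_one, h2, norm_smul, Real.norm_eq_abs, h1]
  refine mul_le_mul_of_nonneg_left ?_ (abs_nonneg _)
  refine (ContinuousMultilinearMap.norm_compContinuousLinearMap_le _ _).trans ?_
  refine mul_le_mul_of_nonneg_right ((hC _).trans ?_)
    (Finset.prod_nonneg fun _ _ => norm_nonneg _)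
  refine (mul_le_mul_of_nonneg_right (le_abs_self C) (by positivity)).trans ?_
  exact mul_le_of_le_one_right (abs_nonneg _) (Real.rpow_le_one_of_one_le_of_nonpos
    (le_add_of_nonneg_right (norm_nonneg _)) (by linarith))

/-! ### The kernel and its derivatives -/

section Kernel
variable {G : E N → ℝ → ℝ} {γ : ℕ} {d L : ℝ}

/-- The profile `G(·,1)`. -/
def profile (G : E N → ℝ → ℝ) : E N → ℝ := fun y => G y 1

/-- The additional decay of order j in the j-th derivative is discarded; the common exponent N + L
suffices throughout because K < L. -/
theorem KernelCondition.decayC (hG : KernelCondition G γ d L) :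
    DecayC (N + L) γ (profile G) := by
  refine ⟨?_, fun j hj => ?_⟩
  · have h1 : ContDiff ℝ γ (fun y : E N => (y, (1 : ℝ))) := by fun_prop
    have := hG.contDiffOn.comp_contDiff h1 (fun y => by simp)
    exact this
  · obtain ⟨C, hC⟩ := hG.decay j hj
    refine ⟨|C|, fun x => ?_⟩
    have h1 : (0 : ℝ) < 1 + ‖x‖ := by positivity
    rw [Real.rpow_neg h1.le, ← div_eq_mul_inv, le_div_iff₀ (by positivity), mul_comm]
    refine le_trans ?_ ((hC x).trans (le_abs_self C))
    refine mul_le_mul_of_nonneg_right ?_ (norm_nonneg _)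
    exact Real.rpow_le_rpow_of_exponent_le (by linarith [norm_nonneg x])
      (le_add_of_nonneg_right (Nat.cast_nonneg j))

theorem KernelCondition.eq_profile (hG : KernelCondition G γ d L) {t : ℝ} (ht : 0 < t) (x : E N) :
    G x t = scl d t ^ N * profile G (scl d t • x) := by
  rw [hG.selfSimilar x t ht, scl_pow ht, profile, scl, Real.rpow_neg ht.le (1 / d)]

theorem KernelCondition.continuousOn (hG : KernelCondition G γ d L) :
    ContinuousOn (fun z : E N × ℝ => G z.1 z.2) (Set.univ ×ˢ Set.Ioi (0 : ℝ)) :=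
  hG.contDiffOn.continuousOn

theorem KernelCondition.continuous (hG : KernelCondition G γ d L) {t : ℝ} (ht : 0 < t) :
    Continuous fun x => G x t := by
  have h := hG.decayC.continuous
  simp_rw [hG.eq_profile ht]
  fun_prop

theorem KernelCondition.profile_integrable (hG : KernelCondition G γ d L) (hL : 0 < L) :
    Integrable (profile G) := by
  have := integrable_monom_mul hG.decayC (0 : Fin N → ℕ) (by simp [len, hL])
  simpa [monom] using this

theorem KernelCondition.integrable (hG : KernelCondition G γ d L) (hL : 0 < L) {t : ℝ}
    (ht : 0 < t) : Integrable fun x => G x t := by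
  simp_rw [hG.eq_profile ht]
  exact ((hG.profile_integrable hL).comp_smul (scl_pos ht).ne').const_mul _

theorem KernelCondition.exists_bound (hG : KernelCondition G γ d L) (hL : 0 < L) :
    ∃ C : ℝ, 0 ≤ C ∧ ∀ x, ∀ t : ℝ, 0 < t → |G x t| ≤ C * scl d t ^ N := by
  obtain ⟨C, hC0, hC⟩ := hG.decayC.bounded (by positivity)
  refine ⟨C, hC0, fun x t ht => ?_⟩
  have := scl_pos (d := d) ht
  rw [hG.eq_profile ht, abs_mul, abs_of_pos (by positivity), mul_comm C]
  exact mul_le_mul_of_nonneg_left (hC _) (by positivity)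

/-- Substituting y = s^{1/d}z in the semigroup identity and letting s tend to 0 concentrates G(·,s)
at the origin with mass ∫G(·,1), so that this mass times G(x,t) reproduces G(x,t). -/
theorem KernelCondition.mass_mul (hG : KernelCondition G γ d L) (hd : 0 < d) (hL : 0 < L)
    (x : E N) {t : ℝ} (ht : 0 < t) : (∫ z, profile G z) * G x t = G x t := by
  obtain ⟨C, hC0, hC⟩ := hG.exists_bound hL
  have hpi := hG.profile_integrable hL
  have hrep : ∀ s, 0 < s → s < t →
      ∫ z, G (x - s ^ (1 / d) • z) (t - s) * profile G z = G x t := by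
    intro s hs hst
    have ha := scl_pos (d := d) hs
    rw [hG.semigroup x s t hs hst, ← integral_scale ha]
    refine integral_congr_ae (Eventually.of_forall fun y => ?_)
    have : s ^ (1 / d) * scl d s = 1 := by
      rw [scl, ← Real.rpow_add hs]; simp
    simp only [smul_smul, this, one_smul, hG.eq_profile hs]
    ring
  have hlim : Tendsto (fun s => ∫ z, G (x - s ^ (1 / d) • z) (t - s) * profile G z)
      (nhdsWithin 0 (Set.Ioi 0)) (nhds (∫ z, G x t * profile G z)) := by
    -- Keeping t - s above t/2 bounds the factor G(·,t-s) uniformly in s, which gives the dominating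
    -- function.
    have hev : ∀ᶠ s in nhdsWithin (0 : ℝ) (Set.Ioi 0), s < t / 2 :=
      mem_nhdsWithin_of_mem_nhds (Iio_mem_nhds (by positivity))
    refine tendsto_integral_filter_of_dominated_convergence
      (fun z => C * scl d (t / 2) ^ N * |profile G z|) ?_ ?_ ?_ ?_
    · filter_upwards [hev] with s hs
      have h1 := hG.continuous (t := t - s) (by linarith)
      have h2 := hG.decayC.continuous
      exact Continuous.aestronglyMeasurable (by fun_prop)
    · filter_upwards [hev] with s hs
      refine Eventually.of_forall fun z => ?_
      rw [Real.norm_eq_abs, abs_mul]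
      refine mul_le_mul_of_nonneg_right ((hC _ _ (by linarith)).trans ?_) (abs_nonneg _)
      exact mul_le_mul_of_nonneg_left (pow_le_pow_left₀ (scl_pos (by linarith)).le
        (scl_anti hd (by linarith) (by linarith)) _) hC0
    · exact hpi.abs.const_mul _
    · refine Eventually.of_forall fun z => Tendsto.mul_const _ ?_
      have h1 : ContinuousAt (fun z : E N × ℝ => G z.1 z.2) (x, t) :=
        hG.continuousOn.continuousAt (prod_mem_nhds Filter.univ_mem (Ioi_mem_nhds ht))
      have h2 : Continuous fun s : ℝ => (x - s ^ (1 / d) • z, t - s) := by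
        have : Continuous fun s : ℝ => s ^ (1 / d) :=
          Real.continuous_rpow_const (by positivity)
        fun_prop
      have h3 : Tendsto (fun s : ℝ => (x - s ^ (1 / d) • z, t - s)) (nhdsWithin 0 (Set.Ioi 0))
          (nhds (x, t)) := by
        have := (h2.tendsto 0).mono_left (nhdsWithin_le_nhds (s := Set.Ioi 0))
        simpa [Real.zero_rpow (inv_ne_zero hd.ne')] using this
      exact h1.tendsto.comp h3
  have hconst : Tendsto (fun s => ∫ z, G (x - s ^ (1 / d) • z) (t - s) * profile G z)
      (nhdsWithin 0 (Set.Ioi 0)) (nhds (G x t)) := by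
    refine tendsto_const_nhds.congr' ?_
    filter_upwards [self_mem_nhdsWithin, mem_nhdsWithin_of_mem_nhds (Iio_mem_nhds ht)] with s h1 h2
    exact (hrep s h1 h2).symm
  have := tendsto_nhds_unique hlim hconst
  rwa [integral_const_mul, mul_comm] at this

/-- Either the kernel has mass one, or it vanishes. -/
theorem KernelCondition.mass_eq_one_or (hG : KernelCondition G γ d L) (hd : 0 < d) (hL : 0 < L) :
    (∫ z, profile G z) = 1 ∨ ∀ x, ∀ t : ℝ, 0 < t → G x t = 0 := by
  by_cases h : (∫ z, profile G z) = 1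
  · exact Or.inl h
  · refine Or.inr fun x t ht => ?_
    by_contra h0
    exact h (mul_right_cancel₀ h0 (by rw [hG.mass_mul hd hL x ht, one_mul]))

/-- The profile of `g_α`. -/
def gprof (G : E N → ℝ → ℝ) (α : Fin N → ℕ) (x : E N) : ℝ :=
  (-1) ^ len α / (multiFact α : ℝ) * multiDeriv α (profile G) x

/-- Besides the mass-preserving dilation, each derivative contributes one factor of the scale
(1+t)^{-1/d}. -/
theorem KernelCondition.gker_eq (hG : KernelCondition G γ d L) (α : Fin N → ℕ) (x : E N) {t : ℝ}
    (ht : 0 ≤ t) : gker G α x t =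
      scl d (1 + t) ^ len α * (scl d (1 + t) ^ N * gprof G α (scl d (1 + t) • x)) := by
  have h1 : (fun z : E N => G z (t + 1)) =
      fun z => scl d (1 + t) ^ N * profile G (scl d (1 + t) • z) := by
    funext z; rw [hG.eq_profile (by linarith), add_comm t 1]
  rw [gker, h1, multiDeriv_smul_comp, gprof]
  ring

theorem KernelCondition.gprof_decayC (hG : KernelCondition G γ d L) {α : Fin N → ℕ}
    (hα : len α ≤ γ) :
    (∃ C : ℝ, 0 ≤ C ∧ ∀ x, |gprof G α x| ≤ C * (1 + ‖x‖) ^ (-(N + L))) ∧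
      Continuous (gprof G α) ∧
      ∀ β : Fin N → ℕ, (len β : ℝ) < L → Integrable fun x => monom β x * gprof G α x := by
  have h := hG.decayC.multiDeriv (m := 0) α (by omega)
  refine ⟨?_, ?_, fun β hβ => ?_⟩
  · obtain ⟨C, hC0, hC⟩ := h.exists_bound
    refine ⟨|(-1) ^ len α / (multiFact α : ℝ)| * C, by positivity, fun x => ?_⟩
    rw [gprof, abs_mul, mul_assoc]
    exact mul_le_mul_of_nonneg_left (hC x) (abs_nonneg _)
  · have := h.continuous
    unfold gprof
    fun_prop
  · have := (integrable_monom_mul h β (by linarith)).const_mul ((-1) ^ len α / (multiFact α : ℝ))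
    refine this.congr (Eventually.of_forall fun x => ?_)
    simp only [gprof]
    ring

theorem KernelCondition.continuous_gker (hG : KernelCondition G γ d L) {α : Fin N → ℕ}
    (hα : len α ≤ γ) {t : ℝ} (ht : 0 ≤ t) : Continuous fun x => gker G α x t := by
  have := (hG.gprof_decayC hα).2.1
  simp_rw [hG.gker_eq α _ ht]
  fun_prop

theorem KernelCondition.integrable_monom_gker (hG : KernelCondition G γ d L) {α : Fin N → ℕ}
    (hα : len α ≤ γ) {β : Fin N → ℕ} (hβ : (len β : ℝ) < L) {t : ℝ} (ht : 0 ≤ t) :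
    Integrable fun x => monom β x * gker G α x t := by
  have ha := scl_pos (d := d) (t := 1 + t) (by linarith)
  have := (((hG.gprof_decayC hα).2.2 β hβ).comp_smul ha.ne').const_mul
    (scl d (1 + t) ^ len α * scl d (1 + t) ^ N * (scl d (1 + t) ^ len β)⁻¹)
  refine this.congr (Eventually.of_forall fun x => ?_)
  simp only [monom_smul, hG.gker_eq α x ht]
  field_simp

/-- These integrals depend on time through a pure power of the scale. This gives both their
measurability in time and the scaling of the moments M_α. -/
theorem KernelCondition.integral_monom_gker (hG : KernelCondition G γ d L) (α β : Fin N → ℕ)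
    {t : ℝ} (ht : 0 ≤ t) :
    ∫ x, monom β x * gker G α x t =
      scl d (1 + t) ^ len α * (scl d (1 + t) ^ len β)⁻¹ * ∫ x, monom β x * gprof G α x := by
  have ha := scl_pos (d := d) (t := 1 + t) (by linarith)
  rw [← integral_scale ha fun x => monom β x * gprof G α x, ← integral_const_mul]
  refine integral_congr_ae (Eventually.of_forall fun x => ?_)
  simp only [monom_smul, hG.gker_eq α x ht]
  field_simp

theorem multiFact_pos (α : Fin N → ℕ) : 0 < multiFact α :=
  Finset.prod_pos fun _ _ => Nat.factorial_pos _

theorem KernelCondition.integral_monom_gker_self (hG : KernelCondition G γ d L)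
    (hm : ∫ z, profile G z = 1) {α : Fin N → ℕ} (hα : len α ≤ γ) (hαL : (len α : ℝ) < L)
    {t : ℝ} (ht : 0 ≤ t) : ∫ x, monom α x * gker G α x t = 1 := by
  have ha := scl_pos (d := d) (t := 1 + t) (by linarith)
  rw [hG.integral_monom_gker α α ht, mul_inv_cancel₀ (by positivity), one_mul]
  have h1 : (fun x => monom α x * gprof G α x) = fun x =>
      (-1) ^ len α / (multiFact α : ℝ) * (monom α x * multiDeriv α (profile G) x) := by
    funext x; rw [gprof]; ring
  have h2 : (multiFact α : ℝ) ≠ 0 := by exact_mod_cast (multiFact_pos α).ne'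
  rw [h1, integral_const_mul, integral_monom_mul_multiDeriv_self α (by linarith)
    (hG.decayC.mono hα), hm]
  field_simp
  rw [← pow_mul, mul_comm, pow_mul]
  simp

/-- Together with the normalisation on the diagonal this is the triangularity that makes the
recursive definition of M_α the correct one. -/
theorem KernelCondition.integral_monom_gker_of_not_le (hG : KernelCondition G γ d L)
    {α β : Fin N → ℕ} (hβ : len β ≤ γ) (hαL : (len α : ℝ) < L) (h : ¬ β ≤ α)
    {t : ℝ} (ht : 0 ≤ t) : ∫ x, monom α x * gker G β x t = 0 := by
  rw [hG.integral_monom_gker β α ht]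
  have h1 : (fun x => monom α x * gprof G β x) = fun x =>
      (-1) ^ len β / (multiFact β : ℝ) * (monom α x * multiDeriv β (profile G) x) := by
    funext x; rw [gprof]; ring
  rw [h1, integral_const_mul, integral_monom_mul_multiDeriv_of_not_le α β (by linarith)
    (hG.decayC.mono hβ) h]
  simp

/-- The α-th derivative of the semigroup identity between the times s + 1 and t + 1. The correction
terms in the projection are thus transported exactly by the evolution. -/
theorem KernelCondition.evol_gker (hG : KernelCondition G γ d L) (hL : 0 < L) {α : Fin N → ℕ}
    (hα : len α ≤ γ) {s t : ℝ} (hs : 0 ≤ s) (hst : s < t) (x : E N) :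
    evol G (t - s) (fun y => gker G α y s) x = gker G α x t := by
  have hN : (0 : ℝ) ≤ N + L := by positivity
  -- Reflecting the integration variable puts z in the factor at time s + 1, so that the derivatives
  -- fall on that factor, as g_α(·,s) requires.
  have h1 : (fun z : E N => G z (t + 1)) =
      fun z => ∫ y, G y (t - s) * G (z - y) (s + 1) := by
    funext z
    rw [hG.semigroup z (s + 1) (t + 1) (by linarith) (by linarith), ← integral_sub_left_eq_self _ _ z]
    simp
  have h2 : DecayC 0 (len α) (fun z : E N => G z (s + 1)) := by
    have := ((hG.decayC.mono hα).smul_comp hN (scl d (s + 1) ^ N) (scl d (s + 1)))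
    simpa only [← hG.eq_profile (show 0 < s + 1 by linarith)] using this
  unfold gker evol
  rw [h1, multiDeriv_conv le_rfl (hG.integrable hL (by linarith)) α h2, ← integral_const_mul,
    ← integral_sub_left_eq_self _ _ x]
  refine integral_congr_ae (Eventually.of_forall fun y => ?_)
  simp only [sub_sub_cancel]
  ring

theorem len_mono {α β : Fin N → ℕ} (h : α ≤ β) : len α ≤ len β :=
  Finset.sum_le_sum fun i _ => h i

/-- The projection kills the moments of order at most `K`. -/
theorem KernelCondition.integral_monom_proj (hG : KernelCondition G γ d L)
    (hm : ∫ z, profile G z = 1) {K : ℝ} (hK : 0 ≤ K) (hKL : K < L) (hKγ : ⌊K⌋₊ + 1 ≤ γ)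
    {f : E N → ℝ} (hf : ∀ α : Fin N → ℕ, (len α : ℝ) ≤ K → Integrable fun x => monom α x * f x)
    {s : ℝ} (hs : 0 ≤ s) {α : Fin N → ℕ} (hα : (len α : ℝ) ≤ K) :
    Integrable (fun x => monom α x * proj G K s f x) ∧ ∫ x, monom α x * proj G K s f x = 0 := by
  have hγ : ∀ β : Fin N → ℕ, (len β : ℝ) ≤ K → len β ≤ γ := fun β hβ =>
    ((Nat.le_floor_iff hK).2 hβ).trans (by omega)
  have hexp : (fun x => monom α x * proj G K s f x) = fun x => monom α x * f x -
      ∑ β ∈ multiIdx N K, moment G f s β * (monom α x * gker G β x s) := by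
    funext x
    rw [proj, mul_sub, Finset.mul_sum]
    congr 1
    exact Finset.sum_congr rfl fun β _ => by ring
  have hint : ∀ β ∈ multiIdx N K,
      Integrable fun x => moment G f s β * (monom α x * gker G β x s) := fun β hβ =>
    (hG.integrable_monom_gker (hγ β ((mem_multiIdx hK β).1 hβ)) (by linarith) hs).const_mul _
  rw [hexp]
  refine ⟨(hf α hα).sub (integrable_finsetSum _ hint), ?_⟩
  rw [integral_sub (hf α hα) (integrable_finsetSum _ hint), integral_finsetSum _ hint]
  simp_rw [integral_const_mul]
  have hsub : Finset.Iic α ⊆ multiIdx N K := fun β hβ => by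
    rw [mem_multiIdx hK]
    refine le_trans ?_ hα
    exact_mod_cast len_mono (Finset.mem_Iic.1 hβ)
  -- Only β ≤ α survive. The diagonal term contributes M_α itself, and the recursion for M_α cancels
  -- the rest.
  rw [← Finset.sum_subset hsub fun β hβ hβ' => by
    rw [hG.integral_monom_gker_of_not_le (hγ β ((mem_multiIdx hK β).1 hβ)) (by linarith)
      (by simpa using hβ') hs, mul_zero], ← Finset.Iio_insert, Finset.sum_insert (by simp),
    hG.integral_monom_gker_self hm (hγ α hα) (by linarith) hs, mul_one, moment_eq G f s α]
  ring

end Kernel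

end GenHeat
end
noncomputable section
namespace GenHeat
variable {N : ℕ}

/-! ### Scaled norms -/

/-- The weight `1 + (a|x|)^K`. -/
def wt (K a : ℝ) (x : E N) : ℝ := 1 + (a * ‖x‖) ^ K

/-- The weighted `L^1` norm at scale `a`. -/
def wsum (K a : ℝ) (f : E N → ℝ) : ℝ≥0∞ := ∫⁻ x, ‖f x‖ₑ * ENNReal.ofReal (wt K a x)

/-- The sum of the `L^∞` norm and the weighted `L^1` norm at scale `a`. -/
def essNorm (K a : ℝ) (f : E N → ℝ) : ℝ≥0∞ :=
  ENNReal.ofReal ((a ^ N)⁻¹) * eLpNorm f ∞ volume + wsum K a f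

/-- The variant of `essNorm` with a pointwise supremum. -/
def supNorm (K a : ℝ) (f : E N → ℝ) : ℝ≥0∞ :=
  ENNReal.ofReal ((a ^ N)⁻¹) * (⨆ x, ‖f x‖ₑ) + wsum K a f

theorem wt_nonneg {K a : ℝ} (ha : 0 ≤ a) (x : E N) : 0 ≤ wt K a x := by
  unfold wt; positivity

theorem wt_mono {K a b : ℝ} (hK : 0 ≤ K) (hb : 0 ≤ b) (h : b ≤ a) (x : E N) :
    wt K b x ≤ wt K a x := by
  unfold wt
  gcongr

@[fun_prop]
theorem measurable_wt (K a : ℝ) : Measurable (wt K a : E N → ℝ) := by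
  unfold wt; fun_prop

theorem wt_add_le {K a : ℝ} (hK : 0 ≤ K) (ha : 0 ≤ a) (x y : E N) :
    wt K a (x + y) ≤ 2 ^ K * (wt K a x * wt K a y) :=
  one_add_norm_add_rpow_le hK (by positivity) (by positivity) (by positivity)
    (by rw [← mul_add]; exact mul_le_mul_of_nonneg_left (norm_add_le x y) ha)

theorem wsum_le_essNorm (K a : ℝ) (f : E N → ℝ) : wsum K a f ≤ essNorm K a f := le_add_self

/-- Inputs are measured with the essential supremum, which ignores null sets; evolutions are defined
at every point and measured with the true supremum, which passes through a time integral without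
interchanging almost-everywhere statements in x and s. -/
theorem essNorm_le_supNorm (K a : ℝ) (f : E N → ℝ) : essNorm K a f ≤ supNorm K a f := by
  unfold essNorm supNorm
  gcongr
  rw [eLpNorm_exponent_top]
  exact essSup_le_of_ae_le _ (Eventually.of_forall fun x => le_iSup (fun x => ‖f x‖ₑ) x)

theorem essNorm_mono_ae (K a : ℝ) {f g : E N → ℝ} (h : ∀ᵐ x, |f x| ≤ |g x|) :
    essNorm K a f ≤ essNorm K a g := by
  unfold essNorm wsum
  gcongr ?_ + ?_
  · gcongr
    exact eLpNorm_mono_ae (by simpa using h)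
  · refine lintegral_mono_ae ?_
    filter_upwards [h] with x hx
    gcongr
    rw [Real.enorm_eq_ofReal_abs, Real.enorm_eq_ofReal_abs]
    exact ENNReal.ofReal_le_ofReal hx

theorem essNorm_zero (K a : ℝ) : essNorm K a (fun _ : E N => (0 : ℝ)) = 0 := by
  have h : eLpNorm (fun _ : E N => (0 : ℝ)) ∞ volume = 0 := eLpNorm_zero
  simp [essNorm, wsum, h]

theorem wsum_const_mul (K a c : ℝ) (f : E N → ℝ) :
    wsum K a (fun x => c * f x) = ‖c‖ₑ * wsum K a f := by
  unfold wsum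
  rw [← lintegral_const_mul' _ _ enorm_ne_top]
  simp_rw [enorm_mul, mul_assoc]

theorem essNorm_const_mul (K a c : ℝ) (f : E N → ℝ) :
    essNorm K a (fun x => c * f x) = ‖c‖ₑ * essNorm K a f := by
  unfold essNorm
  rw [wsum_const_mul, mul_add]
  have : eLpNorm (fun x => c * f x) ∞ (volume : Measure (E N)) = ‖c‖ₑ * eLpNorm f ∞ volume :=
    eLpNorm_const_smul c f ∞ volume
  rw [this, mul_left_comm]

theorem wsum_add_le (K a : ℝ) {f g : E N → ℝ} (hf : AEStronglyMeasurable f volume) :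
    wsum K a (fun x => f x + g x) ≤ wsum K a f + wsum K a g := by
  unfold wsum
  rw [← lintegral_add_left' (by fun_prop)]
  refine lintegral_mono fun x => ?_
  rw [← add_mul]
  gcongr
  exact enorm_add_le _ _

theorem essNorm_add_le (K a : ℝ) {f g : E N → ℝ} (hf : AEStronglyMeasurable f volume)
    (hg : AEStronglyMeasurable g volume) :
    essNorm K a (fun x => f x + g x) ≤ essNorm K a f + essNorm K a g := by
  unfold essNorm
  refine (add_le_add (mul_le_mul_right (eLpNorm_add_le hf hg le_top) _)
    (wsum_add_le K a hf)).trans (le_of_eq ?_)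
  ring

theorem essNorm_sub_le (K a : ℝ) {f g : E N → ℝ} (hf : AEStronglyMeasurable f volume)
    (hg : AEStronglyMeasurable g volume) :
    essNorm K a (fun x => f x - g x) ≤ essNorm K a f + essNorm K a g := by
  have h1 := essNorm_add_le K a hf hg.neg
  have h2 : essNorm K a (-g) = essNorm K a g :=
    le_antisymm (essNorm_mono_ae _ _ (by simp)) (essNorm_mono_ae _ _ (by simp))
  rw [h2] at h1
  simpa [sub_eq_add_neg] using h1

theorem essNorm_sum_le {ι : Type*} (K a : ℝ) (S : Finset ι) {f : ι → E N → ℝ}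
    (hf : ∀ i ∈ S, AEStronglyMeasurable (f i) volume) :
    essNorm K a (fun x => ∑ i ∈ S, f i x) ≤ ∑ i ∈ S, essNorm K a (f i) := by
  classical
  induction S using Finset.induction_on with
  | empty => simp [essNorm_zero]
  | insert i S hi ih =>
    simp_rw [Finset.sum_insert hi]
    refine (essNorm_add_le K a (hf i (by simp)) ?_).trans ?_
    · exact Finset.aestronglyMeasurable_fun_sum _ fun j hj => hf j (by simp [hj])
    · gcongr
      exact ih fun j hj => hf j (by simp [hj])

/-- Passing to a smaller scale decreases the weight, and only the factor in front of the supremum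
grows, by (a/b)^N ≤ c^N. -/
theorem supNorm_le_of_scale {K a b c : ℝ} (hK : 0 ≤ K) (hb : 0 < b) (hba : b ≤ a) (hc : 1 ≤ c)
    (hac : a ≤ c * b) (f : E N → ℝ) : supNorm K b f ≤ ENNReal.ofReal (c ^ N) * supNorm K a f := by
  have ha : 0 < a := hb.trans_le hba
  unfold supNorm
  rw [mul_add, ← mul_assoc, ← ENNReal.ofReal_mul (by positivity)]
  gcongr ?_ * _ + ?_
  · refine ENNReal.ofReal_le_ofReal ?_
    rw [← div_eq_mul_inv, inv_le_iff_one_le_mul₀ (by positivity), ← mul_div_right_comm, ← mul_pow,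
      one_le_div (by positivity)]
    exact pow_le_pow_left₀ ha.le hac _
  · refine le_trans ?_ (le_mul_of_one_le_left' (by simpa using one_le_pow₀ hc))
    unfold wsum
    gcongr with x
    exact wt_mono hK hb.le hba x

theorem essNorm_le_of_scale {K a b c : ℝ} (hK : 0 ≤ K) (hb : 0 < b) (hba : b ≤ a) (hc : 1 ≤ c)
    (hac : a ≤ c * b) (f : E N → ℝ) : essNorm K b f ≤ ENNReal.ofReal (c ^ N) * essNorm K a f := by
  have ha : 0 < a := hb.trans_le hba
  unfold essNorm
  rw [mul_add, ← mul_assoc, ← ENNReal.ofReal_mul (by positivity)]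
  gcongr ?_ * _ + ?_
  · refine ENNReal.ofReal_le_ofReal ?_
    rw [← div_eq_mul_inv, inv_le_iff_one_le_mul₀ (by positivity), ← mul_div_right_comm, ← mul_pow,
      one_le_div (by positivity)]
    exact pow_le_pow_left₀ ha.le hac _
  · refine le_trans ?_ (le_mul_of_one_le_left' (by simpa using one_le_pow₀ hc))
    unfold wsum
    gcongr with x
    exact wt_mono hK hb.le hba x

theorem scl_le_two_mul {d S T : ℝ} (hd : 0 < d) (hT : 0 < T) (h : T ≤ 2 * S) :
    scl d S ≤ 2 ^ (1 / d) * scl d T := by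
  refine (scl_anti hd (by positivity : 0 < T / 2) (by linarith)).trans (le_of_eq ?_)
  rw [scl, scl, Real.div_rpow hT.le zero_le_two, Real.rpow_neg zero_le_two, div_inv_eq_mul, mul_comm]

theorem pow_le_one_add_rpow {K s : ℝ} {n : ℕ} (hs : 0 ≤ s) (hn : (n : ℝ) ≤ K) :
    s ^ n ≤ 1 + s ^ K := by
  rcases le_total s 1 with h | h
  · have := pow_le_one₀ (n := n) hs h
    have : 0 ≤ s ^ K := by positivity
    linarith
  · have := Real.rpow_le_rpow_of_exponent_le h hn
    rw [Real.rpow_natCast] at this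
    linarith

/-- After extracting a^{-|α|} the monomial is at most (a|x|)^{|α|}, hence at most 1 + (a|x|)^K
because |α| ≤ K. -/
theorem lintegral_monom_le {K a : ℝ} (ha : 0 < a) {α : Fin N → ℕ} (hα : (len α : ℝ) ≤ K)
    (f : E N → ℝ) :
    ∫⁻ x, ‖monom α x * f x‖ₑ ≤ ENNReal.ofReal ((a ^ len α)⁻¹) * wsum K a f := by
  unfold wsum
  rw [← lintegral_const_mul' _ _ ENNReal.ofReal_ne_top]
  refine lintegral_mono fun x => ?_
  rw [enorm_mul, mul_left_comm, mul_comm, ← ENNReal.ofReal_mul (by positivity)]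
  gcongr
  rw [Real.enorm_eq_ofReal_abs]
  refine ENNReal.ofReal_le_ofReal ((abs_monom_le α x).trans ?_)
  rw [inv_mul_eq_div, le_div_iff₀ (by positivity), ← mul_pow, mul_comm]
  exact pow_le_one_add_rpow (by positivity) hα

theorem integrable_monom_of_wsum {K a : ℝ} (ha : 0 < a) {α : Fin N → ℕ} (hα : (len α : ℝ) ≤ K)
    {f : E N → ℝ} (hf : AEStronglyMeasurable f volume) (h : wsum K a f < ∞) :
    Integrable fun x => monom α x * f x :=
  ⟨(continuous_monom α).aestronglyMeasurable.mul hf,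
    (lintegral_monom_le ha hα f).trans_lt (ENNReal.mul_lt_top ENNReal.ofReal_lt_top h)⟩

theorem integrable_of_wsum {K a : ℝ} (hK : 0 ≤ K) (ha : 0 < a) {f : E N → ℝ}
    (hf : AEStronglyMeasurable f volume) (h : wsum K a f < ∞) : Integrable f := by
  simpa [monom] using integrable_monom_of_wsum ha (α := (0 : Fin N → ℕ)) (by simpa [len]) hf h

/-! ### Estimates for the evolution -/

section Kernel
variable {G : E N → ℝ → ℝ} {γ : ℕ} {d L K : ℝ}

theorem exists_lintegral_weight_le {r : ℝ} (hK : 0 ≤ K) (hr : N + K < r) {f : E N → ℝ}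
    (hf : ∃ C : ℝ, 0 ≤ C ∧ ∀ x, |f x| ≤ C * (1 + ‖x‖) ^ (-r)) :
    ∃ M : ℝ, 0 ≤ M ∧ ∫⁻ x, ‖f x‖ₑ * ENNReal.ofReal (1 + ‖x‖ ^ K) ≤ ENNReal.ofReal M := by
  obtain ⟨C, hC0, hC⟩ := hf
  refine ⟨C * (weightMass N r K).toReal, by positivity, ?_⟩
  rw [ENNReal.ofReal_mul hC0, ENNReal.ofReal_toReal (weightMass_lt_top hK hr).ne, weightMass,
    ← lintegral_const_mul' _ _ ENNReal.ofReal_ne_top]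
  refine lintegral_mono fun x => ?_
  rw [Real.enorm_eq_ofReal_abs, ← ENNReal.ofReal_mul (abs_nonneg _), ← ENNReal.ofReal_mul hC0,
    ← mul_assoc]
  exact ENNReal.ofReal_le_ofReal (mul_le_mul_of_nonneg_right (hC x) (by positivity))

theorem enorm_scale {a : ℝ} (ha : 0 < a) (x : ℝ) : ‖a ^ N * x‖ₑ = ENNReal.ofReal (a ^ N) * ‖x‖ₑ := by
  rw [enorm_mul, Real.enorm_eq_ofReal_abs, abs_of_pos (by positivity)]

theorem wsum_scale {a : ℝ} (ha : 0 < a) (f : E N → ℝ) :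
    wsum K a (fun x => a ^ N * f (a • x)) = ∫⁻ x, ‖f x‖ₑ * ENNReal.ofReal (1 + ‖x‖ ^ K) := by
  rw [← lintegral_scale ha]
  refine lintegral_congr fun x => ?_
  rw [enorm_scale ha, wt, norm_smul, Real.norm_eq_abs, abs_of_pos ha, mul_assoc]

theorem enorm_evol_le (G : E N → ℝ → ℝ) (τ : ℝ) (h : E N → ℝ) (x : E N) :
    ‖evol G τ h x‖ₑ ≤ ∫⁻ y, ‖G (x - y) τ‖ₑ * ‖h y‖ₑ := by
  unfold evol
  refine (enorm_integral_le_lintegral_enorm _).trans (le_of_eq ?_)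
  simp_rw [enorm_mul]

theorem enorm_ae_le_eLpNorm_top (h : E N → ℝ) : ∀ᵐ y, ‖h y‖ₑ ≤ eLpNorm h ∞ volume := by
  rw [eLpNorm_exponent_top]
  exact ae_le_eLpNormEssSup

/-- The evolution is bounded for the norms at any larger scale. -/
theorem KernelCondition.exists_supNorm_evol_le (hG : KernelCondition G γ d L) (hd : 0 < d)
    (hK : 0 ≤ K) (hKL : K < L) : ∃ C : ℝ, 0 ≤ C ∧ ∀ τ T : ℝ, 0 < τ → τ ≤ T → ∀ h : E N → ℝ,
      AEStronglyMeasurable h volume →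
      supNorm K (scl d T) (evol G τ h) ≤ ENNReal.ofReal C * essNorm K (scl d T) h := by
  obtain ⟨M, hM0, hM⟩ := exists_lintegral_weight_le hK (by linarith : N + K < N + L)
    hG.decayC.exists_bound
  have h2K : (1 : ℝ) ≤ 2 ^ K := Real.one_le_rpow one_le_two hK
  refine ⟨2 ^ K * M, by positivity, fun τ T hτ hT h hh => ?_⟩
  have ha := scl_pos (d := d) hτ
  have hb := scl_pos (d := d) (hτ.trans_le hT)
  have hba := scl_anti hd hτ hT
  set a := scl d τ
  set b := scl d T
  have hGa : (fun x => G x τ) = fun x => a ^ N * profile G (a • x) :=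
    funext fun x => hG.eq_profile hτ x
  have hmass : wsum K a (fun x => G x τ) ≤ ENNReal.ofReal M := by
    rw [hGa, wsum_scale ha]; exact hM
  have hmass' : ∫⁻ x, ‖G x τ‖ₑ ≤ ENNReal.ofReal M := by
    refine le_trans (lintegral_mono fun x => ?_) hmass
    refine le_mul_of_one_le_right' ?_
    rw [ENNReal.one_le_ofReal, wt]
    have : 0 ≤ (a * ‖x‖) ^ K := by positivity
    linarith
  have hGc := hG.continuous hτ
  unfold supNorm essNorm
  rw [mul_add]
  refine add_le_add ?_ ?_
  · rw [mul_left_comm]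
    gcongr
    refine iSup_le fun x => (enorm_evol_le G τ h x).trans ?_
    calc _ ≤ ∫⁻ y, ‖G (x - y) τ‖ₑ * eLpNorm h ∞ volume := by
          refine lintegral_mono_ae ?_
          filter_upwards [enorm_ae_le_eLpNorm_top h] with y hy
          gcongr
      _ = (∫⁻ y, ‖G y τ‖ₑ) * eLpNorm h ∞ volume := by
          rw [lintegral_mul_const (μ := volume) _ (f := fun y => ‖G (x - y) τ‖ₑ)
            (hGc.comp (continuous_const.sub continuous_id)).measurable.enorm,
            lintegral_sub_left_eq_self (fun y => ‖G y τ‖ₑ) x]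
      _ ≤ _ := by
          gcongr
          refine hmass'.trans (ENNReal.ofReal_le_ofReal ?_)
          exact le_mul_of_one_le_left hM0 h2K
  · calc wsum K b (evol G τ h)
        ≤ ∫⁻ x, ∫⁻ y, ‖G (x - y) τ‖ₑ * ‖h y‖ₑ * ENNReal.ofReal (wt K b x) := by
          refine lintegral_mono fun x => ?_
          rw [lintegral_mul_const' _ _ ENNReal.ofReal_ne_top]
          gcongr
          exact enorm_evol_le G τ h x
      _ = ∫⁻ y, ∫⁻ x, ‖G (x - y) τ‖ₑ * ‖h y‖ₑ * ENNReal.ofReal (wt K b x) := by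
          refine lintegral_lintegral_swap ?_
          refine AEMeasurable.mul (AEMeasurable.mul ?_ hh.comp_snd.enorm) ?_
          · exact (Continuous.measurable (f := fun z : E N × E N => G (z.1 - z.2) τ)
              (by fun_prop)).enorm.aemeasurable
          · exact ((measurable_wt K b).comp measurable_fst).ennreal_ofReal.aemeasurable
      _ ≤ ∫⁻ y, ENNReal.ofReal (2 ^ K * M) * (‖h y‖ₑ * ENNReal.ofReal (wt K b y)) := by
          refine lintegral_mono fun y => ?_
          -- The weight at x is split into weights at x - y and at y. The first is raised to the
          -- kernel's own scale a ≥ b, where the weighted mass is bounded independently of τ.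
          calc _ ≤ ∫⁻ x, ‖G (x - y) τ‖ₑ * ENNReal.ofReal (wt K a (x - y)) *
                (‖h y‖ₑ * ENNReal.ofReal (2 ^ K * wt K b y)) := by
                refine lintegral_mono fun x => ?_
                rw [mul_assoc, mul_assoc, mul_left_comm (ENNReal.ofReal (wt K a _)),
                  ← ENNReal.ofReal_mul (wt_nonneg ha.le _)]
                gcongr
                have h1 := wt_add_le hK hb.le (x - y) y
                rw [sub_add_cancel] at h1
                refine h1.trans ?_
                rw [mul_left_comm]
                have := wt_nonneg (K := K) hb.le y
                exact mul_le_mul_of_nonneg_right (wt_mono hK hb.le hba _) (by positivity)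
            _ = wsum K a (fun x => G x τ) * (‖h y‖ₑ * ENNReal.ofReal (2 ^ K * wt K b y)) := by
                rw [lintegral_mul_const' _ _ (ENNReal.mul_ne_top enorm_ne_top
                  ENNReal.ofReal_ne_top), lintegral_sub_right_eq_self
                    (fun x => ‖G x τ‖ₑ * ENNReal.ofReal (wt K a x)) y, wsum]
            _ ≤ ENNReal.ofReal M * (‖h y‖ₑ * ENNReal.ofReal (2 ^ K * wt K b y)) := by gcongr
            _ = _ := by
                rw [ENNReal.ofReal_mul (by positivity), ENNReal.ofReal_mul (by positivity)]
                ring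
      _ = _ := by rw [lintegral_const_mul' _ _ ENNReal.ofReal_ne_top, wsum]

theorem continuous_taylorRem {k : ℕ} {f : E N → ℝ} (hf : ContDiff ℝ k f) :
    Continuous fun z : E N × E N => taylorRem f k z.1 z.2 := by
  have hc := hf.continuous
  have hj : ∀ j ∈ Finset.range (k + 1), Continuous (iteratedFDeriv ℝ j f) := fun j hj =>
    hf.continuous_iteratedFDeriv (by exact_mod_cast Nat.lt_succ_iff.1 (Finset.mem_range.1 hj))
  unfold taylorRem taylorPoly
  refine Continuous.sub (by fun_prop) (continuous_finsetSum _ fun j hj' => ?_)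
  have h1 := hj j hj'
  refine continuous_const.mul ?_
  simp_rw [multilinear_diag_eq_sum_monom]
  refine continuous_finsetSum _ fun e _ => Continuous.mul ?_ ?_
  · have := continuous_monom fun a => (Finset.univ.filter fun i => e i = a).card
    fun_prop
  · have := (ContinuousMultilinearMap.apply ℝ (fun _ : Fin j => E N) ℝ
      (fun i => EuclideanSpace.single (e i) 1)).continuous
    exact this.comp (h1.comp continuous_fst)

/-- The evolution of a function with vanishing moments. -/
theorem KernelCondition.exists_supNorm_evol_le_rho (hG : KernelCondition G γ d L)
    (hK : 0 ≤ K) (hKL : K < L) (hKγ : ⌊K⌋₊ + 1 ≤ γ) : ∃ C : ℝ, 0 ≤ C ∧ ∀ τ : ℝ, 0 < τ →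
      ∀ h : E N → ℝ, AEStronglyMeasurable h volume → (∃ b, 0 < b ∧ wsum K b h < ∞) →
      (∀ α : Fin N → ℕ, (len α : ℝ) ≤ K → ∫ x, monom α x * h x = 0) →
      supNorm K (scl d τ) (evol G τ h) ≤
        ENNReal.ofReal C * ∫⁻ y, ‖h y‖ₑ * ENNReal.ofReal (rho K (scl d τ * ‖y‖)) := by
  have hN : (0 : ℝ) ≤ N := Nat.cast_nonneg N
  have hdec := hG.decayC.mono hKγ
  obtain ⟨C₁, h₁, H₁⟩ := exists_abs_taylorRem_le_rho (by linarith) hK hdec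
  obtain ⟨C₂, h₂, H₂⟩ := exists_lintegral_taylorRem_le_rho hK (by linarith : N + K < N + L) hdec
  refine ⟨C₁ + C₂, by positivity, fun τ hτ h hh ⟨b, hb, hbh⟩ h0 => ?_⟩
  have ha := scl_pos (d := d) hτ
  set a := scl d τ
  set k := ⌊K⌋₊
  have hk : ∀ α : Fin N → ℕ, len α ≤ k → (len α : ℝ) ≤ K := fun α hα =>
    (Nat.le_floor_iff hK).1 hα
  have hhi := integrable_of_wsum hK hb hh hbh
  -- The moments of h vanish, so the Taylor polynomial of the kernel in y can be subtracted at no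
  -- cost.
  have hrep : ∀ x, evol G τ h x = ∫ y, a ^ N * taylorRem (profile G) k (a • x) (a • y) * h y := by
    intro x
    obtain ⟨hi, hz⟩ := integral_taylorPoly_mul_eq_zero (profile G) k (a • x) a
      (fun α hα => integrable_monom_of_wsum hb (hk α hα) hh hbh) (fun α hα => h0 α (hk α hα))
    obtain ⟨B, hB0, hB⟩ := hdec.bounded (by linarith)
    have hpc := hdec.continuous
    have hi' : Integrable fun y => profile G (a • x - a • y) * h y := by
      refine (hhi.abs.const_mul B).mono' (AEStronglyMeasurable.mul
        (Continuous.aestronglyMeasurable (by fun_prop)) hh) (Eventually.of_forall fun y => ?_)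
      rw [Real.norm_eq_abs, abs_mul]
      exact mul_le_mul_of_nonneg_right (hB _) (abs_nonneg _)
    have h3 : ∀ y, a ^ N * taylorRem (profile G) k (a • x) (a • y) * h y =
        a ^ N * (profile G (a • x - a • y) * h y) -
          a ^ N * (taylorPoly (profile G) k (a • x) (a • y) * h y) := fun y => by
      rw [taylorRem]; ring
    simp_rw [h3]
    rw [integral_sub (hi'.const_mul _) (hi.const_mul _), integral_const_mul, integral_const_mul, hz,
      mul_zero, sub_zero, ← integral_const_mul, evol]
    refine integral_congr_ae (Eventually.of_forall fun y => ?_)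
    simp only [hG.eq_profile hτ, smul_sub, mul_assoc, a]
  have hle : ∀ x, ‖evol G τ h x‖ₑ ≤
      ∫⁻ y, ENNReal.ofReal (a ^ N) * ‖taylorRem (profile G) k (a • x) (a • y)‖ₑ * ‖h y‖ₑ := by
    intro x
    rw [hrep]
    refine (enorm_integral_le_lintegral_enorm _).trans (le_of_eq ?_)
    refine lintegral_congr fun y => ?_
    rw [enorm_mul, enorm_scale ha]
  set I := ∫⁻ y, ‖h y‖ₑ * ENNReal.ofReal (rho K (a * ‖y‖)) with hI
  have hna : ∀ y : E N, ‖a • y‖ = a * ‖y‖ := fun y => by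
    rw [norm_smul, Real.norm_eq_abs, abs_of_pos ha]
  unfold supNorm
  rw [ENNReal.ofReal_add h₁ h₂, add_mul]
  refine add_le_add ?_ ?_
  · have h5 : (⨆ x, ‖evol G τ h x‖ₑ) ≤ ENNReal.ofReal (a ^ N) * (ENNReal.ofReal C₁ * I) := by
      refine iSup_le fun x => (hle x).trans ?_
      rw [hI, ← lintegral_const_mul' _ _ ENNReal.ofReal_ne_top,
        ← lintegral_const_mul' _ _ ENNReal.ofReal_ne_top]
      refine lintegral_mono fun y => ?_
      rw [mul_assoc]
      refine mul_le_mul_right ?_ _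
      rw [mul_left_comm, mul_comm ‖taylorRem _ _ _ _‖ₑ]
      gcongr
      rw [← ENNReal.ofReal_mul h₁, Real.enorm_eq_ofReal_abs]
      exact ENNReal.ofReal_le_ofReal ((H₁ _ _).trans (le_of_eq (by rw [hna])))
    refine (mul_le_mul_right h5 _).trans (le_of_eq ?_)
    rw [← mul_assoc, ← ENNReal.ofReal_mul (by positivity), inv_mul_cancel₀ (by positivity),
      ENNReal.ofReal_one, one_mul]
  · calc wsum K a (evol G τ h)
        ≤ ∫⁻ x, ∫⁻ y, ENNReal.ofReal (a ^ N) * ‖taylorRem (profile G) k (a • x) (a • y)‖ₑ * ‖h y‖ₑ *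
            ENNReal.ofReal (wt K a x) := by
          refine lintegral_mono fun x => ?_
          rw [lintegral_mul_const' _ _ ENNReal.ofReal_ne_top]
          gcongr
          exact hle x
      _ = ∫⁻ y, ∫⁻ x, ENNReal.ofReal (a ^ N) * ‖taylorRem (profile G) k (a • x) (a • y)‖ₑ * ‖h y‖ₑ *
            ENNReal.ofReal (wt K a x) := by
          refine lintegral_lintegral_swap ?_
          refine AEMeasurable.mul (AEMeasurable.mul ?_ hh.comp_snd.enorm) ?_
          · have hc := continuous_taylorRem (hdec.mono (Nat.le_succ k)).contDiff
            have h6 : Continuous fun z : E N × E N =>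
                taylorRem (profile G) k (a • z.1) (a • z.2) :=
              hc.comp (f := fun z : E N × E N => (a • z.1, a • z.2)) (by fun_prop)
            exact (h6.measurable.enorm.const_mul _).aemeasurable
          · exact ((measurable_wt K a).comp measurable_fst).ennreal_ofReal.aemeasurable
      _ ≤ ∫⁻ y, ENNReal.ofReal C₂ * (‖h y‖ₑ * ENNReal.ofReal (rho K (a * ‖y‖))) := by
          refine lintegral_mono fun y => ?_
          have h7 : ∀ x, ENNReal.ofReal (a ^ N) * ‖taylorRem (profile G) k (a • x) (a • y)‖ₑ *
              ‖h y‖ₑ * ENNReal.ofReal (wt K a x) = ‖h y‖ₑ * (ENNReal.ofReal (a ^ N) *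
                (‖taylorRem (profile G) k (a • x) (a • y)‖ₑ *
                  ENNReal.ofReal (1 + ‖a • x‖ ^ K))) := fun x => by
            rw [hna, wt]; ring
          simp_rw [h7]
          rw [lintegral_const_mul' _ _ enorm_ne_top, mul_left_comm, ← ENNReal.ofReal_mul h₂,
            lintegral_scale ha fun x => ‖taylorRem (profile G) k x (a • y)‖ₑ *
                  ENNReal.ofReal (1 + ‖x‖ ^ K)]
          gcongr
          exact (H₂ _).trans (le_of_eq (by rw [hna]))
      _ = _ := by rw [lintegral_const_mul' _ _ ENNReal.ofReal_ne_top]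

end Kernel

end GenHeat
end
noncomputable section
namespace GenHeat
variable {N : ℕ}

/-! ### Moments and projections -/

section Kernel
variable {G : E N → ℝ → ℝ} {γ : ℕ} {d L K : ℝ}

/-- The norm at the function's own scale is invariant under mass-preserving dilation; only the
factor from the |α| derivatives remains. -/
theorem KernelCondition.exists_essNorm_gker_le (hG : KernelCondition G γ d L)
    (hK : 0 ≤ K) (hKL : K < L) {α : Fin N → ℕ} (hα : len α ≤ γ) :
    ∃ C : ℝ, 0 ≤ C ∧ ∀ s : ℝ, 0 ≤ s →
      essNorm K (scl d (1 + s)) (fun x => gker G α x s) ≤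
        ENNReal.ofReal (C * scl d (1 + s) ^ len α) := by
  have hN : (0 : ℝ) ≤ N := Nat.cast_nonneg N
  obtain ⟨C, hC0, hC⟩ := (hG.gprof_decayC hα).1
  obtain ⟨M, hM0, hM⟩ := exists_lintegral_weight_le hK (by linarith : N + K < N + L) ⟨C, hC0, hC⟩
  refine ⟨C + M, by positivity, fun s hs => ?_⟩
  have ha := scl_pos (d := d) (t := 1 + s) (by linarith)
  set a := scl d (1 + s)
  have h1 : (fun x => gker G α x s) = fun x => a ^ len α * (a ^ N * gprof G α (a • x)) :=
    funext fun x => hG.gker_eq α x hs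
  have h2 : essNorm K a (fun x => a ^ N * gprof G α (a • x)) ≤ ENNReal.ofReal (C + M) := by
    rw [ENNReal.ofReal_add hC0 hM0, essNorm, wsum_scale ha]
    refine add_le_add ?_ hM
    have h3 : eLpNorm (fun x => a ^ N * gprof G α (a • x)) ∞ volume ≤
        ENNReal.ofReal (a ^ N * C) := by
      rw [eLpNorm_exponent_top]
      refine essSup_le_of_ae_le _ (Eventually.of_forall fun x => ?_)
      change ‖a ^ N * gprof G α (a • x)‖ₑ ≤ ENNReal.ofReal (a ^ N * C)
      rw [Real.enorm_eq_ofReal_abs, abs_mul, abs_of_pos (by positivity)]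
      refine ENNReal.ofReal_le_ofReal (mul_le_mul_of_nonneg_left ((hC _).trans ?_) (by positivity))
      exact mul_le_of_le_one_right hC0 (Real.rpow_le_one_of_one_le_of_nonpos
        (by linarith [norm_nonneg (a • x)]) (by linarith))
    refine (mul_le_mul_right h3 _).trans (le_of_eq ?_)
    rw [← ENNReal.ofReal_mul (by positivity), ← mul_assoc, inv_mul_cancel₀ (by positivity), one_mul]
  rw [h1, essNorm_const_mul, Real.enorm_eq_ofReal_abs, abs_of_pos (by positivity),
    mul_comm (C + M), ENNReal.ofReal_mul (by positivity)]
  gcongr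

/-- Induction along the recursion: M_β scales like a^{-|β|} and ∫x^α g_β like a^{|β|-|α|}, so every
term scales like a^{-|α|}. -/
theorem KernelCondition.exists_enorm_moment_le (hG : KernelCondition G γ d L) (K : ℝ)
    (α : Fin N → ℕ) (hα : (len α : ℝ) ≤ K) :
    ∃ C : ℝ, 0 ≤ C ∧ ∀ (s : ℝ) (f : E N → ℝ), 0 ≤ s →
      ‖moment G f s α‖ₑ ≤
        ENNReal.ofReal (C * (scl d (1 + s) ^ len α)⁻¹) * wsum K (scl d (1 + s)) f := by
  induction hn : len α using Nat.strong_induction_on generalizing α with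
  | _ n ih =>
    subst hn
    have hlt : ∀ β ∈ Finset.Iio α, len β < len α := fun β hβ => by
      obtain ⟨h, i, hi⟩ := Pi.lt_def.1 (Finset.mem_Iio.1 hβ)
      exact Finset.sum_lt_sum (fun j _ => h j) ⟨i, Finset.mem_univ i, hi⟩
    -- Quantifying over all β, with membership as an inner hypothesis, lets the constants be chosen
    -- as one total function.
    have : ∀ β : Fin N → ℕ, ∃ C : ℝ, 0 ≤ C ∧ (β ∈ Finset.Iio α → ∀ (s : ℝ) (f : E N → ℝ), 0 ≤ s →
        ‖moment G f s β‖ₑ ≤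
          ENNReal.ofReal (C * (scl d (1 + s) ^ len β)⁻¹) * wsum K (scl d (1 + s)) f) := by
      intro β
      by_cases hβ : β ∈ Finset.Iio α
      · have := hlt β hβ
        obtain ⟨C, hC, h⟩ := ih _ this β (le_trans (by exact_mod_cast this.le) hα) rfl
        exact ⟨C, hC, fun _ => h⟩
      · exact ⟨0, le_rfl, fun h => absurd h hβ⟩
    choose C hC0 hC using this
    refine ⟨1 + ∑ β ∈ Finset.Iio α, C β * |∫ x, monom α x * gprof G β x|,
      add_nonneg zero_le_one (Finset.sum_nonneg fun β _ => mul_nonneg (hC0 β) (abs_nonneg _)),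
      fun s f hs => ?_⟩
    have ha := scl_pos (d := d) (t := 1 + s) (by linarith)
    set a := scl d (1 + s)
    rw [moment_eq, add_mul, one_mul, Finset.sum_mul, ENNReal.ofReal_add (by positivity)
      (Finset.sum_nonneg fun β _ => by have := hC0 β; positivity), add_mul,
      ENNReal.ofReal_sum_of_nonneg (fun β _ => by have := hC0 β; positivity), Finset.sum_mul]
    refine (enorm_sub_le).trans (add_le_add ?_ ?_)
    · exact (enorm_integral_le_lintegral_enorm _).trans (lintegral_monom_le ha hα f)
    · refine (enorm_sum_le _ _).trans (Finset.sum_le_sum fun β hβ => ?_)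
      rw [enorm_mul, hG.integral_monom_gker β α hs]
      refine (mul_le_mul_left (hC β hβ s f hs) _).trans (le_of_eq ?_)
      have := hC0 β
      rw [Real.enorm_eq_ofReal_abs, abs_mul, abs_of_pos (by positivity), mul_right_comm,
        ← ENNReal.ofReal_mul (by positivity)]
      congr 2
      change _ * (a ^ len β)⁻¹ * (a ^ len β * (a ^ len α)⁻¹ * _) = _
      field_simp

theorem KernelCondition.aestronglyMeasurable_proj (hG : KernelCondition G γ d L)
    (hK : 0 ≤ K) (hKγ : ⌊K⌋₊ + 1 ≤ γ) {s : ℝ} (hs : 0 ≤ s) {f : E N → ℝ}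
    (hf : AEStronglyMeasurable f volume) : AEStronglyMeasurable (proj G K s f) volume := by
  refine hf.sub (Finset.aestronglyMeasurable_fun_sum _ fun α hα => ?_)
  have hα' := (Nat.le_floor_iff hK).2 ((mem_multiIdx hK α).1 hα)
  exact (continuous_const.mul (hG.continuous_gker (by omega) hs)).aestronglyMeasurable

/-- The growth a^{-|α|} of the moment and the size a^{|α|} of g_α cancel exactly, so P_K(s) is
bounded at scale a = (1+s)^{-1/d} uniformly in s. -/
theorem KernelCondition.exists_essNorm_proj_le (hG : KernelCondition G γ d L)
    (hK : 0 ≤ K) (hKL : K < L) (hKγ : ⌊K⌋₊ + 1 ≤ γ) :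
    ∃ C : ℝ, 0 ≤ C ∧ ∀ (s : ℝ) (f : E N → ℝ), 0 ≤ s → AEStronglyMeasurable f volume →
      essNorm K (scl d (1 + s)) (proj G K s f) ≤
        ENNReal.ofReal C * essNorm K (scl d (1 + s)) f := by
  have : ∀ α : Fin N → ℕ, ∃ C : ℝ, 0 ≤ C ∧ (α ∈ multiIdx N K → ∀ (s : ℝ) (f : E N → ℝ), 0 ≤ s →
      essNorm K (scl d (1 + s)) (fun x => moment G f s α * gker G α x s) ≤
        ENNReal.ofReal C * essNorm K (scl d (1 + s)) f) := by
    intro α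
    by_cases hα : α ∈ multiIdx N K
    · have hα' := (mem_multiIdx hK α).1 hα
      have hα'' := (Nat.le_floor_iff hK).2 hα'
      obtain ⟨C₁, h₁, H₁⟩ := hG.exists_enorm_moment_le K α hα'
      obtain ⟨C₂, h₂, H₂⟩ := hG.exists_essNorm_gker_le hK hKL (α := α) (by omega)
      refine ⟨C₁ * C₂, by positivity, fun _ s f hs => ?_⟩
      have ha := scl_pos (d := d) (t := 1 + s) (by linarith)
      rw [essNorm_const_mul]
      refine (mul_le_mul' (H₁ s f hs) (H₂ s hs)).trans ?_
      rw [mul_right_comm, ← ENNReal.ofReal_mul (by positivity)]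
      refine mul_le_mul' (le_of_eq ?_) (wsum_le_essNorm _ _ _)
      congr 1
      field_simp
    · exact ⟨0, le_rfl, fun h => absurd h hα⟩
  choose C hC0 hC using this
  refine ⟨1 + ∑ α ∈ multiIdx N K, C α,
    add_nonneg zero_le_one (Finset.sum_nonneg fun α _ => hC0 α), fun s f hs hf => ?_⟩
  have hm : ∀ α ∈ multiIdx N K,
      AEStronglyMeasurable (fun x => moment G f s α * gker G α x s) volume := fun α hα => by
    have hα' := (Nat.le_floor_iff hK).2 ((mem_multiIdx hK α).1 hα)
    exact (continuous_const.mul (hG.continuous_gker (by omega) hs)).aestronglyMeasurable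
  refine (essNorm_sub_le _ _ hf (Finset.aestronglyMeasurable_fun_sum _ hm)).trans ?_
  rw [ENNReal.ofReal_add zero_le_one (Finset.sum_nonneg fun α _ => hC0 α), add_mul,
    ENNReal.ofReal_one, one_mul, ENNReal.ofReal_sum_of_nonneg fun α _ => hC0 α, Finset.sum_mul]
  gcongr
  exact (essNorm_sum_le _ _ _ hm).trans (Finset.sum_le_sum fun α hα => hC α hα s f hs)

/-- The weight function of the decay estimate. -/
def rhoSum (K a : ℝ) (f : E N → ℝ) : ℝ≥0∞ := ∫⁻ y, ‖f y‖ₑ * ENNReal.ofReal (rho K (a * ‖y‖))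

theorem rhoSum_mono {a b : ℝ} (hK : 0 ≤ K) (ha : 0 ≤ a) (h : a ≤ b) (f : E N → ℝ) :
    rhoSum K a f ≤ rhoSum K b f := by
  unfold rhoSum
  gcongr with y
  exact rho_mono hK (by positivity) (by gcongr)

/-- Only the branch s^K of `rho` is used. Changing the scale from b to a produces (a/b)^K, which
becomes the decay factor of the projected evolution. -/
theorem rhoSum_le {a b : ℝ} (ha : 0 ≤ a) (hb : 0 < b) (f : E N → ℝ) :
    rhoSum K a f ≤ ENNReal.ofReal ((a / b) ^ K) * wsum K b f := by
  unfold rhoSum wsum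
  rw [← lintegral_const_mul' _ _ ENNReal.ofReal_ne_top]
  refine lintegral_mono fun y => ?_
  rw [mul_left_comm, ← ENNReal.ofReal_mul (by positivity)]
  gcongr
  refine (rho_le_rpow _ _).trans ?_
  have : a * ‖y‖ = a / b * (b * ‖y‖) := by field_simp
  rw [this, Real.mul_rpow (by positivity) (by positivity)]
  refine mul_le_mul_of_nonneg_left ?_ (by positivity)
  unfold wt
  linarith

theorem supNorm_evol_eq_zero (hG0 : ∀ x, ∀ t : ℝ, 0 < t → G x t = 0) {τ : ℝ} (hτ : 0 < τ) (K a : ℝ)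
    (h : E N → ℝ) : supNorm K a (evol G τ h) = 0 := by
  have : ∀ x, evol G τ h x = 0 := fun x => by simp [evol, hG0 _ τ hτ]
  simp [supNorm, wsum, this]

/-- The evolution of a projected function, for large times. -/
theorem KernelCondition.exists_supNorm_evol_proj_le_rhoSum (hG : KernelCondition G γ d L)
    (hd : 0 < d) (hL : 0 < L) (hK : 0 ≤ K) (hKL : K < L) (hKγ : ⌊K⌋₊ + 1 ≤ γ) :
    ∃ C : ℝ, 0 ≤ C ∧ ∀ (s t : ℝ) (f : E N → ℝ), 0 ≤ s → 1 + t ≤ 2 * (t - s) →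
      AEStronglyMeasurable f volume → essNorm K (scl d (1 + s)) f < ∞ →
      supNorm K (scl d (1 + t)) (evol G (t - s) (proj G K s f)) ≤
        ENNReal.ofReal C * rhoSum K (2 ^ (1 / d) * scl d (1 + t)) (proj G K s f) := by
  obtain ⟨C, hC0, hC⟩ := hG.exists_supNorm_evol_le_rho hK hKL hKγ
  obtain ⟨C', hC0', hC'⟩ := hG.exists_essNorm_proj_le hK hKL hKγ
  refine ⟨(2 ^ (1 / d)) ^ N * C, by positivity, fun s t f hs hst hf hfin => ?_⟩
  have hτ : 0 < t - s := by linarith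
  -- The moments of the projection vanish only for a kernel of mass one; in the other case the
  -- evolution itself is zero.
  rcases hG.mass_eq_one_or hd hL with hm | h0
  swap
  · rw [supNorm_evol_eq_zero h0 hτ]; exact zero_le
  have ha := scl_pos (d := d) hτ
  have hb := scl_pos (d := d) (t := 1 + t) (by linarith)
  have hc : (1 : ℝ) ≤ 2 ^ (1 / d) := Real.one_le_rpow one_le_two (by positivity)
  have hσ := scl_pos (d := d) (t := 1 + s) (by linarith)
  have hle : scl d (t - s) ≤ 2 ^ (1 / d) * scl d (1 + t) := scl_le_two_mul hd (by linarith) hst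
  have hw := (wsum_le_essNorm _ _ f).trans_lt hfin
  refine (supNorm_le_of_scale hK hb (scl_anti hd hτ (by linarith)) hc hle _).trans ?_
  rw [ENNReal.ofReal_mul (by positivity), mul_assoc]
  gcongr
  refine (hC (t - s) hτ _ (hG.aestronglyMeasurable_proj hK hKγ hs hf) ⟨_, hσ, ?_⟩
    fun α hα => ?_).trans ?_
  · exact (wsum_le_essNorm _ _ _).trans_lt ((hC' s f hs hf).trans_lt
      (ENNReal.mul_lt_top ENNReal.ofReal_lt_top hfin))
  · exact (hG.integral_monom_proj hm hK hKL hKγ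
      (fun α hα => integrable_monom_of_wsum hσ hα hf hw) hs hα).2
  · gcongr
    exact rhoSum_mono hK ha.le hle _

/-- The evolution of a projected function gains the factor `((1+s)/(1+t))^{K/d}`. -/
theorem KernelCondition.exists_supNorm_evol_proj_le (hG : KernelCondition G γ d L)
    (hd : 0 < d) (hL : 0 < L) (hK : 0 ≤ K) (hKL : K < L) (hKγ : ⌊K⌋₊ + 1 ≤ γ) :
    ∃ C : ℝ, 0 ≤ C ∧ ∀ (s t : ℝ) (f : E N → ℝ), 0 ≤ s → s < t →
      AEStronglyMeasurable f volume → essNorm K (scl d (1 + s)) f < ∞ →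
      supNorm K (scl d (1 + t)) (evol G (t - s) (proj G K s f)) ≤
        ENNReal.ofReal (C * ((1 + s) / (1 + t)) ^ (K / d)) * essNorm K (scl d (1 + s)) f := by
  obtain ⟨C₁, h₁, H₁⟩ := hG.exists_supNorm_evol_proj_le_rhoSum hd hL hK hKL hKγ
  obtain ⟨C₂, h₂, H₂⟩ := hG.exists_essNorm_proj_le hK hKL hKγ
  obtain ⟨C₃, h₃, H₃⟩ := hG.exists_supNorm_evol_le hd hK hKL
  set c : ℝ := 2 ^ (1 / d) with hcdef
  have hc : (1 : ℝ) ≤ c := Real.one_le_rpow one_le_two (by positivity)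
  have hc0 : (0 : ℝ) < c := by linarith
  refine ⟨C₁ * C₂ * c ^ K + C₃ * c ^ N * C₂ * c ^ K, by positivity, fun s t f hs hst hf hfin => ?_⟩
  have hσ := scl_pos (d := d) (t := 1 + s) (by linarith)
  have hT := scl_pos (d := d) (t := 1 + t) (by linarith)
  have hratio : ((1 + s) / (1 + t)) ^ (K / d) = (scl d (1 + t) / scl d (1 + s)) ^ K := by
    rw [Real.div_rpow hT.le hσ.le, scl_rpow (by linarith), scl_rpow (by linarith),
      Real.div_rpow (by linarith) (by linarith), Real.rpow_neg (by linarith),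
      Real.rpow_neg (by linarith)]
    field_simp
  have hpm := hG.aestronglyMeasurable_proj hK hKγ hs hf
  rw [hratio]
  set a := scl d (1 + s)
  set b := scl d (1 + t)
  have hab : b ≤ a := scl_anti hd (by linarith) (by linarith)
  have hq : 0 ≤ (b / a) ^ K := by positivity
  -- If the elapsed time is at least (1+t)/2, the vanishing moments give the gain. Otherwise 1 + t ≤
  -- 2(1 + s), the ratio is bounded below, and plain boundedness of the evolution suffices.
  rcases le_total (1 + t) (2 * (t - s)) with h | h
  · refine (H₁ s t f hs h hf hfin).trans ?_
    calc _ ≤ ENNReal.ofReal C₁ * (ENNReal.ofReal ((c * b / a) ^ K) *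
          (ENNReal.ofReal C₂ * essNorm K a f)) := by
          gcongr
          refine (rhoSum_le (by positivity) hσ _).trans ?_
          gcongr
          exact (wsum_le_essNorm _ _ _).trans (H₂ s f hs hf)
      _ = ENNReal.ofReal (C₁ * C₂ * c ^ K * (b / a) ^ K) * essNorm K a f := by
          rw [mul_div_assoc, Real.mul_rpow (by positivity) (by positivity), ← mul_assoc, ← mul_assoc,
            ← ENNReal.ofReal_mul h₁, ← ENNReal.ofReal_mul (by positivity)]
          congr 2
          ring
      _ ≤ _ := by
          refine mul_le_mul_left (ENNReal.ofReal_le_ofReal (mul_le_mul_of_nonneg_right ?_ hq)) _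
          exact le_add_of_nonneg_right (by positivity)
  · refine (H₃ (t - s) (1 + t) (by linarith) (by linarith) _ hpm).trans ?_
    have hle : a ≤ c * b := scl_le_two_mul hd (by linarith) (by linarith)
    calc _ ≤ ENNReal.ofReal C₃ * (ENNReal.ofReal (c ^ N) *
          (ENNReal.ofReal C₂ * essNorm K a f)) := by
          gcongr
          refine (essNorm_le_of_scale hK hT hab hc hle _).trans ?_
          gcongr
          exact H₂ s f hs hf
      _ = ENNReal.ofReal (C₃ * c ^ N * C₂) * essNorm K a f := by
          rw [← mul_assoc, ← mul_assoc, ← ENNReal.ofReal_mul h₃, ← ENNReal.ofReal_mul (by positivity)]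
      _ ≤ _ := by
          refine mul_le_mul_left (ENNReal.ofReal_le_ofReal ?_) _
          have h5 : 1 ≤ c ^ K * (b / a) ^ K := by
            rw [← Real.mul_rpow hc0.le (by positivity)]
            refine Real.one_le_rpow ?_ hK
            rw [← mul_div_assoc, one_le_div hσ]
            exact hle
          calc C₃ * c ^ N * C₂ ≤ C₃ * c ^ N * C₂ * (c ^ K * (b / a) ^ K) :=
                le_mul_of_one_le_right (by positivity) h5
            _ = C₃ * c ^ N * C₂ * c ^ K * (b / a) ^ K := by ring
            _ ≤ _ := by
                gcongr
                exact le_add_of_nonneg_left (by positivity)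

theorem integrable_kernel_mul (hG : KernelCondition G γ d L) (hL : 0 < L) {τ : ℝ} (hτ : 0 < τ)
    {f : E N → ℝ} (hf : Integrable f) (x : E N) : Integrable fun y => G (x - y) τ * f y := by
  obtain ⟨C, hC0, hC⟩ := hG.exists_bound hL
  have hc := hG.continuous hτ
  refine (hf.abs.const_mul (C * scl d τ ^ N)).mono'
    ((hc.comp (continuous_const.sub continuous_id)).aestronglyMeasurable.mul hf.aestronglyMeasurable)
    (Eventually.of_forall fun y => ?_)
  rw [Real.norm_eq_abs, abs_mul]
  exact mul_le_mul_of_nonneg_right (hC _ _ hτ) (abs_nonneg _)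

theorem KernelCondition.integrable_gker (hG : KernelCondition G γ d L) (hL : 0 < L)
    {α : Fin N → ℕ} (hα : len α ≤ γ) {t : ℝ} (ht : 0 ≤ t) : Integrable fun x => gker G α x t := by
  simpa [monom] using hG.integrable_monom_gker hα (β := (0 : Fin N → ℕ)) (by simpa [len]) ht

/-- The evolution of a function in terms of that of its projection. -/
theorem KernelCondition.evol_eq (hG : KernelCondition G γ d L) (hL : 0 < L) (hK : 0 ≤ K)
    (hKγ : ⌊K⌋₊ + 1 ≤ γ) {s t : ℝ} (hs : 0 ≤ s) (hst : s < t) {f : E N → ℝ} (hf : Integrable f)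
    (x : E N) : evol G (t - s) f x = evol G (t - s) (proj G K s f) x +
      ∑ α ∈ multiIdx N K, moment G f s α * gker G α x t := by
  have hτ : 0 < t - s := by linarith
  have hα : ∀ α ∈ multiIdx N K, len α ≤ γ := fun α hα => by
    have hα' := (Nat.le_floor_iff hK).2 ((mem_multiIdx hK α).1 hα)
    omega
  have hint : ∀ α ∈ multiIdx N K,
      Integrable fun y => G (x - y) (t - s) * (moment G f s α * gker G α y s) := fun α h =>
    integrable_kernel_mul hG hL hτ ((hG.integrable_gker hL (hα α h) hs).const_mul _) x
  have h1 : evol G (t - s) (proj G K s f) x = evol G (t - s) f x -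
      ∑ α ∈ multiIdx N K, ∫ y, G (x - y) (t - s) * (moment G f s α * gker G α y s) := by
    rw [← integral_finsetSum _ hint, evol, evol, ← integral_sub
      (integrable_kernel_mul hG hL hτ hf x) (integrable_finsetSum _ hint)]
    refine integral_congr_ae (Eventually.of_forall fun y => ?_)
    simp only [proj, mul_sub, Finset.mul_sum]
  rw [h1]
  refine (sub_add_cancel _ _).symm.trans (congrArg _ ?_)
  refine Finset.sum_congr rfl fun α h => ?_
  rw [← hG.evol_gker hL (hα α h) hs hst x, evol, ← integral_const_mul]
  refine integral_congr_ae (Eventually.of_forall fun y => ?_)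
  simp only
  ring

/-! ### Dependence of the moments on the function -/

theorem moment_congr_ae (G : E N → ℝ → ℝ) (s : ℝ) (α : Fin N → ℕ) {f g : E N → ℝ}
    (h : f =ᵐ[volume] g) : moment G f s α = moment G g s α := by
  induction hn : len α using Nat.strong_induction_on generalizing α with
  | _ n ih =>
    subst hn
    rw [moment_eq, moment_eq]
    congr 1
    · refine integral_congr_ae ?_
      filter_upwards [h] with x hx
      rw [hx]
    · refine Finset.sum_congr rfl fun β hβ => ?_
      obtain ⟨h', i, hi⟩ := Pi.lt_def.1 (Finset.mem_Iio.1 hβ)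
      rw [ih _ (Finset.sum_lt_sum (fun j _ => h' j) ⟨i, Finset.mem_univ i, hi⟩) β rfl]

theorem moment_sub (G : E N → ℝ → ℝ) (s : ℝ) (α : Fin N → ℕ) {f g : E N → ℝ}
    (hf : ∀ β ≤ α, Integrable fun x => monom β x * f x)
    (hg : ∀ β ≤ α, Integrable fun x => monom β x * g x) :
    moment G (fun x => f x - g x) s α = moment G f s α - moment G g s α := by
  induction hn : len α using Nat.strong_induction_on generalizing α with
  | _ n ih =>
    subst hn
    rw [moment_eq, moment_eq, moment_eq]
    have h1 : ∫ x, monom α x * (f x - g x) = (∫ x, monom α x * f x) - ∫ x, monom α x * g x := by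
      rw [← integral_sub (hf α le_rfl) (hg α le_rfl)]
      simp_rw [mul_sub]
    have h2 : ∀ β ∈ Finset.Iio α, moment G (fun x => f x - g x) s β =
        moment G f s β - moment G g s β := fun β hβ => by
      have hle := (Finset.mem_Iio.1 hβ).le
      obtain ⟨h', i, hi⟩ := Pi.lt_def.1 (Finset.mem_Iio.1 hβ)
      exact ih _ (Finset.sum_lt_sum (fun j _ => h' j) ⟨i, Finset.mem_univ i, hi⟩) β
        (fun δ hδ => hf δ (hδ.trans hle)) (fun δ hδ => hg δ (hδ.trans hle)) rfl
    rw [h1, Finset.sum_congr rfl fun β hβ => by rw [h2 β hβ, sub_mul], Finset.sum_sub_distrib]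
    ring

end Kernel

end GenHeat
end
noncomputable section
namespace GenHeat
variable {N : ℕ}

/-! ### Joint measurability -/

/-- Joint measurability of a time-dependent function on the half-space. -/
def JointMeas (h : ℝ → E N → ℝ) : Prop :=
  AEStronglyMeasurable (fun z : E N × ℝ => h z.2 z.1) (halfSpace N)

theorem JointMeas.sub {h k : ℝ → E N → ℝ} (hh : JointMeas h) (hk : JointMeas k) :
    JointMeas fun s y => h s y - k s y :=
  AEStronglyMeasurable.sub hh hk

/-- Fubini for null sets: for almost every time the slice equals that of a strongly measurable
representative, so parametric integrals can be studied for the representative. -/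
theorem JointMeas.exists_strong {h : ℝ → E N → ℝ} (hh : JointMeas h) :
    ∃ k : E N × ℝ → ℝ, StronglyMeasurable k ∧
      ∀ᵐ s ∂volume.restrict (Set.Ioi 0), h s =ᵐ[volume] fun y => k (y, s) := by
  obtain ⟨k, hk, h1⟩ := hh
  refine ⟨k, hk, ?_⟩
  unfold halfSpace at h1
  rw [← Measure.prod_swap] at h1
  have h2 := Measure.ae_ae_of_ae_prod (ae_of_ae_map measurable_swap.aemeasurable h1)
  exact h2

theorem JointMeas.slice {h : ℝ → E N → ℝ} (hh : JointMeas h) :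
    ∀ᵐ s ∂volume.restrict (Set.Ioi 0), AEStronglyMeasurable (h s) volume := by
  obtain ⟨k, hk, hhk⟩ := hh.exists_strong
  filter_upwards [hhk] with s hs
  exact ((hk.comp_measurable measurable_prodMk_right).aestronglyMeasurable).congr hs.symm

@[fun_prop]
theorem measurable_scl (d : ℝ) : Measurable (scl d) := by
  unfold scl; fun_prop

section Kernel
variable {G : E N → ℝ → ℝ} {γ : ℕ} {d L K : ℝ}

/-- In the recursion the integrals of x^α g_β are measurable through their closed form in the scale,
which is available because the half-line of times is nonnegative. -/
theorem KernelCondition.aestronglyMeasurable_moment (hG : KernelCondition G γ d L)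
    {h : ℝ → E N → ℝ} (hh : JointMeas h) (α : Fin N → ℕ) :
    AEStronglyMeasurable (fun s => moment G (h s) s α) (volume.restrict (Set.Ioi 0)) := by
  obtain ⟨k, hk, hhk⟩ := hh.exists_strong
  have key : ∀ α : Fin N → ℕ, AEStronglyMeasurable
      (fun s => moment G (fun y => k (y, s)) s α) (volume.restrict (Set.Ioi 0)) := by
    intro α
    induction hn : len α using Nat.strong_induction_on generalizing α with
    | _ n ih =>
      subst hn
      simp_rw [moment_eq G _ _ α]
      refine AEStronglyMeasurable.sub ?_ (Finset.aestronglyMeasurable_fun_sum _ fun β hβ => ?_)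
      · have h1 : StronglyMeasurable fun z : E N × ℝ => monom α z.1 * k z :=
          ((continuous_monom α).measurable.comp measurable_fst).stronglyMeasurable.mul hk
        exact h1.integral_prod_left'.aestronglyMeasurable
      · obtain ⟨h', i, hi⟩ := Pi.lt_def.1 (Finset.mem_Iio.1 hβ)
        refine (ih _ (Finset.sum_lt_sum (fun j _ => h' j) ⟨i, Finset.mem_univ i, hi⟩) β rfl).mul ?_
        have h2 : Measurable fun s : ℝ => scl d (1 + s) ^ len β * (scl d (1 + s) ^ len α)⁻¹ *
            ∫ x, monom α x * gprof G β x := by fun_prop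
        refine h2.aestronglyMeasurable.congr ?_
        filter_upwards [ae_restrict_mem measurableSet_Ioi] with s hs
        exact (hG.integral_monom_gker β α (le_of_lt hs)).symm
  refine (key α).congr ?_
  filter_upwards [hhk] with s hs
  exact (moment_congr_ae G s α hs).symm

theorem snd_pos_ae : ∀ᵐ z ∂(halfSpace N), 0 < z.2 := by
  have h1 : ∀ᵐ s ∂(volume.restrict (Set.Ioi (0 : ℝ))), 0 < s := ae_restrict_mem measurableSet_Ioi
  exact Measure.quasiMeasurePreserving_snd.ae h1

theorem KernelCondition.measurable_gker_formula (hG : KernelCondition G γ d L) {α : Fin N → ℕ}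
    (hα : len α ≤ γ) : Measurable fun z : E N × ℝ =>
      scl d (1 + z.2) ^ len α * (scl d (1 + z.2) ^ N * gprof G α (scl d (1 + z.2) • z.1)) := by
  have := (hG.gprof_decayC hα).2.1.measurable
  fun_prop

theorem KernelCondition.jointMeas_proj (hG : KernelCondition G γ d L) (hK : 0 ≤ K)
    (hKγ : ⌊K⌋₊ + 1 ≤ γ) {h : ℝ → E N → ℝ} (hh : JointMeas h) :
    JointMeas fun s => proj G K s (h s) := by
  refine AEStronglyMeasurable.sub hh (Finset.aestronglyMeasurable_fun_sum _ fun α hα => ?_)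
  have hα' := (Nat.le_floor_iff hK).2 ((mem_multiIdx hK α).1 hα)
  refine AEStronglyMeasurable.mul (hG.aestronglyMeasurable_moment hh α).comp_snd ?_
  refine (hG.measurable_gker_formula (α := α) (by omega)).aestronglyMeasurable.congr ?_
  filter_upwards [snd_pos_ae] with z hz
  exact (hG.gker_eq α z.1 hz.le).symm

/-- The values of G at nonpositive times are arbitrary, so G itself need not be measurable on the
whole product. The self-similar formula is, and it agrees with G at positive times. -/
theorem KernelCondition.measurable_kernel_formula (hG : KernelCondition G γ d L) :
    Measurable fun z : E N × ℝ => scl d z.2 ^ N * profile G (scl d z.2 • z.1) := by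
  have := hG.decayC.continuous.measurable
  fun_prop

/-- The evolution of a jointly measurable function is jointly measurable. -/
theorem KernelCondition.exists_evol_strong (hG : KernelCondition G γ d L) {h : ℝ → E N → ℝ}
    (hh : JointMeas h) : ∃ e : (E N × ℝ) × ℝ → ℝ, StronglyMeasurable e ∧
      ∀ t : ℝ, ∀ᵐ s ∂volume.restrict (Set.Ioc 0 t), ∀ x, evol G (t - s) (h s) x = e ((x, t), s) := by
  obtain ⟨k, hk, hhk⟩ := hh.exists_strong
  refine ⟨fun z => ∫ y, scl d (z.1.2 - z.2) ^ N *
    profile G (scl d (z.1.2 - z.2) • (z.1.1 - y)) * k (y, z.2), ?_, fun t => ?_⟩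
  · have h1 : Measurable fun w : ((E N × ℝ) × ℝ) × E N => (w.1.1.1 - w.2, w.1.1.2 - w.1.2) := by
      fun_prop
    have h2 : StronglyMeasurable fun w : ((E N × ℝ) × ℝ) × E N =>
        scl d (w.1.1.2 - w.1.2) ^ N *
        profile G (scl d (w.1.1.2 - w.1.2) • (w.1.1.1 - w.2)) * k (w.2, w.1.2) :=
      (hG.measurable_kernel_formula.comp h1).stronglyMeasurable.mul
        (hk.comp_measurable (by fun_prop))
    exact h2.integral_prod_right'
  · have h3 : ∀ᵐ s ∂volume.restrict (Set.Ioc 0 t), h s =ᵐ[volume] fun y => k (y, s) :=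
      ae_mono (Measure.restrict_mono Set.Ioc_subset_Ioi_self le_rfl) hhk
    have h4 : ∀ᵐ s ∂volume.restrict (Set.Ioc 0 t), s ≠ t :=
      ae_restrict_of_ae (by simp [ae_iff])
    filter_upwards [h3, h4, ae_restrict_mem measurableSet_Ioc] with s hs hst hmem x
    have hlt : 0 < t - s := sub_pos.2 (lt_of_le_of_ne hmem.2 hst)
    refine integral_congr_ae ?_
    filter_upwards [hs] with y hy
    rw [hy, hG.eq_profile hlt]

/-- The Duhamel integral agrees for positive times with a strongly measurable function. -/
theorem KernelCondition.exists_duhamel_strong (hG : KernelCondition G γ d L) {h : ℝ → E N → ℝ}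
    (hh : JointMeas h) : ∃ V : E N × ℝ → ℝ, StronglyMeasurable V ∧
      ∀ x, ∀ t : ℝ, 0 < t → ∫ s in (0 : ℝ)..t, evol G (t - s) (h s) x = V (x, t) := by
  obtain ⟨e, he, h1⟩ := hG.exists_evol_strong hh
  -- The moving endpoint t is encoded as an indicator on the product, so that measurability of
  -- parametric integrals over a fixed domain applies.
  let S : Set ((E N × ℝ) × ℝ) := {z | 0 < z.2 ∧ z.2 ≤ z.1.2}
  have hS : MeasurableSet S :=
    (measurableSet_lt measurable_const measurable_snd).inter
      (measurableSet_le measurable_snd (by fun_prop))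
  refine ⟨fun z => ∫ s, S.indicator e (z, s), (he.indicator hS).integral_prod_right', fun x t ht => ?_⟩
  rw [intervalIntegral.integral_of_le ht.le, ← integral_indicator measurableSet_Ioc]
  refine integral_congr_ae ?_
  have h2 := (ae_restrict_iff' measurableSet_Ioc).1 (h1 t)
  filter_upwards [h2] with s hs
  by_cases hmem : s ∈ Set.Ioc 0 t
  · rw [Set.indicator_of_mem hmem, hs hmem, Set.indicator_of_mem]
    exact hmem
  · rw [Set.indicator_of_notMem hmem, Set.indicator_of_notMem]
    exact hmem

/-- The norm of a Duhamel integral. -/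
theorem KernelCondition.supNorm_duhamel_le (hG : KernelCondition G γ d L) {h : ℝ → E N → ℝ}
    (hh : JointMeas h) {t b : ℝ} (ht : 0 < t) {B : ℝ → ℝ≥0∞}
    (hB : ∀ᵐ s ∂volume.restrict (Set.Ioc 0 t), supNorm K b (evol G (t - s) (h s)) ≤ B s) :
    supNorm K b (fun x => ∫ s in (0 : ℝ)..t, evol G (t - s) (h s) x) ≤
      2 * ∫⁻ s in Set.Ioc 0 t, B s := by
  obtain ⟨e, he, h1⟩ := hG.exists_evol_strong hh
  have hle : ∀ x, ‖∫ s in (0 : ℝ)..t, evol G (t - s) (h s) x‖ₑ ≤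
      ∫⁻ s in Set.Ioc 0 t, ‖evol G (t - s) (h s) x‖ₑ := fun x => by
    rw [intervalIntegral.integral_of_le ht.le]
    exact enorm_integral_le_lintegral_enorm _
  -- The supremum part and the weighted part are each bounded by the whole of ∫B, hence the factor
  -- 2; no measurability of B is then needed.
  rw [two_mul]
  unfold supNorm
  refine add_le_add ?_ ?_
  · rw [ENNReal.mul_iSup]
    refine iSup_le fun x => (mul_le_mul_right (hle x) _).trans ?_
    rw [← lintegral_const_mul' _ _ ENNReal.ofReal_ne_top]
    refine lintegral_mono_ae ?_
    filter_upwards [hB] with s hs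
    refine le_trans ?_ (le_self_add.trans hs)
    gcongr
    exact le_iSup (fun x => ‖evol G (t - s) (h s) x‖ₑ) x
  · calc wsum K b (fun x => ∫ s in (0 : ℝ)..t, evol G (t - s) (h s) x)
        ≤ ∫⁻ x, ∫⁻ s in Set.Ioc 0 t, ‖e ((x, t), s)‖ₑ * ENNReal.ofReal (wt K b x) := by
          refine lintegral_mono fun x => ?_
          rw [lintegral_mul_const' _ _ ENNReal.ofReal_ne_top]
          gcongr
          refine (hle x).trans (lintegral_mono_ae ?_)
          filter_upwards [h1 t] with s hs
          rw [hs x]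
      _ = ∫⁻ s in Set.Ioc 0 t, ∫⁻ x, ‖e ((x, t), s)‖ₑ * ENNReal.ofReal (wt K b x) := by
          have hm : AEMeasurable (fun z : E N × ℝ => ‖e ((z.1, t), z.2)‖ₑ *
              ENNReal.ofReal (wt K b z.1)) (volume.prod (volume.restrict (Set.Ioc 0 t))) := by
            have h2 : Measurable fun z : E N × ℝ => e ((z.1, t), z.2) :=
              he.measurable.comp (by fun_prop)
            have h3 := (measurable_wt (N := N) K b)
            fun_prop
          exact lintegral_lintegral_swap hm
      _ ≤ _ := by
          refine lintegral_mono_ae ?_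
          filter_upwards [hB, h1 t] with s hs hse
          refine le_trans (le_of_eq ?_) (le_add_self.trans hs)
          unfold wsum
          simp_rw [hse]

/-- Absolute convergence of the Duhamel integral. -/
theorem KernelCondition.integrable_slab (hG : KernelCondition G γ d L) (hL : 0 < L)
    {h : ℝ → E N → ℝ} (hh : JointMeas h) {t D : ℝ}
    (hD : ∀ᵐ s ∂volume.restrict (Set.Ioc 0 t), eLpNorm (h s) ∞ volume ≤ ENNReal.ofReal D) (x : E N) :
    Integrable (fun z : E N × ℝ => G (x - z.1) (t - z.2) * h z.2 z.1) (slab N t) := by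
  have hsub : slab N t ≤ halfSpace N :=
    Measure.prod_mono le_rfl (Measure.restrict_mono Set.Ioc_subset_Ioi_self le_rfl)
  have hne : ∀ᵐ s ∂volume.restrict (Set.Ioc 0 t), s < t := by
    have h4 : ∀ᵐ s ∂volume.restrict (Set.Ioc 0 t), s ≠ t :=
      ae_restrict_of_ae (by simp [ae_iff])
    filter_upwards [h4, ae_restrict_mem measurableSet_Ioc] with s hs hm
    exact lt_of_le_of_ne hm.2 hs
  have hne' : ∀ᵐ z ∂(slab N t), z.2 < t := Measure.quasiMeasurePreserving_snd.ae hne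
  have hmeas : AEStronglyMeasurable (fun z : E N × ℝ => G (x - z.1) (t - z.2) * h z.2 z.1)
      (slab N t) := by
    refine AEStronglyMeasurable.mul ?_ (AEStronglyMeasurable.mono_measure hh hsub)
    have h1 : Measurable fun w : E N × ℝ => (x - w.1, t - w.2) := by fun_prop
    refine (hG.measurable_kernel_formula.comp h1).aestronglyMeasurable.congr ?_
    filter_upwards [hne'] with z hz
    exact (hG.eq_profile (sub_pos.2 hz) _).symm
  refine ⟨hmeas, ?_⟩
  have hpi := hG.profile_integrable hL
  set M := ∫⁻ y, ‖profile G y‖ₑ with hM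
  have hMt : M < ∞ := hpi.2
  have hkey : ∫⁻ z, ‖G (x - z.1) (t - z.2) * h z.2 z.1‖ₑ ∂(slab N t) ≤
      ∫⁻ _ in Set.Ioc 0 t, M * ENNReal.ofReal D := by
    rw [slab, lintegral_prod_symm _ hmeas.enorm]
    refine lintegral_mono_ae ?_
    filter_upwards [hne, hD] with s hs hDs
    have hτ := sub_pos.2 hs
    have ha := scl_pos (d := d) hτ
    calc _ ≤ ∫⁻ y, ‖G (x - y) (t - s)‖ₑ * ENNReal.ofReal D := by
          refine lintegral_mono_ae ?_
          filter_upwards [enorm_ae_le_eLpNorm_top (h s)] with y hy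
          rw [enorm_mul]
          gcongr
          exact hy.trans hDs
      _ = M * ENNReal.ofReal D := by
          rw [lintegral_mul_const' _ _ ENNReal.ofReal_ne_top,
            lintegral_sub_left_eq_self (fun y => ‖G y (t - s)‖ₑ) x, hM,
            ← lintegral_scale ha fun y => ‖profile G y‖ₑ]
          congr 1
          refine lintegral_congr fun y => ?_
          rw [hG.eq_profile hτ, enorm_scale ha]
  refine hkey.trans_lt ?_
  rw [lintegral_const, Measure.restrict_apply_univ, Real.volume_Ioc]
  exact ENNReal.mul_lt_top (ENNReal.mul_lt_top hMt ENNReal.ofReal_lt_top) ENNReal.ofReal_lt_top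

theorem KernelCondition.intervalIntegrable_evol (hG : KernelCondition G γ d L) (hL : 0 < L)
    {h : ℝ → E N → ℝ} (hh : JointMeas h) {t D : ℝ} (ht : 0 < t)
    (hD : ∀ᵐ s ∂volume.restrict (Set.Ioc 0 t), eLpNorm (h s) ∞ volume ≤ ENNReal.ofReal D) (x : E N) :
    IntervalIntegrable (fun s => evol G (t - s) (h s) x) volume 0 t := by
  rw [intervalIntegrable_iff_integrableOn_Ioc_of_le ht.le]
  exact (hG.integrable_slab hL hh hD x).integral_prod_right

end Kernel

/-! ### The nonlinearity -/

/-- A function which is measurable in `z` and locally Lipschitz in `v` can be composed with a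
measurable function. -/
theorem aestronglyMeasurable_nonlin {F : E N → ℝ → ℝ → ℝ} {Cstar A p : ℝ} (hp : 1 ≤ p)
    (hFmeas : ∀ v : ℝ, AEStronglyMeasurable (fun z : E N × ℝ => F z.1 z.2 v) (halfSpace N))
    (hF : ∀ (x : E N) (t : ℝ), 0 < t → ∀ u₁ u₂ : ℝ,
      |F x t u₁ - F x t u₂| ≤
        Cstar * (1 + t) ^ A * max (|u₁| ^ (p - 1)) (|u₂| ^ (p - 1)) * |u₁ - u₂|)
    {w : E N → ℝ → ℝ}
    (hw : AEStronglyMeasurable (fun z : E N × ℝ => w z.1 z.2) (halfSpace N)) :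
    JointMeas (nonlin F w) := by
  have hk := hw.stronglyMeasurable_mk
  set k := hw.mk _ with hkdef
  -- Composed with a simple function, F becomes a finite sum of indicators times F(·,·,c). The
  -- Lipschitz bound then gives convergence along the simple approximations.
  have hm : ∀ n, AEStronglyMeasurable (fun z : E N × ℝ => F z.1 z.2 (hk.approx n z))
      (halfSpace N) := by
    intro n
    have h1 : (fun z : E N × ℝ => F z.1 z.2 (hk.approx n z)) = fun z =>
        ∑ c ∈ (hk.approx n).range,
          ((hk.approx n) ⁻¹' {c}).indicator (fun z : E N × ℝ => F z.1 z.2 c) z := by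
      funext z
      rw [Finset.sum_eq_single (hk.approx n z)]
      · simp
      · intro c _ hc
        exact Set.indicator_of_notMem (by simpa using hc.symm) _
      · intro hz
        exact absurd (SimpleFunc.mem_range_self _ z) hz
    rw [h1]
    exact Finset.aestronglyMeasurable_fun_sum _ fun c _ =>
      (hFmeas c).indicator ((hk.approx n).measurableSet_fiber c)
  refine aestronglyMeasurable_of_tendsto_ae atTop hm ?_
  filter_upwards [hw.ae_eq_mk, snd_pos_ae] with z hz hpos
  have hlim := hk.tendsto_approx z
  have hz' : k z = w z.1 z.2 := hz.symm
  rw [hz'] at hlim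
  rw [nonlin, tendsto_iff_norm_sub_tendsto_zero]
  refine squeeze_zero (fun _ => norm_nonneg _) (fun n => hF z.1 z.2 hpos _ _) ?_
  have h2 : Continuous fun v : ℝ => Cstar * (1 + z.2) ^ A *
      max (|v| ^ (p - 1)) (|w z.1 z.2| ^ (p - 1)) * |v - w z.1 z.2| := by
    have : Continuous fun v : ℝ => |v| ^ (p - 1) :=
      continuous_abs.rpow_const fun _ => Or.inr (by linarith)
    fun_prop
  have h3 := (h2.tendsto (w z.1 z.2)).comp hlim
  simpa [Function.comp_def] using h3

end GenHeat
end
noncomputable section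
namespace GenHeat
variable {N : ℕ}

/-! ### Time integrals of powers -/

theorem continuousOn_one_add_rpow (c t : ℝ) :
    ContinuousOn (fun s : ℝ => (1 + s) ^ c) (Set.Icc 0 t) := fun s hs =>
  ((continuousAt_const.add continuousAt_id).rpow_const
    (Or.inl (by have := hs.1; have h : (0 : ℝ) < 1 + s := by linarith
                exact h.ne'))).continuousWithinAt

theorem lintegral_one_add_rpow {t : ℝ} (ht : 0 ≤ t) (c : ℝ) :
    ∫⁻ s in Set.Ioc 0 t, ENNReal.ofReal ((1 + s) ^ c) =
      ENNReal.ofReal (∫ s in (0 : ℝ)..t, (1 + s) ^ c) := by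
  rw [intervalIntegral.integral_of_le ht, ofReal_integral_eq_lintegral_ofReal]
  · exact ((continuousOn_one_add_rpow c t).integrableOn_compact isCompact_Icc).mono_set
      Set.Ioc_subset_Icc_self
  · filter_upwards [ae_restrict_mem measurableSet_Ioc] with s hs
    have := hs.1
    exact Real.rpow_nonneg (by linarith) _

theorem integral_one_add_rpow_le {t c : ℝ} (hc : 0 < c) :
    ∫ s in (0 : ℝ)..t, (1 + s) ^ (c - 1) ≤ (1 + t) ^ c / c := by
  rw [intervalIntegral.integral_comp_add_left (fun s : ℝ => s ^ (c - 1)),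
    integral_rpow (Or.inl (by linarith)), add_zero, Real.one_rpow, sub_add_cancel]
  gcongr
  linarith

theorem integral_one_add_rpow_eq_log {t : ℝ} (ht : 0 ≤ t) :
    ∫ s in (0 : ℝ)..t, (1 + s) ^ (0 - 1 : ℝ) = Real.log (1 + t) := by
  rw [intervalIntegral.integral_comp_add_left (fun s : ℝ => s ^ (0 - 1 : ℝ)), add_zero]
  simp_rw [zero_sub, Real.rpow_neg_one]
  rw [integral_inv_of_pos one_pos (by linarith), div_one]

theorem integral_one_add_rpow_le_of_neg {t c : ℝ} (ht : 0 ≤ t) (hc : c < 0) :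
    ∫ s in (0 : ℝ)..t, (1 + s) ^ (c - 1) ≤ (-c)⁻¹ := by
  have h0 : (0 : ℝ) ∉ Set.uIcc (1 + 0) (1 + t) := by
    rw [Set.uIcc_of_le (by linarith)]
    intro h
    have := h.1
    linarith
  rw [intervalIntegral.integral_comp_add_left (fun s : ℝ => s ^ (c - 1)),
    integral_rpow (Or.inr ⟨by linarith, h0⟩), add_zero, Real.one_rpow, sub_add_cancel,
    ← neg_div_neg_eq, inv_eq_one_div]
  have : 0 ≤ (1 + t) ^ c := by positivity
  have hc' : 0 < -c := by linarith
  gcongr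
  linarith

theorem integral_one_add_rpow_nonneg {t : ℝ} (ht : 0 ≤ t) (c : ℝ) :
    0 ≤ ∫ s in (0 : ℝ)..t, (1 + s) ^ c :=
  intervalIntegral.integral_nonneg ht fun s hs =>
    Real.rpow_nonneg (by have := hs.1; linarith) _

theorem ae_lt_of_Ioc (t : ℝ) : ∀ᵐ s ∂volume.restrict (Set.Ioc 0 t), 0 < s ∧ s < t := by
  have h4 : ∀ᵐ s ∂volume.restrict (Set.Ioc 0 t), s ≠ t :=
    ae_restrict_of_ae (by simp [ae_iff])
  filter_upwards [h4, ae_restrict_mem measurableSet_Ioc] with s hs hm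
  exact ⟨hm.1, lt_of_le_of_ne hm.2 hs⟩

/-! ### Dominated convergence for the gain function -/

/-- a^{-K} rho(ar) is dominated by r^K and bounded by a^{⌊K⌋+1-K} r^{⌊K⌋+1}, which tends to 0 since
⌊K⌋ + 1 > K. The general measure space covers both the initial function on space and the source on
space-time. -/
theorem tendsto_lintegral_rho {Ω : Type*} [MeasurableSpace Ω] {μ : Measure Ω} {g r : Ω → ℝ}
    {K : ℝ} (hg : AEStronglyMeasurable g μ) (hr : Measurable r) (hr0 : ∀ ω, 0 ≤ r ω)
    (hfin : ∫⁻ ω, ‖g ω‖ₑ * ENNReal.ofReal (r ω ^ K) ∂μ < ∞) :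
    Tendsto (fun a : ℝ => ENNReal.ofReal ((a ^ K)⁻¹) *
        ∫⁻ ω, ‖g ω‖ₑ * ENNReal.ofReal (rho K (a * r ω)) ∂μ)
      (nhdsWithin 0 (Set.Ioi 0)) (nhds 0) := by
  simp_rw [← lintegral_const_mul' _ _ ENNReal.ofReal_ne_top]
  have hrho := measurable_rho K
  have key : Tendsto (fun a : ℝ => ∫⁻ ω, ENNReal.ofReal ((a ^ K)⁻¹) *
        (‖g ω‖ₑ * ENNReal.ofReal (rho K (a * r ω))) ∂μ)
      (nhdsWithin 0 (Set.Ioi 0)) (nhds (∫⁻ _, 0 ∂μ)) := by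
    refine tendsto_lintegral_filter_of_dominated_convergence'
      (fun ω => ‖g ω‖ₑ * ENNReal.ofReal (r ω ^ K)) ?_ ?_ hfin.ne ?_
    · refine Eventually.of_forall fun a => ?_
      have h1 := hg.enorm
      have h2 : Measurable fun ω => ENNReal.ofReal (rho K (a * r ω)) := by fun_prop
      exact (h1.mul h2.aemeasurable).const_mul _
    · filter_upwards [self_mem_nhdsWithin] with a (ha : 0 < a)
      refine Eventually.of_forall fun ω => ?_
      rw [mul_left_comm, ← ENNReal.ofReal_mul (by positivity)]
      gcongr
      have := hr0 ω
      rw [inv_mul_le_iff₀ (by positivity), ← Real.mul_rpow ha.le this]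
      exact rho_le_rpow _ _
    · refine Eventually.of_forall fun ω => ?_
      have hr := hr0 ω
      have h3 : Tendsto (fun a : ℝ => ENNReal.ofReal ((a ^ K)⁻¹ * rho K (a * r ω)))
          (nhdsWithin 0 (Set.Ioi 0)) (nhds 0) := by
        rw [← ENNReal.ofReal_zero]
        refine ENNReal.tendsto_ofReal ?_
        set q : ℝ := (⌊K⌋₊ + 1 : ℕ) - K with hq
        have hq0 : 0 < q := by
          rw [hq]; push_cast; linarith [Nat.lt_floor_add_one K]
        have h4 : Tendsto (fun a : ℝ => a ^ q * r ω ^ (⌊K⌋₊ + 1)) (nhdsWithin 0 (Set.Ioi 0))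
            (nhds 0) := by
          have := ((Real.continuous_rpow_const hq0.le).tendsto 0).mul_const (r ω ^ (⌊K⌋₊ + 1))
          rw [Real.zero_rpow hq0.ne', zero_mul] at this
          exact this.mono_left nhdsWithin_le_nhds
        refine tendsto_of_tendsto_of_tendsto_of_le_of_le' tendsto_const_nhds h4 ?_ ?_
        · filter_upwards [self_mem_nhdsWithin] with a (ha : 0 < a)
          exact mul_nonneg (by positivity) (rho_nonneg K (by positivity))
        · filter_upwards [self_mem_nhdsWithin] with a (ha : 0 < a)
          refine (mul_le_mul_of_nonneg_left (rho_le_pow K _) (by positivity)).trans (le_of_eq ?_)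
          rw [mul_pow, ← mul_assoc, hq, Real.rpow_sub ha, Real.rpow_natCast]
          ring
      have h5 := ENNReal.Tendsto.const_mul (a := ‖g ω‖ₑ) h3 (Or.inr enorm_ne_top)
      rw [mul_zero] at h5
      refine h5.congr' ?_
      filter_upwards [self_mem_nhdsWithin] with a (ha : 0 < a)
      rw [ENNReal.ofReal_mul (by positivity)]
      ring
  simpa using key

theorem tendsto_scale (d c : ℝ) (hd : 0 < d) (hc : 0 < c) :
    Tendsto (fun t : ℝ => c * scl d (1 + t)) atTop (nhdsWithin 0 (Set.Ioi 0)) := by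
  rw [tendsto_nhdsWithin_iff]
  constructor
  · have h1 : Tendsto (fun t : ℝ => scl d (1 + t)) atTop (nhds 0) :=
      (tendsto_rpow_neg_atTop (y := 1 / d) (by positivity)).comp
        (tendsto_atTop_add_const_left _ 1 tendsto_id)
    simpa using h1.const_mul c
  · filter_upwards [eventually_gt_atTop 0] with t ht
    have := scl_pos (d := d) (t := 1 + t) (by linarith)
    exact mul_pos hc this

/-! ### Estimates for projected Duhamel integrals and the projected initial function -/

section Kernel
variable {G : E N → ℝ → ℝ} {γ : ℕ} {d L K : ℝ}

/-- The decay `O((1+s)^{-1-b})` of a source term. -/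
def SourceBound (d K C b : ℝ) (h : ℝ → E N → ℝ) : Prop :=
  ∀ᵐ s ∂volume.restrict (Set.Ioi 0),
    essNorm K (scl d (1 + s)) (h s) ≤ ENNReal.ofReal (C * (1 + s) ^ (-1 - b))

/-- The Duhamel integral of the projected source `h`. -/
def duhamel (G : E N → ℝ → ℝ) (K : ℝ) (h : ℝ → E N → ℝ) (t : ℝ) (x : E N) : ℝ :=
  ∫ s in (0 : ℝ)..t, evol G (t - s) (proj G K s (h s)) x

/-- The gain ((1+s)/(1+t))^{K/d} multiplied by the source decay (1+s)^{-1-b}, integrated in s. -/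
theorem KernelCondition.exists_supNorm_duhamel_le (hG : KernelCondition G γ d L)
    (hd : 0 < d) (hL : 0 < L) (hK : 0 ≤ K) (hKL : K < L) (hKγ : ⌊K⌋₊ + 1 ≤ γ) :
    ∃ C₀ : ℝ, 0 ≤ C₀ ∧ ∀ (h : ℝ → E N → ℝ) (C b : ℝ), JointMeas h → 0 ≤ C →
      SourceBound d K C b h → ∀ t : ℝ, 0 < t →
      supNorm K (scl d (1 + t)) (duhamel G K h t) ≤
        ENNReal.ofReal (C₀ * C * (1 + t) ^ (-(K / d)) *
          ∫ s in (0 : ℝ)..t, (1 + s) ^ ((K / d - b) - 1)) := by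
  obtain ⟨C₁, h₁, H₁⟩ := hG.exists_supNorm_evol_proj_le hd hL hK hKL hKγ
  refine ⟨2 * C₁, by positivity, fun h C b hh hC hb t ht => ?_⟩
  have hB : ∀ᵐ s ∂volume.restrict (Set.Ioc 0 t),
      supNorm K (scl d (1 + t)) (evol G (t - s) (proj G K s (h s))) ≤
        ENNReal.ofReal (C₁ * C * (1 + t) ^ (-(K / d))) *
          ENNReal.ofReal ((1 + s) ^ ((K / d - b) - 1)) := by
    have h3 : ∀ᵐ s ∂volume.restrict (Set.Ioc 0 t), AEStronglyMeasurable (h s) volume :=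
      ae_mono (Measure.restrict_mono Set.Ioc_subset_Ioi_self le_rfl) hh.slice
    filter_upwards [h3, ae_lt_of_Ioc t,
      ae_mono (Measure.restrict_mono Set.Ioc_subset_Ioi_self le_rfl) hb] with s hs hst hbs
    have h1s : 0 < 1 + s := by linarith [hst.1]
    have h1t : 0 < 1 + t := by linarith
    refine (H₁ s t _ hst.1.le hst.2 hs (hbs.trans_lt ENNReal.ofReal_lt_top)).trans ?_
    refine (mul_le_mul_right hbs _).trans (le_of_eq ?_)
    rw [← ENNReal.ofReal_mul (by positivity), ← ENNReal.ofReal_mul (by positivity)]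
    congr 1
    rw [Real.div_rpow h1s.le h1t.le, Real.rpow_neg h1t.le,
      show K / d - b - 1 = K / d + (-1 - b) by ring, Real.rpow_add h1s]
    ring
  refine (hG.supNorm_duhamel_le (hG.jointMeas_proj hK hKγ hh) ht hB).trans (le_of_eq ?_)
  rw [lintegral_const_mul' _ _ ENNReal.ofReal_ne_top, lintegral_one_add_rpow ht.le,
    ← ENNReal.ofReal_mul (by positivity), ← ENNReal.ofReal_ofNat 2,
    ← ENNReal.ofReal_mul (by positivity)]
  congr 1
  ring

theorem lintegral_rhoSum_eq {p : ℝ → E N → ℝ} (hp : JointMeas p) (K a : ℝ) :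
    ∫⁻ s in Set.Ioi 0, rhoSum K a (p s) =
      ∫⁻ z, ‖p z.2 z.1‖ₑ * ENNReal.ofReal (rho K (a * ‖z.1‖)) ∂(halfSpace N) := by
  have hrho := measurable_rho K
  have hm : Measurable fun z : E N × ℝ => ENNReal.ofReal (rho K (a * ‖z.1‖)) := by fun_prop
  have h1 : AEMeasurable (fun z : E N × ℝ => ‖p z.2 z.1‖ₑ * ENNReal.ofReal (rho K (a * ‖z.1‖)))
      (halfSpace N) := AEMeasurable.mul (AEStronglyMeasurable.enorm hp) hm.aemeasurable
  unfold halfSpace at h1 ⊢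
  rw [lintegral_prod_symm _ h1]
  rfl

theorem lintegral_norm_rpow_le {s : ℝ} (hs : 0 ≤ s) (f : E N → ℝ) :
    ∫⁻ y, ‖f y‖ₑ * ENNReal.ofReal (‖y‖ ^ K) ≤
      ENNReal.ofReal ((1 + s) ^ (K / d)) * wsum K (scl d (1 + s)) f := by
  have h1 : 0 < 1 + s := by linarith
  have ha := scl_pos (d := d) h1
  unfold wsum
  rw [← lintegral_const_mul' _ _ ENNReal.ofReal_ne_top]
  refine lintegral_mono fun y => ?_
  rw [mul_left_comm, ← ENNReal.ofReal_mul (by positivity)]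
  gcongr
  unfold wt
  rw [Real.mul_rpow ha.le (norm_nonneg _), scl_rpow h1, mul_add, ← mul_assoc, ← Real.rpow_add h1,
    add_neg_cancel, Real.rpow_zero, one_mul]
  exact le_add_of_nonneg_left (by positivity)

theorem lintegral_one_add_rpow_Ioi_lt_top {c : ℝ} (hc : c < -1) (C : ℝ) :
    ∫⁻ s in Set.Ioi (0 : ℝ), ENNReal.ofReal (C * (1 + s) ^ c) < ∞ := by
  have h1 := (integrableOn_add_rpow_Ioi_of_lt (c := 0) (m := 1) hc (by norm_num)).const_mul C
  simp_rw [add_comm _ (1 : ℝ)] at h1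
  exact h1.lintegral_lt_top

/-- The Duhamel integral of a source with fast decay is `o(t^{-K/d})`. -/
theorem KernelCondition.tendsto_supNorm_duhamel (hG : KernelCondition G γ d L)
    (hd : 0 < d) (hL : 0 < L) (hK : 0 ≤ K) (hKL : K < L) (hKγ : ⌊K⌋₊ + 1 ≤ γ)
    {h : ℝ → E N → ℝ} {C b : ℝ} (hh : JointMeas h) (hC : 0 ≤ C)
    (hb : SourceBound d K C b h) (hbK : K / d < b) :
    Tendsto (fun t : ℝ => ENNReal.ofReal ((1 + t) ^ (K / d)) *
      supNorm K (scl d (1 + t)) (duhamel G K h t)) atTop (nhds 0) := by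
  obtain ⟨C₁, h₁, H₁⟩ := hG.exists_supNorm_evol_proj_le hd hL hK hKL hKγ
  obtain ⟨C₂, h₂, H₂⟩ := hG.exists_supNorm_evol_proj_le_rhoSum hd hL hK hKL hKγ
  obtain ⟨C₃, h₃, H₃⟩ := hG.exists_essNorm_proj_le hK hKL hKγ
  have hpj := hG.jointMeas_proj hK hKγ hh
  set c : ℝ := 2 ^ (1 / d) with hcdef
  have hc0 : (0 : ℝ) < c := by positivity
  -- The excess of b over K/d is halved: one half supplies a factor tending to 0 when s is
  -- comparable with t, the other makes (1+s)^{-q-1} integrable.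
  set q : ℝ := (b - K / d) / 2 with hq
  have hq0 : 0 < q := by rw [hq]; linarith
  set I : ℝ → ℝ≥0∞ := fun a =>
    ∫⁻ z, ‖proj G K z.2 (h z.2) z.1‖ₑ * ENNReal.ofReal (rho K (a * ‖z.1‖)) ∂(halfSpace N) with hI
  -- Dominated convergence in space-time: b > K/d is exactly what makes (1+s)^{K/d-1-b}, which
  -- bounds ∫|P_K(s)h(s)||y|^K dy, integrable over all times.
  have hlim1 : Tendsto (fun a : ℝ => ENNReal.ofReal ((a ^ K)⁻¹) * I a)
      (nhdsWithin 0 (Set.Ioi 0)) (nhds 0) := by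
    refine tendsto_lintegral_rho (g := fun z : E N × ℝ => proj G K z.2 (h z.2) z.1)
      (r := fun z : E N × ℝ => ‖z.1‖) hpj (by fun_prop) (fun _ => norm_nonneg _) ?_
    have hm : Measurable fun z : E N × ℝ => ENNReal.ofReal (‖z.1‖ ^ K) := by fun_prop
    have hm' : AEMeasurable (fun z : E N × ℝ =>
        ‖proj G K z.2 (h z.2) z.1‖ₑ * ENNReal.ofReal (‖z.1‖ ^ K)) (halfSpace N) :=
      AEMeasurable.mul (AEStronglyMeasurable.enorm hpj) hm.aemeasurable
    unfold halfSpace at hm' ⊢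
    rw [lintegral_prod_symm _ hm']
    refine lt_of_le_of_lt ?_ (lintegral_one_add_rpow_Ioi_lt_top
      (c := K / d + (-1 - b)) (by linarith) (C₃ * C))
    refine lintegral_mono_ae ?_
    filter_upwards [hh.slice, ae_restrict_mem measurableSet_Ioi, hb] with s hs (hs0 : 0 < s) hbs
    have h1s : 0 < 1 + s := by linarith
    refine (lintegral_norm_rpow_le (d := d) hs0.le _).trans ?_
    refine (mul_le_mul_right (((wsum_le_essNorm _ _ _).trans (H₃ s _ hs0.le hs)).trans
      (mul_le_mul_right hbs _)) _).trans (le_of_eq ?_)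
    rw [← ENNReal.ofReal_mul (by positivity), ← ENNReal.ofReal_mul (by positivity),
      Real.rpow_add h1s]
    congr 1
    ring
  have hlim2 : Tendsto (fun t : ℝ => ENNReal.ofReal (2 * C₂ * c ^ K) *
      (ENNReal.ofReal (((c * scl d (1 + t)) ^ K)⁻¹) * I (c * scl d (1 + t)))) atTop (nhds 0) := by
    have := ENNReal.Tendsto.const_mul (a := ENNReal.ofReal (2 * C₂ * c ^ K))
      (hlim1.comp (tendsto_scale d c hd hc0)) (Or.inr ENNReal.ofReal_ne_top)
    rwa [mul_zero] at this
  have hlim3 : Tendsto (fun t : ℝ => ENNReal.ofReal (2 * C₁ * C * q⁻¹ * ((1 + t) / 2) ^ (-q)))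
      atTop (nhds 0) := by
    rw [← ENNReal.ofReal_zero]
    refine ENNReal.tendsto_ofReal ?_
    have h6 : Tendsto (fun t : ℝ => (1 + t) / 2) atTop atTop :=
      (tendsto_atTop_add_const_left _ 1 tendsto_id).atTop_div_const two_pos
    simpa using ((tendsto_rpow_neg_atTop hq0).comp h6).const_mul (2 * C₁ * C * q⁻¹)
  have hsum := hlim2.add hlim3
  rw [add_zero] at hsum
  refine tendsto_of_tendsto_of_tendsto_of_le_of_le' tendsto_const_nhds hsum
    (Eventually.of_forall fun _ => zero_le) ?_
  filter_upwards [eventually_gt_atTop 0] with t ht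
  have h1t : 0 < 1 + t := by linarith
  have hat := scl_pos (d := d) h1t
  -- Each s satisfies one of two bounds according to the elapsed time; taking their sum avoids
  -- cutting the interval. In the second case 1 + s ≥ (1 + t)/2.
  have hB : ∀ᵐ s ∂volume.restrict (Set.Ioc 0 t),
      supNorm K (scl d (1 + t)) (evol G (t - s) (proj G K s (h s))) ≤
        ENNReal.ofReal C₂ * rhoSum K (c * scl d (1 + t)) (proj G K s (h s)) +
        ENNReal.ofReal (C₁ * C * (1 + t) ^ (-(K / d)) * ((1 + t) / 2) ^ (-q)) *
          ENNReal.ofReal ((1 + s) ^ (-q - 1)) := by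
    have h3 : ∀ᵐ s ∂volume.restrict (Set.Ioc 0 t), AEStronglyMeasurable (h s) volume :=
      ae_mono (Measure.restrict_mono Set.Ioc_subset_Ioi_self le_rfl) hh.slice
    filter_upwards [h3, ae_lt_of_Ioc t,
      ae_mono (Measure.restrict_mono Set.Ioc_subset_Ioi_self le_rfl) hb] with s hs hst hbs
    have h1s : 0 < 1 + s := by linarith [hst.1]
    have hfin := hbs.trans_lt ENNReal.ofReal_lt_top
    rcases le_total (1 + t) (2 * (t - s)) with hle | hle
    · exact (H₂ s t _ hst.1.le hle hs hfin).trans le_self_add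
    · refine le_trans ?_ le_add_self
      refine (H₁ s t _ hst.1.le hst.2 hs hfin).trans ?_
      refine (mul_le_mul_right hbs _).trans ?_
      rw [← ENNReal.ofReal_mul (by positivity), ← ENNReal.ofReal_mul (by positivity)]
      refine ENNReal.ofReal_le_ofReal ?_
      have h7 : (1 + s) ^ (-q) ≤ ((1 + t) / 2) ^ (-q) :=
        Real.rpow_le_rpow_of_nonpos (by positivity) (by linarith) (by linarith)
      calc C₁ * ((1 + s) / (1 + t)) ^ (K / d) * (C * (1 + s) ^ (-1 - b))
          = C₁ * C * (1 + t) ^ (-(K / d)) * (1 + s) ^ (-q) * (1 + s) ^ (-q - 1) := by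
            rw [Real.div_rpow h1s.le h1t.le, Real.rpow_neg h1t.le,
              show -1 - b = -(K / d) + -q + (-q - 1) by rw [hq]; ring, Real.rpow_add h1s,
              Real.rpow_add h1s, Real.rpow_neg h1s.le (K / d)]
            field_simp
        _ ≤ _ := by gcongr
  refine (mul_le_mul_right (hG.supNorm_duhamel_le hpj ht hB) _).trans ?_
  have hmeas : Measurable fun s : ℝ => ENNReal.ofReal
      (C₁ * C * (1 + t) ^ (-(K / d)) * ((1 + t) / 2) ^ (-q)) *
          ENNReal.ofReal ((1 + s) ^ (-q - 1)) := by fun_prop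
  rw [lintegral_add_right _ hmeas, lintegral_const_mul' _ _ ENNReal.ofReal_ne_top,
    lintegral_const_mul' _ _ ENNReal.ofReal_ne_top, lintegral_one_add_rpow ht.le, mul_add, mul_add]
  have hrt : ((c * scl d (1 + t)) ^ K)⁻¹ = (c ^ K)⁻¹ * (1 + t) ^ (K / d) := by
    rw [Real.mul_rpow hc0.le hat.le, scl_rpow h1t, mul_inv, Real.rpow_neg h1t.le, inv_inv]
  refine add_le_add ?_ ?_
  · calc _ ≤ ENNReal.ofReal ((1 + t) ^ (K / d)) *
          (2 * (ENNReal.ofReal C₂ * I (c * scl d (1 + t)))) := by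
          gcongr
          rw [hI]
          simp only
          rw [← lintegral_rhoSum_eq hpj]
          exact lintegral_mono_set Set.Ioc_subset_Ioi_self
      _ = _ := by
          rw [hrt, ← ENNReal.ofReal_ofNat 2, ← mul_assoc, ← mul_assoc, ← mul_assoc,
            ← ENNReal.ofReal_mul (by positivity), ← ENNReal.ofReal_mul (by positivity),
            ← ENNReal.ofReal_mul (by positivity)]
          congr 2
          field_simp
  · rw [← ENNReal.ofReal_mul (by positivity), ← ENNReal.ofReal_ofNat 2,
      ← ENNReal.ofReal_mul (by positivity), ← ENNReal.ofReal_mul (by positivity)]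
    refine ENNReal.ofReal_le_ofReal ?_
    have h8 := integral_one_add_rpow_le_of_neg ht.le (neg_neg_of_pos hq0)
    rw [neg_neg] at h8
    have h9 : (1 + t) ^ (K / d) * (1 + t) ^ (-(K / d)) = 1 := by
      rw [← Real.rpow_add h1t, add_neg_cancel, Real.rpow_zero]
    calc _ = 2 * C₁ * C * ((1 + t) / 2) ^ (-q) * ((1 + t) ^ (K / d) * (1 + t) ^ (-(K / d))) *
          ∫ s in (0 : ℝ)..t, (1 + s) ^ (-q - 1) := by ring
      _ ≤ 2 * C₁ * C * ((1 + t) / 2) ^ (-q) * ((1 + t) ^ (K / d) * (1 + t) ^ (-(K / d))) * q⁻¹ := by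
          gcongr
      _ = _ := by rw [h9]; ring

/-- The evolution of the projected initial function is `o(t^{-K/d})`. -/
theorem KernelCondition.tendsto_supNorm_evol_proj (hG : KernelCondition G γ d L)
    (hd : 0 < d) (hL : 0 < L) (hK : 0 ≤ K) (hKL : K < L) (hKγ : ⌊K⌋₊ + 1 ≤ γ)
    {f : E N → ℝ} (hf : AEStronglyMeasurable f volume) (hfin : essNorm K (scl d (1 + 0)) f < ∞) :
    Tendsto (fun t : ℝ => ENNReal.ofReal ((1 + t) ^ (K / d)) *
      supNorm K (scl d (1 + t)) (evol G t (proj G K 0 f))) atTop (nhds 0) := by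
  obtain ⟨C₂, h₂, H₂⟩ := hG.exists_supNorm_evol_proj_le_rhoSum hd hL hK hKL hKγ
  obtain ⟨C₃, h₃, H₃⟩ := hG.exists_essNorm_proj_le hK hKL hKγ
  set c : ℝ := 2 ^ (1 / d) with hcdef
  have hc0 : (0 : ℝ) < c := by positivity
  have hlim1 : Tendsto (fun a : ℝ => ENNReal.ofReal ((a ^ K)⁻¹) * rhoSum K a (proj G K 0 f))
      (nhdsWithin 0 (Set.Ioi 0)) (nhds 0) := by
    refine tendsto_lintegral_rho (hG.aestronglyMeasurable_proj hK hKγ le_rfl hf)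
      (r := fun y : E N => ‖y‖) (by fun_prop) (fun _ => norm_nonneg _) ?_
    refine (lintegral_norm_rpow_le (d := d) le_rfl _).trans_lt ?_
    refine ENNReal.mul_lt_top ENNReal.ofReal_lt_top ?_
    exact ((wsum_le_essNorm _ _ _).trans (H₃ 0 f le_rfl hf)).trans_lt
      (ENNReal.mul_lt_top ENNReal.ofReal_lt_top hfin)
  have hlim2 : Tendsto (fun t : ℝ => ENNReal.ofReal (C₂ * c ^ K) *
      (ENNReal.ofReal (((c * scl d (1 + t)) ^ K)⁻¹) *
        rhoSum K (c * scl d (1 + t)) (proj G K 0 f))) atTop (nhds 0) := by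
    have := ENNReal.Tendsto.const_mul (a := ENNReal.ofReal (C₂ * c ^ K))
      (hlim1.comp (tendsto_scale d c hd hc0)) (Or.inr ENNReal.ofReal_ne_top)
    rwa [mul_zero] at this
  refine tendsto_of_tendsto_of_tendsto_of_le_of_le' tendsto_const_nhds hlim2
    (Eventually.of_forall fun _ => zero_le) ?_
  filter_upwards [eventually_ge_atTop 1] with t ht
  have h1t : 0 < 1 + t := by linarith
  have hat := scl_pos (d := d) h1t
  have hrt : ((c * scl d (1 + t)) ^ K)⁻¹ = (c ^ K)⁻¹ * (1 + t) ^ (K / d) := by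
    rw [Real.mul_rpow hc0.le hat.le, scl_rpow h1t, mul_inv, Real.rpow_neg h1t.le, inv_inv]
  have h4 := H₂ 0 t f le_rfl (by linarith) hf hfin
  rw [sub_zero] at h4
  refine (mul_le_mul_right h4 _).trans (le_of_eq ?_)
  rw [hrt, ← mul_assoc, ← mul_assoc, ← ENNReal.ofReal_mul (by positivity),
    ← ENNReal.ofReal_mul (by positivity)]
  congr 2
  field_simp

theorem KernelCondition.exists_supNorm_evol_proj_zero_le (hG : KernelCondition G γ d L)
    (hd : 0 < d) (hL : 0 < L) (hK : 0 ≤ K) (hKL : K < L) (hKγ : ⌊K⌋₊ + 1 ≤ γ)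
    {f : E N → ℝ} (hf : AEStronglyMeasurable f volume) (hfin : essNorm K (scl d (1 + 0)) f < ∞) :
    ∃ C : ℝ, 0 ≤ C ∧ ∀ t : ℝ, 0 < t →
      supNorm K (scl d (1 + t)) (evol G t (proj G K 0 f)) ≤
        ENNReal.ofReal (C * (1 + t) ^ (-(K / d))) := by
  obtain ⟨C₁, h₁, H₁⟩ := hG.exists_supNorm_evol_proj_le hd hL hK hKL hKγ
  refine ⟨C₁ * (essNorm K (scl d (1 + 0)) f).toReal, by positivity, fun t ht => ?_⟩
  have h1t : 0 < 1 + t := by linarith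
  have h2 := H₁ 0 t f le_rfl ht hf hfin
  rw [sub_zero] at h2
  refine h2.trans (le_of_eq ?_)
  rw [← ENNReal.ofReal_toReal hfin.ne, ← ENNReal.ofReal_mul (by positivity),
    ENNReal.toReal_ofReal ENNReal.toReal_nonneg, add_zero, Real.div_rpow zero_le_one h1t.le,
    Real.one_rpow, Real.rpow_neg h1t.le]
  congr 1
  ring

end Kernel

end GenHeat
end
noncomputable section
namespace GenHeat
variable {N : ℕ}

/-! ### Decomposition of the Duhamel integral -/

theorem supNorm_add_le (K a : ℝ) {f g : E N → ℝ} (hf : AEStronglyMeasurable f volume) :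
    supNorm K a (fun x => f x + g x) ≤ supNorm K a f + supNorm K a g := by
  unfold supNorm
  refine (add_le_add (mul_le_mul_right (iSup_le fun x => (enorm_add_le _ _).trans
    (add_le_add (le_iSup (fun x => ‖f x‖ₑ) x) (le_iSup (fun x => ‖g x‖ₑ) x))) _)
    (wsum_add_le K a hf)).trans (le_of_eq ?_)
  rw [mul_add]
  ring

section Kernel
variable {G : E N → ℝ → ℝ} {γ : ℕ} {d L K C b : ℝ} {h k : ℝ → E N → ℝ}

theorem KernelCondition.exists_evol_init_strong (hG : KernelCondition G γ d L) {f : E N → ℝ}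
    (hf : AEStronglyMeasurable f volume) :
    ∃ V : E N × ℝ → ℝ, StronglyMeasurable V ∧ ∀ x, ∀ t : ℝ, 0 < t → evol G t f x = V (x, t) := by
  have hm : StronglyMeasurable fun z : (E N × ℝ) × E N =>
      (scl d z.1.2 ^ N * profile G (scl d z.1.2 • (z.1.1 - z.2))) * hf.mk f z.2 := by
    refine StronglyMeasurable.mul ?_ (hf.stronglyMeasurable_mk.comp_measurable measurable_snd)
    have h1 : Measurable fun z : (E N × ℝ) × E N => (z.1.1 - z.2, z.1.2) := by fun_prop
    exact (hG.measurable_kernel_formula.comp h1).stronglyMeasurable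
  refine ⟨fun z => ∫ y, (scl d z.2 ^ N * profile G (scl d z.2 • (z.1 - y))) * hf.mk f y,
    hm.integral_prod_right', fun x t ht => ?_⟩
  refine integral_congr_ae ?_
  filter_upwards [hf.ae_eq_mk] with y hy
  rw [hG.eq_profile ht, hy]

theorem aestronglyMeasurable_slice {V : E N × ℝ → ℝ} (hV : StronglyMeasurable V) {w : E N → ℝ}
    {t : ℝ} (hw : ∀ x, w x = V (x, t)) : AEStronglyMeasurable w volume := by
  rw [show w = fun x => V (x, t) from funext hw]
  exact (hV.comp_measurable measurable_prodMk_right).aestronglyMeasurable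

theorem scl_one_add_le_one (hd : 0 < d) {s : ℝ} (hs : 0 ≤ s) : scl d (1 + s) ≤ 1 :=
  Real.rpow_le_one_of_one_le_of_nonpos (by linarith) (by have : 0 < 1 / d := by positivity
                                                         linarith)

theorem eLpNorm_top_le_essNorm {a : ℝ} (ha : 0 < a) (ha1 : a ≤ 1) (f : E N → ℝ) :
    eLpNorm f ∞ volume ≤ essNorm K a f := by
  refine le_trans ?_ le_self_add
  refine le_mul_of_one_le_left zero_le ?_
  rw [ENNReal.one_le_ofReal]
  exact (one_le_inv₀ (by positivity)).2 (pow_le_one₀ ha.le ha1)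

theorem SourceBound.eLpNorm_top (hb : SourceBound d K C b h) (hd : 0 < d) (hC : 0 ≤ C)
    (hb1 : -1 ≤ b) :
    ∀ᵐ s ∂volume.restrict (Set.Ioi 0), eLpNorm (h s) ∞ volume ≤ ENNReal.ofReal C := by
  filter_upwards [hb, ae_restrict_mem measurableSet_Ioi] with s hs hs0
  rw [Set.mem_Ioi] at hs0
  refine (eLpNorm_top_le_essNorm (scl_pos (by linarith)) (scl_one_add_le_one hd hs0.le) _).trans
    (hs.trans (ENNReal.ofReal_le_ofReal (mul_le_of_le_one_right hC ?_)))
  exact Real.rpow_le_one_of_one_le_of_nonpos (by linarith) (by linarith)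

theorem SourceBound.integrable (hb : SourceBound d K C b h) (hh : JointMeas h) :
    ∀ᵐ s ∂volume.restrict (Set.Ioi 0), ∀ α : Fin N → ℕ, (len α : ℝ) ≤ K →
      Integrable fun x => monom α x * h s x := by
  filter_upwards [hb, hh.slice, ae_restrict_mem measurableSet_Ioi] with s hs hm hs0 α hα
  rw [Set.mem_Ioi] at hs0
  exact integrable_monom_of_wsum (scl_pos (by linarith)) hα hm
    (((wsum_le_essNorm _ _ _).trans hs).trans_lt ENNReal.ofReal_lt_top)

theorem ae_Ioc_of_Ioi {P : ℝ → Prop} (hP : ∀ᵐ s ∂volume.restrict (Set.Ioi 0), P s) (t : ℝ) :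
    ∀ᵐ s ∂volume.restrict (Set.Ioc 0 t), P s :=
  ae_mono (Measure.restrict_mono Set.Ioc_subset_Ioi_self le_rfl) hP

/-- The factor a^{-|α|} in the moment bound is (1+s)^{|α|/d}; it multiplies the decay of the source.
-/
theorem KernelCondition.exists_abs_moment_le (hG : KernelCondition G γ d L) (hC : 0 ≤ C)
    (hb : SourceBound d K C b h) {α : Fin N → ℕ} (hα : (len α : ℝ) ≤ K) :
    ∃ C' : ℝ, 0 ≤ C' ∧ ∀ᵐ s ∂volume.restrict (Set.Ioi 0),
      |moment G (h s) s α| ≤ C' * (1 + s) ^ ((len α : ℝ) / d - b - 1) := by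
  obtain ⟨M, hM, H⟩ := hG.exists_enorm_moment_le K α hα
  refine ⟨M * C, by positivity, ?_⟩
  filter_upwards [hb, ae_restrict_mem measurableSet_Ioi] with s hs hs0
  rw [Set.mem_Ioi] at hs0
  have h1 : 0 < 1 + s := by linarith
  have hp := scl_pos (d := d) h1
  have h2 := ((H s (h s) hs0.le).trans (mul_le_mul_right ((wsum_le_essNorm _ _ _).trans hs) _))
  rw [← ENNReal.ofReal_mul (by positivity), Real.enorm_eq_ofReal_abs,
    ENNReal.ofReal_le_ofReal_iff (by positivity)] at h2
  refine h2.trans (le_of_eq ?_)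
  rw [scl_pow h1, Real.rpow_neg h1.le, inv_inv,
    show (len α : ℝ) / d - b - 1 = len α / d + (-1 - b) by ring, Real.rpow_add h1]
  ring

theorem KernelCondition.intervalIntegrable_moment (hG : KernelCondition G γ d L)
    (hh : JointMeas h) (hC : 0 ≤ C) (hb : SourceBound d K C b h) {α : Fin N → ℕ}
    (hα : (len α : ℝ) ≤ K) {t : ℝ} (ht : 0 ≤ t) :
    IntervalIntegrable (fun s => moment G (h s) s α) volume 0 t := by
  obtain ⟨C', -, H⟩ := hG.exists_abs_moment_le hC hb hα
  rw [intervalIntegrable_iff_integrableOn_Ioc_of_le ht]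
  refine Integrable.mono' (g := fun s => C' * (1 + s) ^ ((len α : ℝ) / d - b - 1)) ?_
    ((hG.aestronglyMeasurable_moment hh α).mono_measure
      (Measure.restrict_mono Set.Ioc_subset_Ioi_self le_rfl)) (ae_Ioc_of_Ioi H t)
  exact (((continuousOn_one_add_rpow _ t).integrableOn_compact isCompact_Icc).mono_set
    Set.Ioc_subset_Icc_self).const_mul _

theorem SourceBound.proj (hb : SourceBound d K C b h) (hG : KernelCondition G γ d L)
    (hK : 0 ≤ K) (hKL : K < L) (hKγ : ⌊K⌋₊ + 1 ≤ γ) (hh : JointMeas h) (hC : 0 ≤ C) :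
    ∃ C' : ℝ, 0 ≤ C' ∧ SourceBound d K C' b fun s => proj G K s (h s) := by
  obtain ⟨M, hM, H⟩ := hG.exists_essNorm_proj_le hK hKL hKγ
  refine ⟨M * C, by positivity, ?_⟩
  filter_upwards [hb, hh.slice, ae_restrict_mem measurableSet_Ioi] with s hs hm hs0
  refine ((H s _ (le_of_lt hs0) hm).trans (mul_le_mul_right hs _)).trans (le_of_eq ?_)
  rw [← ENNReal.ofReal_mul hM, mul_assoc]

theorem SourceBound.sub (hh : JointMeas h) (hk : JointMeas k) {C₁ C₂ : ℝ} (h₁ : 0 ≤ C₁)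
    (h₂ : 0 ≤ C₂) (hb : SourceBound d K C₁ b h) (kb : SourceBound d K C₂ b k) :
    SourceBound d K (C₁ + C₂) b fun s y => h s y - k s y := by
  filter_upwards [hb, kb, hh.slice, hk.slice, ae_restrict_mem measurableSet_Ioi]
    with s h3 h4 h5 h6 hs0
  rw [Set.mem_Ioi] at hs0
  refine ((essNorm_sub_le _ _ h5 h6).trans (add_le_add h3 h4)).trans (le_of_eq ?_)
  have : 0 < 1 + s := by linarith
  rw [← ENNReal.ofReal_add (by positivity) (by positivity), add_mul]

theorem KernelCondition.intervalIntegrable_evol_proj (hG : KernelCondition G γ d L) (hd : 0 < d)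
    (hL : 0 < L) (hK : 0 ≤ K) (hKL : K < L) (hKγ : ⌊K⌋₊ + 1 ≤ γ) (hh : JointMeas h) (hC : 0 ≤ C)
    (hb1 : -1 ≤ b) (hb : SourceBound d K C b h) {t : ℝ} (ht : 0 < t) (x : E N) :
    IntervalIntegrable (fun s => evol G (t - s) (GenHeat.proj G K s (h s)) x) volume 0 t := by
  obtain ⟨C', hC', hb'⟩ := hb.proj hG hK hKL hKγ hh hC
  exact hG.intervalIntegrable_evol hL (hG.jointMeas_proj hK hKγ hh) ht
    (ae_Ioc_of_Ioi (hb'.eLpNorm_top hd hC' hb1) t) x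

/-- Since g_α(·,s) is carried to g_α(·,t) whatever s is, the correction terms leave the time
integral, and only their coefficients are integrated. -/
theorem KernelCondition.integral_evol_eq (hG : KernelCondition G γ d L) (hd : 0 < d)
    (hL : 0 < L) (hK : 0 ≤ K) (hKL : K < L) (hKγ : ⌊K⌋₊ + 1 ≤ γ) (hh : JointMeas h) (hC : 0 ≤ C)
    (hb1 : -1 ≤ b) (hb : SourceBound d K C b h) {t : ℝ} (ht : 0 < t) (x : E N) :
    ∫ s in (0 : ℝ)..t, evol G (t - s) (h s) x = duhamel G K h t x +
      ∑ α ∈ multiIdx N K, (∫ s in (0 : ℝ)..t, moment G (h s) s α) * gker G α x t := by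
  have hI : ∀ α ∈ multiIdx N K,
      IntervalIntegrable (fun s => moment G (h s) s α * gker G α x t) volume 0 t := fun α hα =>
    (hG.intervalIntegrable_moment hh hC hb ((mem_multiIdx hK α).1 hα) ht.le).mul_const _
  have hS : IntervalIntegrable (fun s => ∑ α ∈ multiIdx N K, moment G (h s) s α * gker G α x t)
      volume 0 t := by
    simpa only [Finset.sum_fn] using IntervalIntegrable.sum _ hI
  simp_rw [← intervalIntegral.integral_mul_const]
  rw [duhamel, ← intervalIntegral.integral_finsetSum hI, ← intervalIntegral.integral_add
    (hG.intervalIntegrable_evol_proj hd hL hK hKL hKγ hh hC hb1 hb ht x)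
    hS]
  rw [intervalIntegral.integral_of_le ht.le, intervalIntegral.integral_of_le ht.le]
  refine integral_congr_ae ?_
  filter_upwards [ae_Ioc_of_Ioi (hb.integrable hh) t, ae_lt_of_Ioc t] with s hs hst
  refine hG.evol_eq hL hK hKγ hst.1.le hst.2 ?_ x
  simpa [monom] using hs 0 (by simpa [len] using hK)

/-- Linearity of the projection uses integrability of the relevant moments, which the source bounds
provide for almost every s. -/
theorem KernelCondition.duhamel_sub (hG : KernelCondition G γ d L) (hd : 0 < d)
    (hL : 0 < L) (hK : 0 ≤ K) (hKL : K < L) (hKγ : ⌊K⌋₊ + 1 ≤ γ) (hh : JointMeas h)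
    (hk : JointMeas k) {C₁ C₂ : ℝ} (h₁ : 0 ≤ C₁) (h₂ : 0 ≤ C₂) (hb1 : -1 ≤ b)
    (hb : SourceBound d K C₁ b h) (kb : SourceBound d K C₂ b k) {t : ℝ} (ht : 0 < t) (x : E N) :
    duhamel G K (fun s y => h s y - k s y) t x = duhamel G K h t x - duhamel G K k t x := by
  obtain ⟨C₃, h₃, b₃⟩ := hb.proj hG hK hKL hKγ hh h₁
  obtain ⟨C₄, h₄, b₄⟩ := kb.proj hG hK hKL hKγ hk h₂
  rw [duhamel, duhamel, duhamel, ← intervalIntegral.integral_sub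
    (hG.intervalIntegrable_evol_proj hd hL hK hKL hKγ hh h₁ hb1 hb ht x)
    (hG.intervalIntegrable_evol_proj hd hL hK hKL hKγ hk h₂ hb1 kb ht x),
    intervalIntegral.integral_of_le ht.le, intervalIntegral.integral_of_le ht.le]
  refine integral_congr_ae ?_
  filter_upwards [ae_Ioc_of_Ioi (hb.integrable hh) t, ae_Ioc_of_Ioi (kb.integrable hk) t,
    ae_Ioc_of_Ioi (b₃.integrable (hG.jointMeas_proj hK hKγ hh)) t,
    ae_Ioc_of_Ioi (b₄.integrable (hG.jointMeas_proj hK hKγ hk)) t, ae_lt_of_Ioc t]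
    with s i₁ i₂ i₃ i₄ hst
  have h0 : (len (0 : Fin N → ℕ) : ℝ) ≤ K := by simpa [len] using hK
  have i₃' : Integrable (GenHeat.proj G K s (h s)) := by simpa [monom] using i₃ 0 h0
  have i₄' : Integrable (GenHeat.proj G K s (k s)) := by simpa [monom] using i₄ 0 h0
  have hp : GenHeat.proj G K s (fun y => h s y - k s y) =
      fun y => GenHeat.proj G K s (h s) y - GenHeat.proj G K s (k s) y := by
    funext y
    unfold GenHeat.proj
    rw [sub_sub_sub_comm, ← Finset.sum_sub_distrib]
    congr 1
    refine Finset.sum_congr rfl fun α hα => ?_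
    have hle : ∀ β ≤ α, (len β : ℝ) ≤ K := fun β hβ =>
      (Nat.cast_le.2 (len_mono hβ)).trans ((mem_multiIdx hK α).1 hα)
    rw [moment_sub G s α (fun β hβ => i₁ β (hle β hβ)) (fun β hβ => i₂ β (hle β hβ)), sub_mul]
  have hts : 0 < t - s := sub_pos.2 hst.2
  rw [hp]
  unfold evol
  rw [← integral_sub (integrable_kernel_mul hG hL hts i₃' x)
    (integrable_kernel_mul hG hL hts i₄' x)]
  simp_rw [mul_sub]

end Kernel

end GenHeat
end
noncomputable section
namespace GenHeat
variable {N : ℕ}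

/-! ### The nonlinear term -/

theorem ae_abs_le_of_essNorm {K a D : ℝ} (ha : 0 < a) (hD : 0 ≤ D) {f : E N → ℝ}
    (h : essNorm K a f ≤ ENNReal.ofReal D) : ∀ᵐ x, |f x| ≤ D * a ^ N := by
  filter_upwards [enorm_ae_le_eLpNorm_top f] with x hx
  have h1 : ENNReal.ofReal ((a ^ N)⁻¹) * ‖f x‖ₑ ≤ ENNReal.ofReal D :=
    ((mul_le_mul_right hx _).trans le_self_add).trans h
  rw [Real.enorm_eq_ofReal_abs, ← ENNReal.ofReal_mul (by positivity),
    ENNReal.ofReal_le_ofReal_iff hD, inv_mul_le_iff₀ (by positivity)] at h1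
  linarith

section Nonlin
variable {F : E N → ℝ → ℝ → ℝ} {Cstar A p Ap d K : ℝ}

/-- The scaled norm bounds both arguments by D(1+s)^{-N/d} almost everywhere. The Lipschitz factor
is then of order (1+s)^{A-N(p-1)/d} = (1+s)^{-1-A_p}, and it multiplies the norm of the difference.
-/
theorem essNorm_nonlin_sub_le (hC : 0 < Cstar) (hp : 1 ≤ p)
    (hF : ∀ (x : E N) (t : ℝ), 0 < t → ∀ u₁ u₂ : ℝ,
      |F x t u₁ - F x t u₂| ≤
        Cstar * (1 + t) ^ A * max (|u₁| ^ (p - 1)) (|u₂| ^ (p - 1)) * |u₁ - u₂|)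
    (hAp : Ap = -A + N * (p - 1) / d - 1) {w₁ w₂ : E N → ℝ → ℝ} {s D δ : ℝ} (hs : 0 < s)
    (hD : 0 ≤ D)
    (h₁ : essNorm K (scl d (1 + s)) (fun y => w₁ y s) ≤ ENNReal.ofReal D)
    (h₂ : essNorm K (scl d (1 + s)) (fun y => w₂ y s) ≤ ENNReal.ofReal D)
    (h : essNorm K (scl d (1 + s)) (fun y => w₁ y s - w₂ y s) ≤ ENNReal.ofReal δ) :
    essNorm K (scl d (1 + s)) (fun y => nonlin F w₁ s y - nonlin F w₂ s y) ≤
      ENNReal.ofReal (Cstar * D ^ (p - 1) * δ * (1 + s) ^ (-1 - Ap)) := by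
  have h1s : 0 < 1 + s := by linarith
  have ha := scl_pos (d := d) h1s
  have hp0 : 0 ≤ p - 1 := by linarith
  set c := Cstar * (1 + s) ^ A * (D * scl d (1 + s) ^ N) ^ (p - 1) with hc
  have hc0 : 0 ≤ c := by positivity
  have h3 : essNorm K (scl d (1 + s)) (fun y => nonlin F w₁ s y - nonlin F w₂ s y) ≤
      essNorm K (scl d (1 + s)) (fun y => c * (w₁ y s - w₂ y s)) := by
    refine essNorm_mono_ae _ _ ?_
    filter_upwards [ae_abs_le_of_essNorm ha hD h₁, ae_abs_le_of_essNorm ha hD h₂] with y k₁ k₂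
    refine (hF y s hs _ _).trans ?_
    rw [abs_mul, abs_of_nonneg hc0, hc]
    gcongr
    exact max_le (Real.rpow_le_rpow (abs_nonneg _) k₁ hp0)
      (Real.rpow_le_rpow (abs_nonneg _) k₂ hp0)
  refine h3.trans ?_
  rw [essNorm_const_mul]
  refine (mul_le_mul_right h _).trans (le_of_eq ?_)
  rw [Real.enorm_eq_ofReal hc0, ← ENNReal.ofReal_mul hc0, hc,
    Real.mul_rpow hD (by positivity), scl_pow h1s, ← Real.rpow_mul h1s.le,
    show -1 - Ap = A + -((N : ℝ) / d) * (p - 1) by rw [hAp]; ring, Real.rpow_add h1s]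
  congr 1
  ring

theorem essNorm_nonlin_le (hC : 0 < Cstar) (hp : 1 ≤ p)
    (hF0 : ∀ (x : E N) (t : ℝ), 0 < t → F x t 0 = 0)
    (hF : ∀ (x : E N) (t : ℝ), 0 < t → ∀ u₁ u₂ : ℝ,
      |F x t u₁ - F x t u₂| ≤
        Cstar * (1 + t) ^ A * max (|u₁| ^ (p - 1)) (|u₂| ^ (p - 1)) * |u₁ - u₂|)
    (hAp : Ap = -A + N * (p - 1) / d - 1) {w : E N → ℝ → ℝ} {s D : ℝ} (hs : 0 < s) (hD : 0 ≤ D)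
    (h : essNorm K (scl d (1 + s)) (fun y => w y s) ≤ ENNReal.ofReal D) :
    essNorm K (scl d (1 + s)) (nonlin F w s) ≤
      ENNReal.ofReal (Cstar * D ^ (p - 1) * D * (1 + s) ^ (-1 - Ap)) := by
  have := essNorm_nonlin_sub_le (w₁ := w) (w₂ := fun _ _ => 0) hC hp hF hAp hs hD h
    (by rw [essNorm_zero]; exact zero_le) (by simpa using h)
  simp only [nonlin, hF0 _ s hs, sub_zero] at this
  exact this

end Nonlin

/-! ### Decay rates -/

/-- The decay `O((1+t)^{-a})` of a time-dependent function. -/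
def RateBound (d K a : ℝ) (v : ℝ → E N → ℝ) : Prop :=
  ∃ C : ℝ, 0 ≤ C ∧ ∀ t : ℝ, 0 < t →
    essNorm K (scl d (1 + t)) (v t) ≤ ENNReal.ofReal (C * (1 + t) ^ (-a))

theorem one_le_one_add_rpow {t c : ℝ} (ht : 0 ≤ t) (hc : 0 ≤ c) : 1 ≤ (1 + t) ^ c :=
  Real.one_le_rpow (by linarith) hc

section Rates
variable {G : E N → ℝ → ℝ} {γ : ℕ} {d L K C b : ℝ} {h : ℝ → E N → ℝ} {φ : E N → ℝ}
  {v : ℝ → E N → ℝ}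

theorem KernelCondition.aestronglyMeasurable_evol (hG : KernelCondition G γ d L) {f : E N → ℝ}
    (hf : AEStronglyMeasurable f volume) {t : ℝ} (ht : 0 < t) :
    AEStronglyMeasurable (evol G t f) volume := by
  obtain ⟨V, hV, h⟩ := hG.exists_evol_init_strong hf
  exact aestronglyMeasurable_slice hV fun x => h x t ht

theorem KernelCondition.exists_essNorm_remainder_le (hG : KernelCondition G γ d L) (hd : 0 < d)
    (hL : 0 < L) (hK : 0 ≤ K) (hKL : K < L) (hKγ : ⌊K⌋₊ + 1 ≤ γ)
    (hφ : AEStronglyMeasurable φ volume) (hfin : essNorm K (scl d (1 + 0)) φ < ∞)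
    (hh : JointMeas h) (hC : 0 ≤ C) (hb : SourceBound d K C b h)
    (hv : ∀ t : ℝ, 0 < t → ∀ x, v t x = evol G t (proj G K 0 φ) x + duhamel G K h t x) :
    ∃ M : ℝ, 0 ≤ M ∧ ∀ t : ℝ, 0 < t → essNorm K (scl d (1 + t)) (v t) ≤
      ENNReal.ofReal (M * (1 + t) ^ (-(K / d)) *
        (1 + ∫ s in (0 : ℝ)..t, (1 + s) ^ ((K / d - b) - 1))) := by
  obtain ⟨C₁, h₁, H₁⟩ := hG.exists_supNorm_evol_proj_zero_le hd hL hK hKL hKγ hφ hfin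
  obtain ⟨C₂, h₂, H₂⟩ := hG.exists_supNorm_duhamel_le hd hL hK hKL hKγ
  refine ⟨C₁ + C₂ * C, by positivity, fun t ht => ?_⟩
  have h1t : 0 < 1 + t := by linarith
  have hI := integral_one_add_rpow_nonneg ht.le ((K / d - b) - 1)
  set I := ∫ s in (0 : ℝ)..t, (1 + s) ^ ((K / d - b) - 1)
  rw [show v t = _ from funext (hv t ht)]
  refine (essNorm_le_supNorm _ _ _).trans ((supNorm_add_le _ _ (hG.aestronglyMeasurable_evol
    (hG.aestronglyMeasurable_proj hK hKγ le_rfl hφ) ht)).trans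
    ((add_le_add (H₁ t ht) (H₂ h C b hh hC hb t ht)).trans ?_))
  rw [← ENNReal.ofReal_add (by positivity) (by positivity)]
  refine ENNReal.ofReal_le_ofReal ?_
  have hx : 0 ≤ (1 + t) ^ (-(K / d)) := by positivity
  nlinarith [mul_nonneg (mul_nonneg h₁ hx) hI, mul_nonneg (mul_nonneg h₂ hC) hx]

/-- The time integral grows like (1+t)^{K/d-b}, which replaces the factor (1+t)^{-K/d} by (1+t)^{-b}
and dominates the contribution of the initial function. -/
theorem KernelCondition.rateBound_of_lt (hG : KernelCondition G γ d L) (hd : 0 < d)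
    (hL : 0 < L) (hK : 0 ≤ K) (hKL : K < L) (hKγ : ⌊K⌋₊ + 1 ≤ γ)
    (hφ : AEStronglyMeasurable φ volume) (hfin : essNorm K (scl d (1 + 0)) φ < ∞)
    (hh : JointMeas h) (hC : 0 ≤ C) (hb : SourceBound d K C b h)
    (hv : ∀ t : ℝ, 0 < t → ∀ x, v t x = evol G t (proj G K 0 φ) x + duhamel G K h t x)
    (hbK : b < K / d) : RateBound d K b v := by
  obtain ⟨M, hM, H⟩ := hG.exists_essNorm_remainder_le hd hL hK hKL hKγ hφ hfin hh hC hb hv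
  have hc : 0 < K / d - b := sub_pos.2 hbK
  refine ⟨M * (1 + (K / d - b)⁻¹), by positivity, fun t ht => (H t ht).trans
    (ENNReal.ofReal_le_ofReal ?_)⟩
  have h1t : 0 < 1 + t := by linarith
  have h2 := integral_one_add_rpow_le (t := t) hc
  have h3 := one_le_one_add_rpow ht.le hc.le
  calc _ ≤ M * (1 + t) ^ (-(K / d)) *
        ((1 + t) ^ (K / d - b) + (1 + t) ^ (K / d - b) / (K / d - b)) := by gcongr
    _ = M * (1 + (K / d - b)⁻¹) * ((1 + t) ^ (-(K / d)) * (1 + t) ^ (K / d - b)) := by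
        field_simp
    _ = _ := by
        rw [← Real.rpow_add h1t]
        congr 2
        ring

theorem KernelCondition.exists_essNorm_le_log (hG : KernelCondition G γ d L) (hd : 0 < d)
    (hL : 0 < L) (hK : 0 ≤ K) (hKL : K < L) (hKγ : ⌊K⌋₊ + 1 ≤ γ)
    (hφ : AEStronglyMeasurable φ volume) (hfin : essNorm K (scl d (1 + 0)) φ < ∞)
    (hh : JointMeas h) (hC : 0 ≤ C) (hb : SourceBound d K C b h)
    (hv : ∀ t : ℝ, 0 < t → ∀ x, v t x = evol G t (proj G K 0 φ) x + duhamel G K h t x)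
    (hbK : b = K / d) :
    ∃ M : ℝ, 0 ≤ M ∧ ∀ t : ℝ, 0 < t → essNorm K (scl d (1 + t)) (v t) ≤
      ENNReal.ofReal (M * (1 + t) ^ (-(K / d)) * (1 + Real.log (1 + t))) := by
  obtain ⟨M, hM, H⟩ := hG.exists_essNorm_remainder_le hd hL hK hKL hKγ hφ hfin hh hC hb hv
  refine ⟨M, hM, fun t ht => ?_⟩
  have h1 := H t ht
  rwa [sub_eq_zero.2 hbK.symm, integral_one_add_rpow_eq_log ht.le] at h1

/-- The logarithm is absorbed into an arbitrarily small loss of exponent, so that the iteration can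
continue with pure powers. -/
theorem KernelCondition.rateBound_of_eq (hG : KernelCondition G γ d L) (hd : 0 < d)
    (hL : 0 < L) (hK : 0 ≤ K) (hKL : K < L) (hKγ : ⌊K⌋₊ + 1 ≤ γ)
    (hφ : AEStronglyMeasurable φ volume) (hfin : essNorm K (scl d (1 + 0)) φ < ∞)
    (hh : JointMeas h) (hC : 0 ≤ C) (hb : SourceBound d K C b h)
    (hv : ∀ t : ℝ, 0 < t → ∀ x, v t x = evol G t (proj G K 0 φ) x + duhamel G K h t x)
    (hbK : b = K / d) {ε : ℝ} (hε : 0 < ε) : RateBound d K (K / d - ε) v := by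
  obtain ⟨M, hM, H⟩ := hG.exists_essNorm_le_log hd hL hK hKL hKγ hφ hfin hh hC hb hv hbK
  refine ⟨M * (1 + ε⁻¹), by positivity, fun t ht => (H t ht).trans
    (ENNReal.ofReal_le_ofReal ?_)⟩
  have h1t : 0 < 1 + t := by linarith
  have h2 := Real.log_le_rpow_div h1t.le hε
  have h3 := one_le_one_add_rpow ht.le hε.le
  calc _ ≤ M * (1 + t) ^ (-(K / d)) * ((1 + t) ^ ε + (1 + t) ^ ε / ε) := by gcongr
    _ = M * (1 + ε⁻¹) * ((1 + t) ^ (-(K / d)) * (1 + t) ^ ε) := by field_simp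
    _ = _ := by
        rw [← Real.rpow_add h1t]
        congr 2
        ring

theorem KernelCondition.rateBound_of_gt (hG : KernelCondition G γ d L) (hd : 0 < d)
    (hL : 0 < L) (hK : 0 ≤ K) (hKL : K < L) (hKγ : ⌊K⌋₊ + 1 ≤ γ)
    (hφ : AEStronglyMeasurable φ volume) (hfin : essNorm K (scl d (1 + 0)) φ < ∞)
    (hh : JointMeas h) (hC : 0 ≤ C) (hb : SourceBound d K C b h)
    (hv : ∀ t : ℝ, 0 < t → ∀ x, v t x = evol G t (proj G K 0 φ) x + duhamel G K h t x)
    (hbK : K / d < b) : RateBound d K (K / d) v := by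
  obtain ⟨M, hM, H⟩ := hG.exists_essNorm_remainder_le hd hL hK hKL hKγ hφ hfin hh hC hb hv
  have hc : K / d - b < 0 := sub_neg.2 hbK
  have hc' : 0 < -(K / d - b) := neg_pos.2 hc
  refine ⟨M * (1 + (-(K / d - b))⁻¹), by positivity, fun t ht => (H t ht).trans
    (ENNReal.ofReal_le_ofReal ?_)⟩
  have h1t : 0 < 1 + t := by linarith
  calc _ ≤ M * (1 + t) ^ (-(K / d)) * (1 + (-(K / d - b))⁻¹) := by
        gcongr
        exact integral_one_add_rpow_le_of_neg ht.le hc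
    _ = _ := by ring

theorem KernelCondition.tendsto_essNorm_remainder (hG : KernelCondition G γ d L) (hd : 0 < d)
    (hL : 0 < L) (hK : 0 ≤ K) (hKL : K < L) (hKγ : ⌊K⌋₊ + 1 ≤ γ)
    (hφ : AEStronglyMeasurable φ volume) (hfin : essNorm K (scl d (1 + 0)) φ < ∞)
    (hh : JointMeas h) (hC : 0 ≤ C) (hb : SourceBound d K C b h)
    (hv : ∀ t : ℝ, 0 < t → ∀ x, v t x = evol G t (proj G K 0 φ) x + duhamel G K h t x)
    (hbK : K / d < b) :
    Tendsto (fun t : ℝ => ENNReal.ofReal ((1 + t) ^ (K / d)) * essNorm K (scl d (1 + t)) (v t))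
      atTop (nhds 0) := by
  have h1 := (hG.tendsto_supNorm_evol_proj hd hL hK hKL hKγ hφ hfin).add
    (hG.tendsto_supNorm_duhamel hd hL hK hKL hKγ hh hC hb hbK)
  rw [add_zero] at h1
  refine tendsto_of_tendsto_of_tendsto_of_le_of_le' tendsto_const_nhds h1
    (Eventually.of_forall fun _ => zero_le) ?_
  filter_upwards [eventually_gt_atTop 0] with t ht
  rw [show v t = _ from funext (hv t ht), ← mul_add]
  gcongr
  exact (essNorm_le_supNorm _ _ _).trans (supNorm_add_le _ _ (hG.aestronglyMeasurable_evol
    (hG.aestronglyMeasurable_proj hK hKγ le_rfl hφ) ht))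

end Rates

/-! ### Comparison with the unscaled norms -/

theorem wsum_le_eLpNorm_add {K a : ℝ} (ha : 0 ≤ a) {f : E N → ℝ}
    (hf : AEStronglyMeasurable f volume) :
    wsum K a f ≤ eLpNorm f 1 volume + ENNReal.ofReal (a ^ K) * wnorm K f := by
  rw [eLpNorm_one_eq_lintegral_enorm, wnorm, ← lintegral_const_mul' _ _ ENNReal.ofReal_ne_top,
    ← lintegral_add_left' hf.enorm]
  refine lintegral_mono fun x => ?_
  have h1 : ENNReal.ofReal (wt K a x) ≤ 1 + ENNReal.ofReal (a ^ K) *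
      ENNReal.ofReal (1 + ‖x‖ ^ K) := by
    rw [← ENNReal.ofReal_mul (by positivity), ← ENNReal.ofReal_one,
      ← ENNReal.ofReal_add zero_le_one (by positivity)]
    refine ENNReal.ofReal_le_ofReal ?_
    rw [wt, Real.mul_rpow ha (norm_nonneg x)]
    have : 0 ≤ a ^ K := by positivity
    nlinarith
  refine (mul_le_mul_right h1 _).trans (le_of_eq ?_)
  ring

/-- Only three of the assumed bounds are needed: q = ∞, q = 1 and ℓ = K. -/
theorem exists_essNorm_le_of_decay {d K : ℝ} (hK : 0 ≤ K) {u : E N → ℝ → ℝ}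
    (hm : ∀ t : ℝ, 0 < t → AEStronglyMeasurable (fun x => u x t) volume)
    (hudecay : ∀ q : ℝ≥0∞, 1 ≤ q → ∀ ℓ : ℝ, 0 ≤ ℓ → ℓ ≤ K →
      (⨆ (t : ℝ) (_ : 0 < t), ENNReal.ofReal ((1 + t) ^ qExp N d q) *
          eLpNorm (fun x => u x t) q volume) +
        (⨆ (t : ℝ) (_ : 0 < t), ENNReal.ofReal ((1 + t) ^ (-(ℓ / d))) *
          wnorm ℓ (fun x => u x t)) < ∞) :
    ∃ D : ℝ, 0 ≤ D ∧ ∀ t : ℝ, 0 < t →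
      essNorm K (scl d (1 + t)) (fun x => u x t) ≤ ENNReal.ofReal D := by
  have h1 := hudecay ∞ le_top K hK le_rfl
  have h2 := hudecay 1 le_rfl K hK le_rfl
  have h3 := ENNReal.add_lt_top.2 ⟨h1, h2⟩
  have h4 := ENNReal.ofReal_toReal h3.ne
  refine ⟨_, ENNReal.toReal_nonneg, fun t ht => (le_of_le_of_eq ?_ h4.symm)⟩
  have h1t : 0 < 1 + t := by linarith
  have ha := scl_pos (d := d) h1t
  rw [essNorm]
  refine (add_le_add_right (wsum_le_eLpNorm_add ha.le (hm t ht)) _).trans ?_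
  rw [add_comm (eLpNorm _ 1 volume), ← add_assoc]
  refine add_le_add (add_le_add ?_ ?_) (le_trans ?_ le_self_add)
  · refine le_trans (le_of_eq ?_) (le_iSup₂ (f := fun (t : ℝ) (_ : 0 < t) =>
      ENNReal.ofReal ((1 + t) ^ qExp N d ∞) * eLpNorm (fun x => u x t) ∞ volume) t ht)
    rw [scl_pow h1t, Real.rpow_neg h1t.le, inv_inv]
    simp [qExp]
  · refine le_trans (le_of_eq ?_) (le_iSup₂ (f := fun (t : ℝ) (_ : 0 < t) =>
      ENNReal.ofReal ((1 + t) ^ (-(K / d))) * wnorm K (fun x => u x t)) t ht)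
    rw [scl_rpow h1t]
  · refine le_trans (le_of_eq ?_) (le_iSup₂ (f := fun (t : ℝ) (_ : 0 < t) =>
      ENNReal.ofReal ((1 + t) ^ qExp N d 1) * eLpNorm (fun x => u x t) 1 volume) t ht)
    simp [qExp]

/-- Interpolation: |f|^q is at most |f| times the (q-1)-st power of the supremum bound B a^N, and
∫|f| is at most B. -/
theorem eLpNorm_le_of_essNorm {K a B : ℝ} (ha : 0 < a) (hB : 0 ≤ B) {f : E N → ℝ}
    (h : essNorm K a f ≤ ENNReal.ofReal B) {q : ℝ≥0∞} (hq : 1 ≤ q) :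
    eLpNorm f q volume ≤ ENNReal.ofReal (B * (a ^ N) ^ (1 - (q⁻¹).toReal)) := by
  have hae := ae_abs_le_of_essNorm ha hB h
  rcases eq_or_ne q ∞ with rfl | hqt
  · simp only [ENNReal.inv_top, ENNReal.toReal_zero, sub_zero, Real.rpow_one]
    rw [eLpNorm_exponent_top]
    refine eLpNormEssSup_le_of_ae_enorm_bound ?_
    filter_upwards [hae] with x hx
    rw [Real.enorm_eq_ofReal_abs]
    exact ENNReal.ofReal_le_ofReal hx
  have hq0 : q ≠ 0 := (zero_lt_one.trans_le hq).ne'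
  have hr : 1 ≤ q.toReal := by
    rw [← ENNReal.toReal_one]
    exact (ENNReal.toReal_le_toReal ENNReal.one_ne_top hqt).2 hq
  rw [eLpNorm_eq_lintegral_rpow_enorm_toReal hq0 hqt, ENNReal.toReal_inv]
  set r := q.toReal
  have hI : ∫⁻ x, ‖f x‖ₑ ≤ ENNReal.ofReal B := by
    refine le_trans (lintegral_mono fun x => ?_) ((wsum_le_essNorm K a f).trans h)
    refine le_mul_of_one_le_right zero_le ?_
    rw [ENNReal.one_le_ofReal, wt]
    have : 0 ≤ (a * ‖x‖) ^ K := by positivity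
    linarith
  have h1 : ∫⁻ x, ‖f x‖ₑ ^ r ≤ ENNReal.ofReal ((B * a ^ N) ^ (r - 1) * B) := by
    rw [ENNReal.ofReal_mul (by positivity)]
    refine le_trans ?_ (mul_le_mul_right hI _)
    rw [← lintegral_const_mul' _ _ ENNReal.ofReal_ne_top]
    refine lintegral_mono_ae ?_
    filter_upwards [hae] with x hx
    rw [Real.enorm_eq_ofReal_abs, ENNReal.ofReal_rpow_of_nonneg (abs_nonneg _) (by linarith),
      ← ENNReal.ofReal_mul (by positivity)]
    refine ENNReal.ofReal_le_ofReal ?_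
    calc |f x| ^ r = |f x| ^ (r - 1) * |f x| := by
          rw [← Real.rpow_add_one' (abs_nonneg _) (by linarith), sub_add_cancel]
      _ ≤ _ := by
          gcongr
  refine (ENNReal.rpow_le_rpow h1 (by positivity)).trans (le_of_eq ?_)
  rw [ENNReal.ofReal_rpow_of_nonneg (by positivity) (by positivity),
    Real.mul_rpow hB (by positivity), mul_right_comm,
    ← Real.rpow_add_one' hB (by linarith), sub_add_cancel,
    Real.mul_rpow (by positivity) (by positivity), ← Real.rpow_mul hB, ← Real.rpow_mul (by positivity)]
  have hr0 : r ≠ 0 := by linarith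
  rw [mul_one_div_cancel hr0, Real.rpow_one]
  congr 3
  field_simp

theorem qExp_nonneg {d : ℝ} (hd : 0 < d) {q : ℝ≥0∞} (hq : 1 ≤ q) : 0 ≤ qExp N d q := by
  have h1 : (q⁻¹).toReal ≤ 1 := by
    rw [← ENNReal.toReal_one]
    exact ENNReal.toReal_mono ENNReal.one_ne_top (ENNReal.inv_le_one.2 hq)
  unfold qExp
  have : 0 ≤ 1 - (q⁻¹).toReal := by linarith
  positivity

theorem ofReal_mul_eLpNorm_le {d K B t : ℝ} (ht : 0 ≤ t) (hB : 0 ≤ B) {f : E N → ℝ}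
    (h : essNorm K (scl d (1 + t)) f ≤ ENNReal.ofReal B) {q : ℝ≥0∞} (hq : 1 ≤ q) :
    ENNReal.ofReal ((1 + t) ^ qExp N d q) * eLpNorm f q volume ≤ ENNReal.ofReal B := by
  have h1t : 0 < 1 + t := by linarith
  refine (mul_le_mul_right (eLpNorm_le_of_essNorm (scl_pos h1t) hB h hq) _).trans (le_of_eq ?_)
  rw [← ENNReal.ofReal_mul (by positivity), scl_pow h1t, ← Real.rpow_mul h1t.le, mul_left_comm,
    ← Real.rpow_add h1t, qExp, neg_mul, add_neg_cancel, Real.rpow_zero, mul_one]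

/-- With a ≤ 1 and ℓ ≤ K the rescaled weight a^ℓ + (a|x|)^ℓ is at most 2 + (a|x|)^K, hence at most
twice the weight of the scaled norm. -/
theorem ofReal_mul_wnorm_le {d K B t ℓ : ℝ} (hd : 0 < d) (ht : 0 ≤ t) (hℓ : 0 ≤ ℓ) (hℓK : ℓ ≤ K)
    {f : E N → ℝ} (h : essNorm K (scl d (1 + t)) f ≤ ENNReal.ofReal B) :
    ENNReal.ofReal ((1 + t) ^ (-(ℓ / d))) * wnorm ℓ f ≤ ENNReal.ofReal (2 * B) := by
  have h1t : 0 < 1 + t := by linarith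
  have ha := scl_pos (d := d) h1t
  have ha1 := scl_one_add_le_one hd ht
  rw [← scl_rpow h1t, ENNReal.ofReal_mul zero_le_two]
  refine le_trans ?_ (mul_le_mul_right ((wsum_le_essNorm _ _ _).trans h) _)
  rw [wnorm, wsum, ← lintegral_const_mul' _ _ ENNReal.ofReal_ne_top,
    ← lintegral_const_mul' _ _ ENNReal.ofReal_ne_top]
  refine lintegral_mono fun x => ?_
  rw [mul_left_comm, mul_left_comm (ENNReal.ofReal 2), ← ENNReal.ofReal_mul (by positivity),
    ← ENNReal.ofReal_mul zero_le_two]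
  refine mul_le_mul_right (ENNReal.ofReal_le_ofReal ?_) _
  set a := scl d (1 + t)
  have h2 : a ^ ℓ ≤ 1 := Real.rpow_le_one ha.le ha1 hℓ
  have h3 : (a * ‖x‖) ^ ℓ ≤ 1 + (a * ‖x‖) ^ K := by
    have h0 : 0 ≤ a * ‖x‖ := by positivity
    rcases le_total (a * ‖x‖) 1 with h1 | h1
    · have := Real.rpow_le_one h0 h1 hℓ
      have : 0 ≤ (a * ‖x‖) ^ K := by positivity
      linarith
    · have := Real.rpow_le_rpow_of_exponent_le h1 hℓK
      linarith
  rw [mul_add, ← Real.mul_rpow ha.le (norm_nonneg x), wt]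
  have : 0 ≤ (a * ‖x‖) ^ K := by positivity
  linarith

/-- For t ≥ 1 one has 1 + t ≤ 2t, so replacing 1 + t by t in the negative power costs 2^{ℓ/d}; in
the nonnegative power it costs nothing. -/
theorem errNorm_le {d K B t ℓ : ℝ} (hd : 0 < d) (ht : 1 ≤ t) (hℓ : 0 ≤ ℓ) (hℓK : ℓ ≤ K)
    (hB : 0 ≤ B) {u U : E N → ℝ → ℝ} {q : ℝ≥0∞} (hq : 1 ≤ q)
    (h : essNorm K (scl d (1 + t)) (fun x => u x t - U x t) ≤ ENNReal.ofReal B) :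
    errNorm d q ℓ u U t ≤ ENNReal.ofReal ((1 + 2 ^ (ℓ / d) * 2) * B) := by
  have ht0 : 0 < t := by linarith
  have h1 := ofReal_mul_eLpNorm_le ht0.le hB h hq
  have h2 := ofReal_mul_wnorm_le hd ht0.le hℓ hℓK h
  rw [add_mul, one_mul, ENNReal.ofReal_add hB (by positivity), mul_assoc,
    ENNReal.ofReal_mul (by positivity)]
  refine add_le_add (le_trans ?_ h1) (le_trans ?_ (mul_le_mul_right h2 _))
  · gcongr
    · exact qExp_nonneg hd hq
    · linarith
  · rw [← mul_assoc, ← ENNReal.ofReal_mul (by positivity)]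
    gcongr
    have hc : 0 ≤ ℓ / d := by positivity
    rw [Real.rpow_neg ht0.le, Real.rpow_neg (by linarith), ← div_eq_mul_inv,
      ← Real.div_rpow zero_le_two (by linarith), ← Real.inv_rpow ht0.le]
    refine Real.rpow_le_rpow (by positivity) ?_ hc
    rw [inv_le_comm₀ ht0 (by positivity), inv_div]
    linarith

end GenHeat
end
noncomputable section
namespace GenHeat
variable {N : ℕ}

/-! ### The approximation scheme -/

/-- The hypotheses on the kernel, the initial function, the nonlinearity and the solution. -/
structure Setting (G : E N → ℝ → ℝ) (γ : ℕ) (d L K : ℝ) (φ : E N → ℝ) (F : E N → ℝ → ℝ → ℝ)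
    (Cstar A p Ap : ℝ) (u : E N → ℝ → ℝ) : Prop where
  hd : 0 < d
  hL : 0 < L
  hG : KernelCondition G γ d L
  hK : 0 ≤ K
  hKL : K < L
  hKγ : ⌊K⌋₊ + 1 ≤ γ
  hφ : MemLp φ ∞ volume
  hφK : MemL1k K φ
  hC : 0 < Cstar
  hp : 1 ≤ p
  hFmeas : ∀ v : ℝ, AEStronglyMeasurable (fun z : E N × ℝ => F z.1 z.2 v) (halfSpace N)
  hF0 : ∀ (x : E N) (t : ℝ), 0 < t → F x t 0 = 0
  hF : ∀ (x : E N) (t : ℝ), 0 < t → ∀ u₁ u₂ : ℝ, |F x t u₁ - F x t u₂| ≤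
    Cstar * (1 + t) ^ A * max (|u₁| ^ (p - 1)) (|u₂| ^ (p - 1)) * |u₁ - u₂|
  hAp : Ap = -A + N * (p - 1) / d - 1
  hAp0 : 0 < Ap
  humeas : AEStronglyMeasurable (fun z : E N × ℝ => u z.1 z.2) (halfSpace N)
  hu : IsSolution G F φ u
  hudecay : ∀ q : ℝ≥0∞, 1 ≤ q → ∀ ℓ : ℝ, 0 ≤ ℓ → ℓ ≤ K →
    (⨆ (t : ℝ) (_ : 0 < t), ENNReal.ofReal ((1 + t) ^ qExp N d q) *
        eLpNorm (fun x => u x t) q volume) +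
      (⨆ (t : ℝ) (_ : 0 < t), ENNReal.ofReal ((1 + t) ^ (-(ℓ / d))) *
        wnorm ℓ (fun x => u x t)) < ∞

/-- The difference of `u` and `U` is the sum of the projected linear evolution of `φ` and the
projected Duhamel integral of `h`, where `h` decays at the rate `b`. -/
structure Remainder (G : E N → ℝ → ℝ) (d K : ℝ) (φ : E N → ℝ) (u U : E N → ℝ → ℝ) (C b : ℝ)
    (h : ℝ → E N → ℝ) : Prop where
  meas : JointMeas h
  nonneg : 0 ≤ C
  source : SourceBound d K C b h
  eq : ∀ t : ℝ, 0 < t → ∀ x,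
    u x t - U x t = evol G t (proj G K 0 φ) x + duhamel G K h t x

section Scheme
variable {G : E N → ℝ → ℝ} {γ : ℕ} {d L K : ℝ} {φ : E N → ℝ} {F : E N → ℝ → ℝ → ℝ}
  {Cstar A p Ap C b : ℝ} {u U w : E N → ℝ → ℝ} {h : ℝ → E N → ℝ}

theorem Setting.essNorm_init (S : Setting G γ d L K φ F Cstar A p Ap u) :
    essNorm K (scl d (1 + 0)) φ < ∞ := by
  have h1 : scl d (1 + 0) = 1 := by simp [scl]
  rw [h1, essNorm]
  refine ENNReal.add_lt_top.2 ⟨ENNReal.mul_lt_top ENNReal.ofReal_lt_top S.hφ.2, ?_⟩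
  have h2 := S.hφK.2
  simpa [wsum, wt, wnorm] using h2

theorem Setting.jointMeas_nonlin (S : Setting G γ d L K φ F Cstar A p Ap u)
    (hw : AEStronglyMeasurable (fun z : E N × ℝ => w z.1 z.2) (halfSpace N)) :
    JointMeas (nonlin F w) :=
  aestronglyMeasurable_nonlin S.hp S.hFmeas S.hF hw

/-- Joint measurability would give this for almost every t only; the integral equation, whose
right-hand side has a strongly measurable formula, gives it for every t > 0. -/
theorem Setting.aestronglyMeasurable_slice (S : Setting G γ d L K φ F Cstar A p Ap u) {t : ℝ}
    (ht : 0 < t) : AEStronglyMeasurable (fun x => u x t) volume := by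
  obtain ⟨V, hV, h1⟩ := S.hG.exists_evol_init_strong S.hφ.1
  obtain ⟨W, hW, h2⟩ := S.hG.exists_duhamel_strong (S.jointMeas_nonlin S.humeas)
  refine GenHeat.aestronglyMeasurable_slice (hV.add hW) (t := t) fun x => ?_
  rw [Pi.add_apply, ← h1 x t ht, ← h2 x t ht, S.hu x t ht]
  rfl

theorem Setting.exists_essNorm_le (S : Setting G γ d L K φ F Cstar A p Ap u) :
    ∃ D : ℝ, 0 ≤ D ∧ ∀ t : ℝ, 0 < t →
      essNorm K (scl d (1 + t)) (fun x => u x t) ≤ ENNReal.ofReal D :=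
  exists_essNorm_le_of_decay S.hK (fun _ ht => S.aestronglyMeasurable_slice ht) S.hudecay

theorem Setting.sourceBound_nonlin (S : Setting G γ d L K φ F Cstar A p Ap u)
    (hD : ∃ D : ℝ, 0 ≤ D ∧ ∀ t : ℝ, 0 < t →
      essNorm K (scl d (1 + t)) (fun x => w x t) ≤ ENNReal.ofReal D) :
    ∃ C : ℝ, 0 ≤ C ∧ SourceBound d K C Ap (nonlin F w) := by
  obtain ⟨D, hD, h⟩ := hD
  have := S.hC
  refine ⟨Cstar * D ^ (p - 1) * D, by positivity, ?_⟩
  filter_upwards [ae_restrict_mem measurableSet_Ioi] with s hs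
  exact essNorm_nonlin_le S.hC S.hp S.hF0 S.hF S.hAp hs hD (h s hs)

/-- Splitting the projections off both terms of the integral equation leaves coefficients of
g_α(·,t) that are exactly those of U_0. -/
theorem Setting.remainder_zero (S : Setting G γ d L K φ F Cstar A p Ap u) :
    ∃ C, Remainder G d K φ u (approx G F φ u K 0) C Ap (nonlin F u) := by
  obtain ⟨C, hC, hb⟩ := S.sourceBound_nonlin S.exists_essNorm_le
  have hm := S.jointMeas_nonlin S.humeas
  refine ⟨C, hm, hC, hb, fun t ht x => ?_⟩
  have h1 := S.hG.integral_evol_eq S.hd S.hL S.hK S.hKL S.hKγ hm hC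
    (by linarith [S.hAp0]) hb ht x
  have hi : Integrable φ := integrable_of_wsum S.hK (scl_pos (d := d) (by norm_num)) S.hφ.1
    ((wsum_le_essNorm _ _ _).trans_lt S.essNorm_init)
  have h2 := S.hG.evol_eq S.hL S.hK S.hKγ le_rfl ht hi x
  rw [sub_zero] at h2
  have h3 : u x t = evol G t φ x + ∫ s in (0 : ℝ)..t, evol G (t - s) (nonlin F u s) x :=
    S.hu x t ht
  rw [h3, h1, h2, approx]
  simp only [coeff, add_mul, Finset.sum_add_distrib]
  ring

/-- The Duhamel term of U_{n+1} is subtracted from the remainder of U_0, so the source becomes F -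
F_n. The Lipschitz estimate then adds A_p to the decay rate of u - U_n. -/
theorem Setting.remainder_succ (S : Setting G γ d L K φ F Cstar A p Ap u) {n : ℕ}
    (hm : AEStronglyMeasurable (fun z : E N × ℝ => approx G F φ u K n z.1 z.2) (halfSpace N))
    (hD : ∃ D : ℝ, 0 ≤ D ∧ ∀ t : ℝ, 0 < t →
      essNorm K (scl d (1 + t)) (fun x => approx G F φ u K n x t) ≤ ENNReal.ofReal D)
    {a : ℝ} (ha : RateBound d K a fun t x => u x t - approx G F φ u K n x t) :
    ∃ C, Remainder G d K φ u (approx G F φ u K (n + 1)) C (a + Ap)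
      fun s y => nonlin F u s y - nonlin F (approx G F φ u K n) s y := by
  obtain ⟨C₀, R⟩ := S.remainder_zero
  obtain ⟨C₁, hC₁, b₁⟩ := S.sourceBound_nonlin hD
  have hm₁ := S.jointMeas_nonlin hm
  obtain ⟨D, hD0, hD⟩ := hD
  obtain ⟨D', hD0', hD'⟩ := S.exists_essNorm_le
  obtain ⟨M, hM, ha⟩ := ha
  have := S.hC
  refine ⟨Cstar * (D + D') ^ (p - 1) * M, R.meas.sub hm₁, by positivity, ?_, fun t ht x => ?_⟩
  · filter_upwards [ae_restrict_mem measurableSet_Ioi] with s hs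
    rw [Set.mem_Ioi] at hs
    have h1s : 0 < 1 + s := by linarith
    have := essNorm_nonlin_sub_le S.hC S.hp S.hF S.hAp hs (add_nonneg hD0 hD0')
      ((hD' s hs).trans (ENNReal.ofReal_le_ofReal (by linarith)))
      ((hD s hs).trans (ENNReal.ofReal_le_ofReal (by linarith))) (ha s hs)
    refine this.trans (le_of_eq ?_)
    rw [show -1 - (a + Ap) = -a + (-1 - Ap) by ring, Real.rpow_add h1s]
    congr 1
    ring
  · rw [S.hG.duhamel_sub S.hd S.hL S.hK S.hKL S.hKγ R.meas hm₁ R.nonneg hC₁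
      (by linarith [S.hAp0]) R.source b₁ ht x]
    have h1 := R.eq t ht x
    have h2 : approx G F φ u K (n + 1) x t = approx G F φ u K 0 x t +
        duhamel G K (nonlin F (approx G F φ u K n)) t x := by
      rw [approx, approx]
      rfl
    rw [h2]
    linarith

theorem Remainder.exists_strong (R : Remainder G d K φ u U C b h)
    (S : Setting G γ d L K φ F Cstar A p Ap u) : ∃ V : E N × ℝ → ℝ, StronglyMeasurable V ∧
      ∀ x, ∀ t : ℝ, 0 < t → U x t = u x t - V (x, t) := by
  obtain ⟨V, hV, h1⟩ := S.hG.exists_evol_init_strong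
    (S.hG.aestronglyMeasurable_proj S.hK S.hKγ le_rfl S.hφ.1)
  obtain ⟨W, hW, h2⟩ := S.hG.exists_duhamel_strong (S.hG.jointMeas_proj S.hK S.hKγ R.meas)
  refine ⟨_, hV.add hW, fun x t ht => ?_⟩
  rw [Pi.add_apply, ← h1 x t ht, ← h2 x t ht]
  have := R.eq t ht x
  rw [duhamel] at this
  linarith

theorem Remainder.aestronglyMeasurable (R : Remainder G d K φ u U C b h)
    (S : Setting G γ d L K φ F Cstar A p Ap u) :
    AEStronglyMeasurable (fun z : E N × ℝ => U z.1 z.2) (halfSpace N) := by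
  obtain ⟨V, hV, h1⟩ := R.exists_strong S
  refine (S.humeas.sub hV.aestronglyMeasurable).congr ?_
  filter_upwards [snd_pos_ae] with z hz
  exact (h1 z.1 z.2 hz).symm

theorem Remainder.aestronglyMeasurable_slice (R : Remainder G d K φ u U C b h)
    (S : Setting G γ d L K φ F Cstar A p Ap u) {t : ℝ} (ht : 0 < t) :
    AEStronglyMeasurable (fun x => U x t) volume := by
  obtain ⟨V, hV, h1⟩ := R.exists_strong S
  refine ((S.aestronglyMeasurable_slice ht).sub
    (hV.comp_measurable (measurable_prodMk_right (y := t))).aestronglyMeasurable).congr ?_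
  filter_upwards with x
  exact (h1 x t ht).symm

/-- U is u minus a remainder that does not grow, so it inherits the uniform scaled bound. -/
theorem Remainder.exists_essNorm_le (R : Remainder G d K φ u U C b h)
    (S : Setting G γ d L K φ F Cstar A p Ap u) {a : ℝ} (ha0 : 0 ≤ a)
    (ha : RateBound d K a fun t x => u x t - U x t) :
    ∃ D : ℝ, 0 ≤ D ∧ ∀ t : ℝ, 0 < t →
      essNorm K (scl d (1 + t)) (fun x => U x t) ≤ ENNReal.ofReal D := by
  obtain ⟨D, hD, h1⟩ := S.exists_essNorm_le
  obtain ⟨M, hM, h2⟩ := ha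
  refine ⟨D + M, by positivity, fun t ht => ?_⟩
  have h3 : (fun x => U x t) = fun x => u x t - (u x t - U x t) := by
    funext x
    ring
  rw [h3, ENNReal.ofReal_add hD hM]
  refine (essNorm_sub_le _ _ (S.aestronglyMeasurable_slice ht) ((S.aestronglyMeasurable_slice
    ht).sub (R.aestronglyMeasurable_slice S ht))).trans (add_le_add (h1 t ht) ((h2 t ht).trans ?_))
  refine ENNReal.ofReal_le_ofReal (mul_le_of_le_one_right hM ?_)
  exact Real.rpow_le_one_of_one_le_of_nonpos (by linarith) (by linarith)

/-- The invariant of the iteration: the source exponent is exactly (n+1)A_p, or both it and (n+1)A_p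
have already passed K/d. Beyond K/d the remainder decays no faster than (1+t)^{-K/d} by this method,
so the exact value no longer matters. -/
theorem Remainder.exists_rateBound (R : Remainder G d K φ u U C b h)
    (S : Setting G γ d L K φ F Cstar A p Ap u) {n : ℕ}
    (hb : b = (n + 1) * Ap ∨ (K / d < b ∧ K / d < (n + 1) * Ap)) :
    ∃ a : ℝ, 0 ≤ a ∧ (RateBound d K a fun t x => u x t - U x t) ∧
      (a + Ap = (n + 2) * Ap ∨ (K / d < a + Ap ∧ K / d < (n + 2) * Ap)) := by
  have hp := S.hAp0
  have hKd : 0 ≤ K / d := div_nonneg S.hK S.hd.le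
  have hn : 0 ≤ (n : ℝ) * Ap := by positivity
  rcases lt_trichotomy b (K / d) with h1 | h1 | h1
  · rcases hb with hb | hb
    · refine ⟨b, by rw [hb]; positivity, S.hG.rateBound_of_lt S.hd S.hL S.hK S.hKL S.hKγ S.hφ.1
        S.essNorm_init R.meas R.nonneg R.source R.eq h1, Or.inl ?_⟩
      rw [hb]
      ring
    · exact absurd hb.1 h1.not_gt
  · rcases hb with hb | hb
    -- At equality half of A_p is given up to absorb the logarithm. The next exponent K/d + A_p/2
    -- still exceeds K/d, and K/d = (n+1)A_p keeps the rate nonnegative.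
    · refine ⟨K / d - Ap / 2, by rw [← h1, hb]; linarith, S.hG.rateBound_of_eq S.hd S.hL S.hK S.hKL
        S.hKγ S.hφ.1 S.essNorm_init R.meas R.nonneg R.source R.eq h1 (by positivity),
        Or.inr ⟨by linarith, ?_⟩⟩
      rw [← h1, hb]
      linarith
    · exact absurd hb.1 h1.not_gt
  · refine ⟨K / d, hKd, S.hG.rateBound_of_gt S.hd S.hL S.hK S.hKL
      S.hKγ S.hφ.1 S.essNorm_init R.meas R.nonneg R.source R.eq h1, Or.inr ⟨by linarith, ?_⟩⟩
    rcases hb with hb | hb <;> linarith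

theorem Setting.exists_remainder (S : Setting G γ d L K φ F Cstar A p Ap u) (n : ℕ) :
    ∃ (C b : ℝ) (h : ℝ → E N → ℝ), Remainder G d K φ u (approx G F φ u K n) C b h ∧
      (b = (n + 1) * Ap ∨ (K / d < b ∧ K / d < (n + 1) * Ap)) := by
  induction n with
  | zero =>
    obtain ⟨C, R⟩ := S.remainder_zero
    exact ⟨C, Ap, _, R, Or.inl (by simp)⟩
  | succ n ih =>
    obtain ⟨C, b, h, R, hb⟩ := ih
    obtain ⟨a, ha0, ha, hab⟩ := R.exists_rateBound S hb
    obtain ⟨C', R'⟩ := S.remainder_succ (R.aestronglyMeasurable S)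
      (R.exists_essNorm_le S ha0 ha) ha
    refine ⟨C', a + Ap, _, R', ?_⟩
    have h1 : ((n + 1 : ℕ) : ℝ) + 1 = n + 2 := by push_cast; ring
    rwa [h1]

end Scheme

end GenHeat
end
noncomputable section
namespace GenHeat
variable {N : ℕ}

/-! ### Asymptotics of time integrals -/

theorem isBigO_one_add_rpow_neg {b : ℝ} (hb : 0 ≤ b) :
    (fun t : ℝ => (1 + t) ^ (-b)) =O[atTop] fun t : ℝ => t ^ (-b) := by
  refine IsBigO.of_bound 1 ?_
  filter_upwards [eventually_ge_atTop 1] with t ht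
  have h0 : 0 < t := by linarith
  rw [one_mul, Real.norm_of_nonneg (by positivity), Real.norm_of_nonneg (by positivity)]
  exact Real.rpow_le_rpow_of_nonpos h0 (by linarith) (by linarith)

/-- The threshold 3 exceeds e and ensures 1 + t ≤ t². -/
theorem eventually_log_bound :
    ∀ᶠ t : ℝ in atTop, 1 ≤ Real.log t ∧ Real.log (1 + t) ≤ 2 * Real.log t := by
  filter_upwards [eventually_ge_atTop 3] with t ht
  have h0 : 0 < t := by linarith
  refine ⟨(Real.le_log_iff_exp_le h0).2 (by linarith [Real.exp_one_lt_d9]), ?_⟩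
  calc Real.log (1 + t) ≤ Real.log (t ^ 2) := Real.log_le_log (by linarith) (by nlinarith)
    _ = _ := by rw [Real.log_pow]; norm_num

theorem isBigO_one_add_log :
    (fun t : ℝ => 1 + Real.log (1 + t)) =O[atTop] fun t : ℝ => Real.log t := by
  refine IsBigO.of_bound 3 ?_
  filter_upwards [eventually_log_bound, eventually_ge_atTop 0] with t ht h0
  have h1 : 0 ≤ Real.log (1 + t) := Real.log_nonneg (by linarith)
  rw [Real.norm_of_nonneg (by linarith), Real.norm_of_nonneg (by linarith)]
  linarith

section Primitive
variable {m : ℝ → ℝ} {C e : ℝ}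

theorem abs_integral_le_of_bound
    (hb : ∀ᵐ s ∂volume.restrict (Set.Ioi 0), |m s| ≤ C * (1 + s) ^ (e - 1))
    {t : ℝ} (ht : 0 ≤ t) :
    |∫ s in (0 : ℝ)..t, m s| ≤ C * ∫ s in (0 : ℝ)..t, (1 + s) ^ (e - 1) := by
  rw [← intervalIntegral.integral_const_mul, ← Real.norm_eq_abs]
  refine intervalIntegral.norm_integral_le_of_norm_le ht ?_ ?_
  · exact (ae_restrict_iff' measurableSet_Ioc).1 (ae_Ioc_of_Ioi hb t)
  · rw [intervalIntegrable_iff_integrableOn_Ioc_of_le ht]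
    exact (((continuousOn_one_add_rpow _ t).integrableOn_compact isCompact_Icc).mono_set
      Set.Ioc_subset_Icc_self).const_mul _

/-- The limit is c₀ plus the integral over the whole half-line, and the error is the tail beyond t,
bounded by C∫_t^∞ s^{e-1} ds. -/
theorem exists_isBigO_integral_of_neg
    (hm : ∀ t : ℝ, 0 < t → IntervalIntegrable m volume 0 t)
    (hms : AEStronglyMeasurable m (volume.restrict (Set.Ioi 0))) (hC : 0 ≤ C)
    (hb : ∀ᵐ s ∂volume.restrict (Set.Ioi 0), |m s| ≤ C * (1 + s) ^ (e - 1)) (he : e < 0) (c₀ : ℝ) :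
    ∃ c : ℝ, (fun t : ℝ => c₀ + (∫ s in (0 : ℝ)..t, m s) - c) =O[atTop] fun t : ℝ => t ^ e := by
  have hsub : ∀ t : ℝ, 0 ≤ t → volume.restrict (Set.Ioi t) ≤ volume.restrict (Set.Ioi (0 : ℝ)) :=
    fun t ht => Measure.restrict_mono (Set.Ioi_subset_Ioi ht) le_rfl
  have hle : ∀ t : ℝ, 0 < t → ∀ᵐ s ∂volume.restrict (Set.Ioi t), ‖m s‖ ≤ C * s ^ (e - 1) := by
    intro t ht
    filter_upwards [ae_mono (hsub t ht.le) hb, ae_restrict_mem measurableSet_Ioi] with s hs hst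
    rw [Set.mem_Ioi] at hst
    refine hs.trans (mul_le_mul_of_nonneg_left ?_ hC)
    exact Real.rpow_le_rpow_of_nonpos (by linarith) (by linarith) (by linarith)
  have hgi : ∀ t : ℝ, 0 < t → IntegrableOn (fun s : ℝ => C * s ^ (e - 1)) (Set.Ioi t) :=
    fun t ht => (integrableOn_Ioi_rpow_of_lt (by linarith) ht).const_mul C
  have hmi : ∀ t : ℝ, 0 < t → IntegrableOn m (Set.Ioi t) := fun t ht =>
    Integrable.mono' (hgi t ht) (hms.mono_measure (hsub t ht.le)) (hle t ht)
  refine ⟨c₀ + ∫ s in Set.Ioi 0, m s, IsBigO.of_bound (C * (-e)⁻¹) ?_⟩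
  filter_upwards [eventually_gt_atTop 0] with t ht
  have h1 : IntegrableOn m (Set.Ioc 0 t) :=
    (intervalIntegrable_iff_integrableOn_Ioc_of_le ht.le).1 (hm t ht)
  have h2 : ∫ s in Set.Ioi 0, m s = (∫ s in (0 : ℝ)..t, m s) + ∫ s in Set.Ioi t, m s := by
    rw [intervalIntegral.integral_of_le ht.le, ← setIntegral_union
      (Set.Ioc_disjoint_Ioi le_rfl) measurableSet_Ioi h1 (hmi t ht),
      Set.Ioc_union_Ioi_eq_Ioi ht.le]
  have h3 : c₀ + (∫ s in (0 : ℝ)..t, m s) - (c₀ + ∫ s in Set.Ioi 0, m s) =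
      -∫ s in Set.Ioi t, m s := by
    rw [h2]
    ring
  rw [h3, norm_neg, Real.norm_of_nonneg (Real.rpow_nonneg ht.le _)]
  refine (norm_integral_le_of_norm_le (hgi t ht) (hle t ht)).trans (le_of_eq ?_)
  rw [integral_const_mul, integral_Ioi_rpow_of_lt (by linarith) ht, sub_add_cancel]
  rw [neg_div, ← div_neg]
  ring

theorem isBigO_integral_of_pos (hC : 0 ≤ C)
    (hb : ∀ᵐ s ∂volume.restrict (Set.Ioi 0), |m s| ≤ C * (1 + s) ^ (e - 1)) (he : 0 < e) (c₀ : ℝ) :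
    (fun t : ℝ => c₀ + ∫ s in (0 : ℝ)..t, m s) =O[atTop] fun t : ℝ => t ^ e := by
  refine IsBigO.of_bound (|c₀| + C * (2 ^ e / e)) ?_
  filter_upwards [eventually_ge_atTop 1] with t ht
  have h0 : 0 < t := by linarith
  have h1 : (1 + t) ^ e ≤ 2 ^ e * t ^ e := by
    rw [← Real.mul_rpow zero_le_two h0.le]
    exact Real.rpow_le_rpow (by linarith) (by linarith) he.le
  have h2 : 1 ≤ t ^ e := Real.one_le_rpow ht he.le
  rw [Real.norm_of_nonneg (Real.rpow_nonneg h0.le e)]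
  calc ‖c₀ + ∫ s in (0 : ℝ)..t, m s‖ ≤ |c₀| + |∫ s in (0 : ℝ)..t, m s| := abs_add_le _ _
    _ ≤ |c₀| * t ^ e + C * (2 ^ e * t ^ e / e) := by
        refine add_le_add (le_mul_of_one_le_right (abs_nonneg _) h2)
          ((abs_integral_le_of_bound hb h0.le).trans (mul_le_mul_of_nonneg_left ?_ hC))
        exact (integral_one_add_rpow_le he).trans (by gcongr)
    _ = _ := by ring

theorem isBigO_integral_log (hC : 0 ≤ C)
    (hb : ∀ᵐ s ∂volume.restrict (Set.Ioi 0), |m s| ≤ C * (1 + s) ^ (0 - 1 : ℝ)) (c₀ : ℝ) :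
    (fun t : ℝ => c₀ + ∫ s in (0 : ℝ)..t, m s) =O[atTop] fun t : ℝ => Real.log t := by
  refine IsBigO.of_bound (|c₀| + C * 2) ?_
  filter_upwards [eventually_ge_atTop 1, eventually_log_bound] with t ht hl
  rw [Real.norm_of_nonneg (by linarith : 0 ≤ Real.log t)]
  have h1 := abs_integral_le_of_bound hb (by linarith : 0 ≤ t)
  rw [integral_one_add_rpow_eq_log (by linarith)] at h1
  calc ‖c₀ + ∫ s in (0 : ℝ)..t, m s‖ ≤ |c₀| + |∫ s in (0 : ℝ)..t, m s| := abs_add_le _ _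
    _ ≤ |c₀| * Real.log t + C * (2 * Real.log t) :=
        add_le_add (le_mul_of_one_le_right (abs_nonneg _) hl.1)
          (h1.trans (mul_le_mul_of_nonneg_left hl.2 hC))
    _ = _ := by ring

end Primitive

/-! ### The conclusions -/

section Scheme
variable {G : E N → ℝ → ℝ} {γ : ℕ} {d L K : ℝ} {φ : E N → ℝ} {F : E N → ℝ → ℝ → ℝ}
  {Cstar A p Ap C b : ℝ} {u U w : E N → ℝ → ℝ} {h k : ℝ → E N → ℝ}

/-- The integrand is O((1+s)^{e-1}) with e = |α|/d - A_p, and the three cases are the signs of e. -/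
theorem Setting.coeff_asymptotics (S : Setting G γ d L K φ F Cstar A p Ap u) {α : Fin N → ℕ}
    (hα : (len α : ℝ) ≤ K) :
    (∀ t : ℝ, 0 < t → IntervalIntegrable
      (fun s => moment G (nonlin F u s) s α) volume 0 t) ∧
    ((len α : ℝ) / d < Ap → ∃ c : ℝ,
      (fun t => coeff G F φ u α t - c) =O[atTop] fun t : ℝ => t ^ (-Ap + (len α : ℝ) / d)) ∧
    (Ap < (len α : ℝ) / d →
      (fun t => coeff G F φ u α t) =O[atTop] fun t : ℝ => t ^ (-Ap + (len α : ℝ) / d)) ∧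
    (Ap = (len α : ℝ) / d →
      (fun t => coeff G F φ u α t) =O[atTop] fun t : ℝ => Real.log t) := by
  obtain ⟨C₀, R⟩ := S.remainder_zero
  obtain ⟨C, hC, hb⟩ := S.hG.exists_abs_moment_le R.nonneg R.source hα
  have hi : ∀ t : ℝ, 0 < t → IntervalIntegrable (fun s => moment G (nonlin F u s) s α) volume 0 t :=
    fun t ht => S.hG.intervalIntegrable_moment R.meas R.nonneg R.source hα ht.le
  have he : -Ap + (len α : ℝ) / d = len α / d - Ap := by ring
  rw [he]
  refine ⟨hi, fun h => ?_, fun h => ?_, fun h => ?_⟩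
  · exact exists_isBigO_integral_of_neg hi (S.hG.aestronglyMeasurable_moment R.meas α) hC hb
      (by linarith) _
  · exact isBigO_integral_of_pos hC hb (by linarith) _
  · rw [sub_eq_zero.2 h.symm] at hb
    exact isBigO_integral_log hC hb _

theorem KernelCondition.integral_moment_sub (hG : KernelCondition G γ d L) (hh : JointMeas h)
    (hk : JointMeas k) {C₁ C₂ : ℝ} (h₁ : 0 ≤ C₁) (h₂ : 0 ≤ C₂)
    (hb : SourceBound d K C₁ b h) (kb : SourceBound d K C₂ b k) {α : Fin N → ℕ}
    (hα : (len α : ℝ) ≤ K) {t : ℝ} (ht : 0 < t) :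
    ∫ s in (0 : ℝ)..t, moment G (fun y => h s y - k s y) s α =
      (∫ s in (0 : ℝ)..t, moment G (h s) s α) - ∫ s in (0 : ℝ)..t, moment G (k s) s α := by
  rw [← intervalIntegral.integral_sub (hG.intervalIntegrable_moment hh h₁ hb hα ht.le)
    (hG.intervalIntegrable_moment hk h₂ kb hα ht.le), intervalIntegral.integral_of_le ht.le,
    intervalIntegral.integral_of_le ht.le]
  refine integral_congr_ae ?_
  filter_upwards [ae_Ioc_of_Ioi (hb.integrable hh) t, ae_Ioc_of_Ioi (kb.integrable hk) t]
    with s i₁ i₂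
  have hle : ∀ β ≤ α, (len β : ℝ) ≤ K := fun β hβ => (Nat.cast_le.2 (len_mono hβ)).trans hα
  exact moment_sub G s α (fun β hβ => i₁ β (hle β hβ)) (fun β hβ => i₂ β (hle β hβ))

/-- Removing the projection from the Duhamel term of U_{n+1} subtracts the time-integrated moments
of F_n from the coefficients c_α(t). The integrals converge absolutely because the sources are
bounded in L^∞ and the kernel has the same finite absolute mass at all positive times. -/
theorem Setting.approx_structure (S : Setting G γ d L K φ F Cstar A p Ap u) (n : ℕ) :
    (∀ t : ℝ, 0 < t → AEStronglyMeasurable (fun x => approx G F φ u K n x t) volume) ∧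
    (∀ (x : E N) (t : ℝ), 0 < t →
      Integrable (fun z : E N × ℝ => G (x - z.1) (t - z.2) *
        proj G K z.2 (nonlin F (approx G F φ u K n) z.2) z.1) (slab N t) ∧
      Integrable (fun z : E N × ℝ => G (x - z.1) (t - z.2) *
        nonlin F (approx G F φ u K n) z.2 z.1) (slab N t) ∧
      (∀ α ∈ multiIdx N K, IntervalIntegrable
        (fun s => moment G (fun y => nonlin F u s y -
          nonlin F (approx G F φ u K n) s y) s α) volume 0 t) ∧
      approx G F φ u K (n + 1) x t =
        (∑ α ∈ multiIdx N K, (moment G φ 0 α +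
          ∫ s in (0 : ℝ)..t, moment G (fun y => nonlin F u s y -
            nonlin F (approx G F φ u K n) s y) s α) * gker G α x t) +
        ∫ s in (0 : ℝ)..t, evol G (t - s) (nonlin F (approx G F φ u K n) s) x) := by
  obtain ⟨C₀, R₀⟩ := S.remainder_zero
  obtain ⟨C, b, h, R, hb⟩ := S.exists_remainder n
  obtain ⟨a, ha0, ha, -⟩ := R.exists_rateBound S hb
  obtain ⟨C₁, hC₁, b₁⟩ := S.sourceBound_nonlin (R.exists_essNorm_le S ha0 ha)
  have hm := S.jointMeas_nonlin (R.aestronglyMeasurable S)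
  obtain ⟨C₂, hC₂, b₂⟩ := b₁.proj S.hG S.hK S.hKL S.hKγ hm hC₁
  have hb1 : -1 ≤ Ap := by linarith [S.hAp0]
  refine ⟨fun t ht => R.aestronglyMeasurable_slice S ht, fun x t ht => ⟨?_, ?_, fun α hα => ?_, ?_⟩⟩
  · exact S.hG.integrable_slab S.hL (S.hG.jointMeas_proj S.hK S.hKγ hm)
      (ae_Ioc_of_Ioi (b₂.eLpNorm_top S.hd hC₂ hb1) t) x
  · exact S.hG.integrable_slab S.hL hm (ae_Ioc_of_Ioi (b₁.eLpNorm_top S.hd hC₁ hb1) t) x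
  · exact S.hG.intervalIntegrable_moment (R₀.meas.sub hm) (add_nonneg R₀.nonneg hC₁)
      (SourceBound.sub R₀.meas hm R₀.nonneg hC₁ R₀.source b₁) ((mem_multiIdx S.hK α).1 hα) ht.le
  · have h1 : ∀ α ∈ multiIdx N K, (moment G φ 0 α +
          ∫ s in (0 : ℝ)..t, moment G (fun y => nonlin F u s y -
            nonlin F (approx G F φ u K n) s y) s α) * gker G α x t =
        coeff G F φ u α t * gker G α x t -
          (∫ s in (0 : ℝ)..t, moment G (nonlin F (approx G F φ u K n) s) s α) *
            gker G α x t := by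
      intro α hα
      rw [S.hG.integral_moment_sub R₀.meas hm R₀.nonneg hC₁ R₀.source b₁
        ((mem_multiIdx S.hK α).1 hα) ht, coeff]
      ring
    rw [Finset.sum_congr rfl h1, Finset.sum_sub_distrib,
      S.hG.integral_evol_eq S.hd S.hL S.hK S.hKL S.hKγ hm hC₁ hb1 b₁ ht x, approx, duhamel]
    ring

theorem Setting.approx_bounded (S : Setting G γ d L K φ F Cstar A p Ap u) (n : ℕ) {q : ℝ≥0∞}
    (hq : 1 ≤ q) {ℓ : ℝ} (hℓ : 0 ≤ ℓ) (hℓK : ℓ ≤ K) :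
    (⨆ (t : ℝ) (_ : 0 < t), ENNReal.ofReal (t ^ qExp N d q) *
        eLpNorm (fun x => approx G F φ u K n x t) q volume) +
      (⨆ (t : ℝ) (_ : 0 < t), ENNReal.ofReal ((1 + t) ^ (-(ℓ / d))) *
        wnorm ℓ (fun x => approx G F φ u K n x t)) < ∞ := by
  obtain ⟨C, b, h, R, hb⟩ := S.exists_remainder n
  obtain ⟨a, ha0, ha, -⟩ := R.exists_rateBound S hb
  obtain ⟨D, hD, H⟩ := R.exists_essNorm_le S ha0 ha
  refine ENNReal.add_lt_top.2 ⟨lt_of_le_of_lt (b := ENNReal.ofReal D) (iSup₂_le fun t ht => ?_)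
    ENNReal.ofReal_lt_top, lt_of_le_of_lt (b := ENNReal.ofReal (2 * D)) (iSup₂_le fun t ht => ?_)
    ENNReal.ofReal_lt_top⟩
  · refine le_trans ?_ (ofReal_mul_eLpNorm_le ht.le hD (H t ht) hq)
    gcongr
    · exact qExp_nonneg S.hd hq
    · linarith
  · exact ofReal_mul_wnorm_le S.hd ht.le hℓ hℓK (H t ht)

theorem Setting.errNorm_rate (S : Setting G γ d L K φ F Cstar A p Ap u) (n : ℕ) {q : ℝ≥0∞}
    (hq : 1 ≤ q) {ℓ : ℝ} (hℓ : 0 ≤ ℓ) (hℓK : ℓ ≤ K) (hne : (n + 1) * Ap ≠ K / d) :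
    ∃ a b : ℝ → ℝ, (a =o[atTop] fun t : ℝ => t ^ (-(K / d))) ∧
      (b =O[atTop] fun t : ℝ => t ^ (-((n + 1) * Ap))) ∧
      ∀ᶠ t in atTop, errNorm d q ℓ u (approx G F φ u K n) t ≤ ENNReal.ofReal (a t + b t) := by
  obtain ⟨C, b, h, R, hb⟩ := S.exists_remainder n
  have hp := S.hAp0
  have hKd : 0 ≤ K / d := div_nonneg S.hK S.hd.le
  -- Below K/d the exponent is exactly (n+1)A_p and the error is purely of O type; above K/d it is
  -- purely of o type. One of the two witnesses is therefore zero.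
  rcases lt_or_gt_of_ne hne with h1 | h1
  · obtain rfl : b = (n + 1) * Ap := hb.resolve_right fun h2 => h2.2.not_gt h1
    obtain ⟨M, hM, H⟩ := S.hG.rateBound_of_lt S.hd S.hL S.hK S.hKL S.hKγ S.hφ.1 S.essNorm_init
      R.meas R.nonneg R.source R.eq h1
    refine ⟨fun _ => 0, fun t => (1 + 2 ^ (ℓ / d) * 2) * M * (1 + t) ^ (-((n + 1) * Ap)),
      isLittleO_zero _ _, (isBigO_one_add_rpow_neg (by positivity)).const_mul_left _, ?_⟩
    filter_upwards [eventually_ge_atTop 1] with t ht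
    have h1t : 0 < 1 + t := by linarith
    have := errNorm_le S.hd ht hℓ hℓK (by positivity) hq (H t (by linarith))
    rwa [zero_add, mul_assoc]
  · have hbK : K / d < b := by
      rcases hb with rfl | hb
      exacts [h1, hb.1]
    have hlim := S.hG.tendsto_essNorm_remainder S.hd S.hL S.hK S.hKL S.hKγ S.hφ.1 S.essNorm_init
      R.meas R.nonneg R.source R.eq hbK
    obtain ⟨M, hM, H⟩ := S.hG.rateBound_of_gt S.hd S.hL S.hK S.hKL S.hKγ S.hφ.1 S.essNorm_init
      R.meas R.nonneg R.source R.eq hbK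
    set e : ℝ → ℝ≥0∞ := fun t =>
      essNorm K (scl d (1 + t)) fun x => u x t - approx G F φ u K n x t with hedef
    have hlim' : (fun t : ℝ => (ENNReal.ofReal ((1 + t) ^ (K / d)) * e t).toReal) =o[atTop]
        fun _ => (1 : ℝ) := by
      rw [isLittleO_one_iff]
      exact (ENNReal.tendsto_toReal ENNReal.zero_ne_top).comp hlim
    -- This witness is a constant times the scaled norm itself, written as a factor tending to 0
    -- times (1+t)^{-K/d}. The rate bound serves only to make the norm finite, so that its real
    -- value is faithful.
    refine ⟨fun t => (1 + 2 ^ (ℓ / d) * 2) * ((ENNReal.ofReal ((1 + t) ^ (K / d)) * e t).toReal *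
      (1 + t) ^ (-(K / d))), fun _ => 0, IsLittleO.const_mul_left ?_ _, isBigO_zero _ _, ?_⟩
    · simpa using hlim'.mul_isBigO (isBigO_one_add_rpow_neg hKd)
    · filter_upwards [eventually_ge_atTop 1] with t ht
      have ht0 : 0 < t := by linarith
      have h1t : 0 < 1 + t := by linarith
      have he : e t ≠ ∞ := ((H t ht0).trans_lt ENNReal.ofReal_lt_top).ne
      have := errNorm_le S.hd ht hℓ hℓK (ENNReal.toReal_nonneg (a := e t)) hq
        (ENNReal.ofReal_toReal he).ge
      have h2 : (ENNReal.ofReal ((1 + t) ^ (K / d)) * e t).toReal * (1 + t) ^ (-(K / d)) =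
          (e t).toReal := by
        rw [ENNReal.toReal_mul, ENNReal.toReal_ofReal (by positivity), mul_right_comm,
          ← Real.rpow_add h1t, add_neg_cancel, Real.rpow_zero, one_mul]
      rwa [h2, add_zero]

theorem Setting.errNorm_rate_critical (S : Setting G γ d L K φ F Cstar A p Ap u) (n : ℕ)
    {q : ℝ≥0∞} (hq : 1 ≤ q) {ℓ : ℝ} (hℓ : 0 ≤ ℓ) (hℓK : ℓ ≤ K) (heq : (n + 1) * Ap = K / d) :
    ∃ b : ℝ → ℝ, (b =O[atTop] fun t : ℝ => t ^ (-(K / d)) * Real.log t) ∧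
      ∀ᶠ t in atTop, errNorm d q ℓ u (approx G F φ u K n) t ≤ ENNReal.ofReal (b t) := by
  obtain ⟨C, b, h, R, hb⟩ := S.exists_remainder n
  have hKd : 0 ≤ K / d := div_nonneg S.hK S.hd.le
  -- Equality rules out the alternative in which (n+1)A_p strictly exceeds K/d.
  have hbe : b = K / d := (hb.resolve_right fun h2 => h2.2.ne heq.symm).trans heq
  obtain ⟨M, hM, H⟩ := S.hG.exists_essNorm_le_log S.hd S.hL S.hK S.hKL S.hKγ S.hφ.1 S.essNorm_init
    R.meas R.nonneg R.source R.eq hbe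
  refine ⟨fun t => (1 + 2 ^ (ℓ / d) * 2) * M *
    ((1 + t) ^ (-(K / d)) * (1 + Real.log (1 + t))),
    ((isBigO_one_add_rpow_neg hKd).mul isBigO_one_add_log).const_mul_left _, ?_⟩
  filter_upwards [eventually_ge_atTop 1] with t ht
  have h1t : 0 < 1 + t := by linarith
  have h2 : 0 ≤ Real.log (1 + t) := Real.log_nonneg (by linarith)
  have := errNorm_le S.hd ht hℓ hℓK (by positivity) hq (H t (by linarith))
  rwa [← mul_assoc, mul_assoc _ M, mul_assoc _ (M * _)]

end Scheme

end GenHeat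
end
-- The main theorem
theorem theorem5p1 {N : ℕ} (hN : 1 ≤ N)
    -- the kernel
    (G : GenHeat.E N → ℝ → ℝ) (γ : ℕ) (d L : ℝ) (hd : 0 < d) (hL : 0 < L)
    (hG : GenHeat.KernelCondition G γ d L)
    -- the initial function
    (K : ℝ) (hK0 : 0 ≤ K) (hKL : K < L) (hKγ : ⌊K⌋₊ + 1 ≤ γ)
    (φ : GenHeat.E N → ℝ) (hφ : MemLp φ ∞ volume) (hφK : GenHeat.MemL1k K φ)
    -- the nonlinearity
    (F : GenHeat.E N → ℝ → ℝ → ℝ) (Cstar A p Ap : ℝ) (hC : 0 < Cstar) (hp : 1 ≤ p)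
    (hFmeas : ∀ v : ℝ, AEStronglyMeasurable (fun z : GenHeat.E N × ℝ => F z.1 z.2 v)
      (GenHeat.halfSpace N))
    (hF0 : ∀ (x : GenHeat.E N) (t : ℝ), 0 < t → F x t 0 = 0)
    (hF : ∀ (x : GenHeat.E N) (t : ℝ), 0 < t → ∀ u₁ u₂ : ℝ,
      |F x t u₁ - F x t u₂| ≤
        Cstar * (1 + t) ^ A * max (|u₁| ^ (p - 1)) (|u₂| ^ (p - 1)) * |u₁ - u₂|)
    (hAp : Ap = -A + N * (p - 1) / d - 1) (hAp0 : 0 < Ap)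
    -- the solution
    (u : GenHeat.E N → ℝ → ℝ)
    (humeas : AEStronglyMeasurable (fun z : GenHeat.E N × ℝ => u z.1 z.2) (GenHeat.halfSpace N))
    (hu : GenHeat.IsSolution G F φ u)
    (hudecay : ∀ q : ℝ≥0∞, 1 ≤ q → ∀ ℓ : ℝ, 0 ≤ ℓ → ℓ ≤ K →
      (⨆ (t : ℝ) (_ : 0 < t), ENNReal.ofReal ((1 + t) ^ GenHeat.qExp N d q) *
          eLpNorm (fun x => u x t) q volume) +
        (⨆ (t : ℝ) (_ : 0 < t), ENNReal.ofReal ((1 + t) ^ (-(ℓ / d))) *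
          GenHeat.wnorm ℓ (fun x => u x t)) < ∞) :
    -- (i) behaviour of the coefficients
    (∀ α : Fin N → ℕ, (GenHeat.len α : ℝ) ≤ K →
      (∀ t : ℝ, 0 < t → IntervalIntegrable
        (fun s => GenHeat.moment G (GenHeat.nonlin F u s) s α) volume 0 t) ∧
      ((GenHeat.len α : ℝ) / d < Ap → ∃ c : ℝ,
        (fun t => GenHeat.coeff G F φ u α t - c) =O[atTop]
          fun t : ℝ => t ^ (-Ap + (GenHeat.len α : ℝ) / d)) ∧
      (Ap < (GenHeat.len α : ℝ) / d →
        (fun t => GenHeat.coeff G F φ u α t) =O[atTop]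
          fun t : ℝ => t ^ (-Ap + (GenHeat.len α : ℝ) / d)) ∧
      (Ap = (GenHeat.len α : ℝ) / d →
        (fun t => GenHeat.coeff G F φ u α t) =O[atTop] fun t : ℝ => Real.log t)) ∧
    -- (ii) the approximations `U_n`
    (∀ n : ℕ,
      -- the integrals defining `U_{n+1}` converge absolutely, and the two expressions for
      -- `U_{n+1}` agree
      (∀ t : ℝ, 0 < t →
        AEStronglyMeasurable (fun x => GenHeat.approx G F φ u K n x t) volume) ∧
      (∀ (x : GenHeat.E N) (t : ℝ), 0 < t →
        Integrable (fun z : GenHeat.E N × ℝ => G (x - z.1) (t - z.2) *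
          GenHeat.proj G K z.2 (GenHeat.nonlin F (GenHeat.approx G F φ u K n) z.2) z.1)
          (GenHeat.slab N t) ∧
        Integrable (fun z : GenHeat.E N × ℝ => G (x - z.1) (t - z.2) *
          GenHeat.nonlin F (GenHeat.approx G F φ u K n) z.2 z.1) (GenHeat.slab N t) ∧
        (∀ α ∈ GenHeat.multiIdx N K, IntervalIntegrable
          (fun s => GenHeat.moment G (fun y => GenHeat.nonlin F u s y -
            GenHeat.nonlin F (GenHeat.approx G F φ u K n) s y) s α) volume 0 t) ∧
        GenHeat.approx G F φ u K (n + 1) x t =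
          (∑ α ∈ GenHeat.multiIdx N K, (GenHeat.moment G φ 0 α +
            ∫ s in (0 : ℝ)..t, GenHeat.moment G (fun y => GenHeat.nonlin F u s y -
              GenHeat.nonlin F (GenHeat.approx G F φ u K n) s y) s α) * GenHeat.gker G α x t) +
          ∫ s in (0 : ℝ)..t,
            GenHeat.evol G (t - s) (GenHeat.nonlin F (GenHeat.approx G F φ u K n) s) x) ∧
      -- boundedness and approximation
      ∀ q : ℝ≥0∞, 1 ≤ q → ∀ ℓ : ℝ, 0 ≤ ℓ → ℓ ≤ K →
        ((⨆ (t : ℝ) (_ : 0 < t), ENNReal.ofReal (t ^ GenHeat.qExp N d q) *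
            eLpNorm (fun x => GenHeat.approx G F φ u K n x t) q volume) +
          (⨆ (t : ℝ) (_ : 0 < t), ENNReal.ofReal ((1 + t) ^ (-(ℓ / d))) *
            GenHeat.wnorm ℓ (fun x => GenHeat.approx G F φ u K n x t)) < ∞) ∧
        ((n + 1) * Ap ≠ K / d → ∃ a b : ℝ → ℝ,
          (a =o[atTop] fun t : ℝ => t ^ (-(K / d))) ∧
          (b =O[atTop] fun t : ℝ => t ^ (-((n + 1) * Ap))) ∧
          ∀ᶠ t in atTop, GenHeat.errNorm d q ℓ u (GenHeat.approx G F φ u K n) t ≤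
            ENNReal.ofReal (a t + b t)) ∧
        ((n + 1) * Ap = K / d → ∃ b : ℝ → ℝ,
          (b =O[atTop] fun t : ℝ => t ^ (-(K / d)) * Real.log t) ∧
          ∀ᶠ t in atTop, GenHeat.errNorm d q ℓ u (GenHeat.approx G F φ u K n) t ≤
            ENNReal.ofReal (b t))) := by
  have S : GenHeat.Setting G γ d L K φ F Cstar A p Ap u :=
    ⟨hd, hL, hG, hK0, hKL, hKγ, hφ, hφK, hC, hp, hFmeas, hF0, hF, hAp, hAp0, humeas, hu, hudecay⟩
  refine ⟨fun α hα => S.coeff_asymptotics hα, fun n => ?_⟩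
  obtain ⟨h1, h2⟩ := S.approx_structure n
  exact ⟨h1, h2, fun q hq ℓ hℓ hℓK => ⟨S.approx_bounded n hq hℓ hℓK,
    S.errNorm_rate n hq hℓ hℓK, S.errNorm_rate_critical n hq hℓ hℓK⟩⟩
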